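/- **Setting.** Let $\gamma>1$, $\alpha=\frac{\gamma-1}2$, $\beta_1=\frac1{1+\alpha}$, $\kappa_0>1$, $M>1$. For $\varepsilon>0$, $a\ne0$, $T>-\varepsilon$ put $I=[-\varepsilon,T)$, and let $(u,\rho,k)$, $\rho>0$, be a classical ($C^4$) solution on $I\times\mathbb R^3$ of the compressible Euler system with damping, in the rescaled time $t=\frac{1+\alpha}2t_{\rm phys}$: $$\tfrac1{2\beta_1}\partial_t\rho+u\cdot\nabla\rho=-\rho\,\mathrm{div}\,u,\quad \tfrac1{2\beta_1}\partial_tu+u\cdot\nabla u=-\tfrac1\rho\nabla p-au,\quad \tfrac1{2\beta_1}\partial_tk+u\cdot\nabla k=0,\qquad p=\tfrac1\gamma\rho^\gamma e^k .$$ Let $\sigma=\frac1\alpha\rho^\alpha e^{k/2}$ and let $\zeta=\rho^{-1}\,\mathrm{curl}\,u$ be the specific vorticity. **Modulation and coordinates.** Let $\kappa,\tau\in\mathbb R$, $\xi\in\mathbb R^3$, $\check n=(n_2,n_3)\in\mathbb R^2$ and the symmetric matrix $\phi=(\phi_{\mu\nu})_{\mu,\nu\in\{2,3\}}$ be $C^1$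 functions on $I$ with $\kappa(-\varepsilon)=\kappa_0$, $\tau(-\varepsilon)=0$, $\xi(-\varepsilon)=0$, $\check n(-\varepsilon)=0$ and $\tau(t)>t$. With $n_1=\sqrt{1-|\check n|^2}$ let $$R=\begin{pmatrix} n_1&-n_2&-n_3\\ n_2&1-\frac{n_2^2}{1+n_1}&-\frac{n_2n_3}{1+n_1}\\ n_3&-\frac{n_2n_3}{1+n_1}&1-\frac{n_3^2}{1+n_1}\end{pmatrix}.$$ Write $\check x=(x_2,x_3)$, $f=\frac12\phi_{\mu\nu}x_\mu x_\nu$, $f_{,\mu}=\phi_{\mu\nu}x_\nu$, $J=\sqrt{1+f_{,2}^2+f_{,3}^2}$, $N=J^{-1}(1,-f_{,2},-f_{,3})$, $T^2=\big(\frac{f_{,2}}J,1-\frac{f_{,2}^2}{J(J+1)},-\frac{f_{,2}f_{,3}}{J(J+1)}\big)$, $T^3=\big(\frac{f_{,3}}J,-\frac{f_{,2}f_{,3}}{J(J+1)},1-\frac{f_{,3}^2}{J(J+1)}\big)$. The point with adapted coordinates $x$ at time $t$ is $X(t,x)=R(t)(x_1+f,x_2,x_3)^{\mathsf T}+\xi(t)$.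 Put $\mathring u(x,t)=R^{\mathsf T}u(X(t,x),t)$, $\mathring\zeta(x,t)=R^{\mathsf T}\zeta(X(t,x),t)$, $\mathring\sigma(x,t)=\sigma(X(t,x),t)$, $\mathring k(x,t)=k(X(t,x),t)$, $w=\mathring u\cdot N+\mathring\sigma$, $z=\mathring u\cdot N-\mathring\sigma$, $a_\nu=\mathring u\cdot T^\nu$. Let $s=-\log(\tau(t)-t)$, $y_1=e^{3s/2}x_1$, $\check y=e^{s/2}\check x$, and define $$w=e^{-s/2}W(y,s)+\kappa,\qquad z=Z(y,s),\qquad a_\nu=A_\nu(y,s),\qquad \mathring k=K(y,s).$$ The modulation functions are such that, for all $t\in I$, at $y=0$: $W=0$, $\partial_1W=-1$, $\check\nabla W=0$, $\nabla^2W=0$. Let $Y(s)=\{|y_1|\le2\varepsilon^{1/2}e^{3s/2},\ |\check y|\le2\varepsilon^{1/6}e^{s/2}\}$. Outside $Y(s)$ the fluid is in a constant state: $\nabla u=0$, $\nabla\rho=0$, $k=0$. **Bootstrap assumptions**, for all $t\in I$, with some $0<l\le L$. A dot is $d/dt$; $|\check b|=b_2+b_3$ and $|b|=b_1+b_2+b_3$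 for a multi-index $b$; $\eta(y)=1+y_1^2+|\check y|^6$; $\tilde\eta(y)=\varepsilon^3+y_1^2+|\check y|^6$; $\bar W(y)=\langle\check y\rangle^{1/2}\bar U(\langle\check y\rangle^{-3/2}y_1)$ with $\langle\check y\rangle=1+|\check y|^2$ and $\bar U$ the solution of $y=-\bar U-\bar U^3$; $\tilde W=W-\bar W$; $|\phi|$ is the largest entry. * Modulation: $|\dot\kappa+\beta_1ae^{-\beta_1a(t+\varepsilon)}\kappa_0|\le\varepsilon^{1/6}$, $|\dot\tau|\le(\beta_1|a|+M)e^{-s}$, $|\dot\xi|\le M^{1/4}$, $|\dot{\check n}|\le M^2\varepsilon^{1/2}$, $|\dot\phi|\le M^2$, $\frac12\kappa_0\le\kappa\le2\kappa_0$, $|\tau|\le M\varepsilon$, $|\xi|\le M^{1/4}\varepsilon$, $|\check n|\le M^2\varepsilon^{3/2}$, $|\phi|\le M^2\varepsilon$. * On $Y(s)$, for $|b|\le2$: $|\partial^bZ|\le M^{\frac{1+|\check b|}2}e^{-\frac32s}$ if $b_1\ge1$, and $|\partial^bZ|\le M\varepsilon^{\frac{2-|\check b|}2}e^{-\frac{|\check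 b|}2s}$ if $b_1=0$; $|\partial_1A_\nu|\le Me^{-\frac32s}$, and $|\partial^bA_\nu|\le M\varepsilon^{\frac{2-|\check b|}2}e^{-\frac{|\check b|}2s}$ if $b_1=0$; $|\partial_1K|\le\varepsilon^{\frac14}e^{-\frac32s}$, $|\partial_1\check\nabla K|\le\varepsilon^{\frac18}e^{-\frac{13}8s}$, $|\partial_1^2K|\le\varepsilon^{\frac18}e^{-2s}\eta^{-\frac1{15}}$, and $|\partial^bK|\le\varepsilon^{\frac18}e^{-\frac{|\check b|}2s}$ if $b_1=0$, $|\check b|=1,2$ (a bound on $\partial_1\check\nabla$, $\check\nabla^2$ is meant for each partial derivative). * On $Y(s)\cap\{|y|\le l\}$: $|\partial^b\tilde W|\le(\log M)^4\varepsilon^{\frac1{10}}|y|^{4-|b|}+M\varepsilon^{\frac14}|y|^{3-|b|}$ for $|b|\le3$, $|\partial^b\tilde W|\le\varepsilon^{\frac1{10}}(\log M)^{|\check b|}$ for $|b|=4$; at $y=0$: $|\partial^b\tilde W|\le\varepsilon^{\frac14}$ for $|b|=3$. * On $Y(s)\cap\{|y|\le L\}$: $|\tilde W|\le\varepsilon^{\frac1{11}}\eta^{\frac16}$,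 $|\partial_1\tilde W|\le\varepsilon^{\frac1{12}}\eta^{-\frac13}$, $|\check\nabla\tilde W|\le\varepsilon^{\frac1{13}}$. * On $Y(s)$: $|W|\le(1+\varepsilon^{\frac1{20}})\eta^{\frac16}$, $|\partial_1W|\le\tilde\eta(\tfrac y2)^{-\frac13}\mathbf 1_{|y|\le L}+2\eta^{-\frac13}\mathbf 1_{|y|\ge L}$, $|\partial_\mu W|\le1$, $|\partial_1\partial_\mu W|\le M^{\frac23}\eta^{-\frac13}$, $|\partial_1^2W|\le M^{\frac13}\eta^{-\frac13}\big(\eta^{-\frac12}+e^{-\frac45s}\eta^{\frac25}\big)^{\frac12}$, $|\partial_\mu\partial_\nu W|\le M\eta^{-\frac16}$. **Proposition.** For all $\gamma>1$, $\kappa_0>1$, $M>1$ there are $\varepsilon_0>0$ and $C$, depending only on $\gamma,\kappa_0,M$, such that the following holds for all $0<\varepsilon<\varepsilon_0$, $a\ne0$, $T>-\varepsilon$, $0<l\le L$ and every solution and modulation as above that satisfy the bootstrap assumptions on $[-\varepsilon,T)$. Put $\lambda(t)=e^{-2\beta_1a(t+\varepsilon)}$, $E(t)=\frac1{2\beta_1a}(1-\lambda(t))+\varepsilon^{1/8}$,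 let $T^\mu_0$ be $T^\mu$ at time $-\varepsilon$, and let all $L^\infty$ norms be over $x\in\mathbb R^3$. For all $t\in[-\varepsilon,T)$ and $\mu=2,3$: 1. $\|\mathring\zeta(t)\cdot N\|_{L^\infty}\le\varepsilon^{1/4}$. 2. $\|\mathring\zeta(t)\cdot T^\mu\|_{L^\infty}\le\lambda(t)\,\|\mathring\zeta(-\varepsilon)\cdot T_0^\mu\|_{L^\infty}+E(t)$. 3. Along fluid particles the initial tangential vorticity is multiplied by $\lambda$ up to the same error: if $c:[-\varepsilon,t]\to\mathbb R^3$ satisfies $c'(r)=2\beta_1u(c(r),r)$, $c(-\varepsilon)=X(-\varepsilon,x_0)$ and $c(t)=X(t,x)$, then $|(\mathring\zeta\cdot T^\mu)(x,t)-\lambda(t)(\mathring\zeta\cdot T^\mu)(x_0,-\varepsilon)|\le E(t)$. 4. If a shock forms at $T$, that is, $\tau(t)-t\to0$ as $t\to T$, then $\lambda(t)$ has a limit as $t\to T$, and it differs from $(1-\varepsilon\beta_1a)^2$ by at most $C\varepsilon^2$. 5. If $a<0$, then $\lambda(-\varepsilon)=1$ and $\lambda$ is strictly increasing on $[-\varepsilon,T)$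 (the transported vorticity in 3 is amplified). 6. If $0<a\le\frac1{2\beta_1\varepsilon}$, then $\lambda(-\varepsilon)=1$ and $\lambda$ is strictly decreasing on $[-\varepsilon,T)$ (it is dissipated). 7. If $a\ge\frac2{\beta_1\varepsilon}$, then no singularity occurs at $T$: on $[-\varepsilon,T)$ the difference $\tau(t)-t$ is bounded below by a positive constant, and $\nabla u,\nabla\rho,\nabla k$ are bounded on $[-\varepsilon,T)\times\mathbb R^3$. Moreover the initial vorticity decays exponentially: $\|\mathring\zeta(t)\cdot T^\mu\|_{L^\infty}\le e^{-4(t+\varepsilon)/\varepsilon}\|\mathring\zeta(-\varepsilon)\cdot T_0^\mu\|_{L^\infty}+\frac\varepsilon4+\varepsilon^{1/8}$. -/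

import Mathlib

open MeasureTheory Set Filter
open scoped ENNReal Matrix Topology

noncomputable section

namespace DampedEuler

/-- Physical space. Coordinate `0` is `x₁`; coordinates `1, 2` are `x₂, x₃`. -/
abbrev E3 := EuclideanSpace ℝ (Fin 3)

/-! ### Differential calculus in `ℝ³` -/

/-- The partial derivative `∂ᵢ F`. -/
def pd (i : Fin 3) (F : E3 → ℝ) (x : E3) : ℝ :=
  fderiv ℝ F x (EuclideanSpace.single i 1)

/-- The iterated partial derivative `∂^b F` for a multi-index `b`. -/
def pdIter (b : Fin 3 → ℕ) (F : E3 → ℝ) : E3 → ℝ :=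
  (pd 0)^[b 0] ((pd 1)^[b 1] ((pd 2)^[b 2] F))

/-- The total order `|b|` of a multi-index. -/
def order (b : Fin 3 → ℕ) : ℕ := b 0 + b 1 + b 2

/-- The order of a multi-index in the two transversal directions. -/
def torder (b : Fin 3 → ℕ) : ℕ := b 1 + b 2

def curl (u : E3 → E3) (x : E3) : E3 :=
  !₂[pd 1 (fun z => u z 2) x - pd 2 (fun z => u z 1) x,
     pd 2 (fun z => u z 0) x - pd 0 (fun z => u z 2) x,
     pd 0 (fun z => u z 1) x - pd 1 (fun z => u z 0) x]

/-- A matrix acting on a vector of Euclidean space. -/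
def act (A : Matrix (Fin 3) (Fin 3) ℝ) (v : E3) : E3 :=
  WithLp.toLp 2 (A *ᵥ WithLp.ofLp v)

/-! ### The damped Euler system -/

/-- `α = (γ - 1) / 2`. -/
def alphaC (γ : ℝ) : ℝ := (γ - 1) / 2

/-- `β₁ = 1 / (1 + α)`. -/
def betaOne (γ : ℝ) : ℝ := 1 / (1 + alphaC γ)

/-- Velocity, density and entropy, as functions of time and position. -/
structure Fluid where
  u : ℝ → E3 → E3
  ρ : ℝ → E3 → ℝ
  k : ℝ → E3 → ℝ

namespace Fluid

variable (fl : Fluid) (γ : ℝ)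

/-- The pressure `p = ρ^γ e^k / γ`. -/
def pressure (t : ℝ) (x : E3) : ℝ := 1 / γ * fl.ρ t x ^ γ * Real.exp (fl.k t x)

/-- The rescaled sound speed `σ = ρ^α e^{k/2} / α`. -/
def sigma (t : ℝ) (x : E3) : ℝ :=
  1 / alphaC γ * fl.ρ t x ^ alphaC γ * Real.exp (fl.k t x / 2)

/-- The specific vorticity `ζ = curl u / ρ`. -/
def zeta (t : ℝ) (x : E3) : E3 := (1 / fl.ρ t x) • curl (fl.u t) x

end Fluid

/-- A classical solution, with positive density, of the compressible Euler system with damping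
constant `a` on `[-ε, T) × ℝ³`. Time is the rescaled time `t = (1 + α) / 2 * t_phys`, so that
`∂_{t_phys} = (1 / (2 β₁)) ∂_t`. -/
structure IsEulerSolution (γ a ε T : ℝ) (fl : Fluid) : Prop where
  smooth_u : ContDiffOn ℝ 4 (fun q : ℝ × E3 => fl.u q.1 q.2) (Ico (-ε) T ×ˢ univ)
  smooth_rho : ContDiffOn ℝ 4 (fun q : ℝ × E3 => fl.ρ q.1 q.2) (Ico (-ε) T ×ˢ univ)
  smooth_k : ContDiffOn ℝ 4 (fun q : ℝ × E3 => fl.k q.1 q.2) (Ico (-ε) T ×ˢ univ)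
  pos : ∀ t ∈ Ico (-ε) T, ∀ x, 0 < fl.ρ t x
  mass : ∀ t ∈ Ico (-ε) T, ∀ x,
    derivWithin (fun r => fl.ρ r x) (Ico (-ε) T) t
      + 2 * betaOne γ * ∑ i, fl.u t x i * pd i (fl.ρ t) x
      = - (2 * betaOne γ * (fl.ρ t x * ∑ i, pd i (fun z => fl.u t z i) x))
  momentum : ∀ t ∈ Ico (-ε) T, ∀ x, ∀ j : Fin 3,
    derivWithin (fun r => fl.u r x j) (Ico (-ε) T) t
      + 2 * betaOne γ * ∑ i, fl.u t x i * pd i (fun z => fl.u t z j) x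
      = 2 * betaOne γ * (- (1 / fl.ρ t x) * pd j (fl.pressure γ t) x - a * fl.u t x j)
  entropy : ∀ t ∈ Ico (-ε) T, ∀ x,
    derivWithin (fun r => fl.k r x) (Ico (-ε) T) t
      + 2 * betaOne γ * ∑ i, fl.u t x i * pd i (fl.k t) x = 0

/-- `c` is the path of a fluid particle over the (rescaled) time interval `[-ε, t]`. -/
def IsParticlePath (γ ε : ℝ) (fl : Fluid) (t : ℝ) (c : ℝ → E3) : Prop :=
  ∀ r ∈ Icc (-ε) t, HasDerivWithinAt c ((2 * betaOne γ) • fl.u r (c r)) (Icc (-ε) t) r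

/-! ### Modulation variables and moving coordinates -/

/-- The modulation functions: wave amplitude `κ`, blow-up time `τ`, blow-up location `ξ`,
the components `n = (n₂, n₃)` of the blow-up direction, and the curvature `φ` of the front. -/
structure Modulation where
  κ : ℝ → ℝ
  τ : ℝ → ℝ
  ξ : ℝ → E3
  n : ℝ → EuclideanSpace ℝ (Fin 2)
  φ : ℝ → Fin 2 → Fin 2 → ℝ

/-- The rotation taking `e₁` to `(√(1 - n₂² - n₃²), n₂, n₃)`. -/
def rot (n : EuclideanSpace ℝ (Fin 2)) : Matrix (Fin 3) (Fin 3) ℝ :=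
  let p := n 0
  let q := n 1
  let d := Real.sqrt (1 - p ^ 2 - q ^ 2)
  !![d, -p, -q;
     p, 1 - p ^ 2 / (1 + d), -(p * q / (1 + d));
     q, -(p * q / (1 + d)), 1 - q ^ 2 / (1 + d)]

namespace Modulation

variable (m : Modulation)

/-- The quadratic profile `f = ½ φ_{μν} x_μ x_ν` of the front. -/
def front (t : ℝ) (x : E3) : ℝ :=
  1 / 2 * ∑ μ : Fin 2, ∑ ν : Fin 2, m.φ t μ ν * x μ.succ * x ν.succ

/-- `f_{,μ} = φ_{μν} x_ν`. -/
def frontD (t : ℝ) (x : E3) (μ : Fin 2) : ℝ := ∑ ν : Fin 2, m.φ t μ ν * x ν.succ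

/-- `J = √(1 + f_{,2}² + f_{,3}²)`. -/
def J (t : ℝ) (x : E3) : ℝ := Real.sqrt (1 + m.frontD t x 0 ^ 2 + m.frontD t x 1 ^ 2)

/-- The unit normal `N` of the front. -/
def N (t : ℝ) (x : E3) : E3 :=
  !₂[1 / m.J t x, -(m.frontD t x 0 / m.J t x), -(m.frontD t x 1 / m.J t x)]

/-- The unit tangent vectors `T²` (index `0`) and `T³` (index `1`) of the front. -/
def Tan (μ : Fin 2) (t : ℝ) (x : E3) : E3 :=
  !₂[m.frontD t x μ / m.J t x,
     (if μ = 0 then 1 else 0)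
       - m.frontD t x μ * m.frontD t x 0 / (m.J t x * (m.J t x + 1)),
     (if μ = 1 then 1 else 0)
       - m.frontD t x μ * m.frontD t x 1 / (m.J t x * (m.J t x + 1))]

/-- The point of physical space with front-adapted coordinates `x` at time `t`: with
`x̃ = (x₁ + f, x₂, x₃)` it is `R(t) x̃ + ξ(t)`. -/
def physPos (t : ℝ) (x : E3) : E3 :=
  act (rot (m.n t)) !₂[x 0 + m.front t x, x 1, x 2] + m.ξ t

/-- Self-similar time `s = -log(τ(t) - t)`. -/
def s (t : ℝ) : ℝ := -Real.log (m.τ t - t)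

/-- The front-adapted coordinates of the point with self-similar coordinates `y`. -/
def unscale (t : ℝ) (y : E3) : E3 :=
  !₂[Real.exp (-(3 / 2) * m.s t) * y 0, Real.exp (-(1 / 2) * m.s t) * y 1,
     Real.exp (-(1 / 2) * m.s t) * y 2]

variable (γ : ℝ) (fl : Fluid)

/-- Velocity in the rotating frame and front-adapted coordinates. -/
def uRing (t : ℝ) (x : E3) : E3 := act (rot (m.n t))ᵀ (fl.u t (m.physPos t x))

/-- Specific vorticity in the rotating frame and front-adapted coordinates. -/
def zetaRing (t : ℝ) (x : E3) : E3 := act (rot (m.n t))ᵀ (fl.zeta t (m.physPos t x))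

def sigmaRing (t : ℝ) (x : E3) : ℝ := fl.sigma γ t (m.physPos t x)

/-- Riemann variable `w = u·N + σ`. -/
def w (t : ℝ) (x : E3) : ℝ := inner ℝ (m.uRing fl t x) (m.N t x) + m.sigmaRing γ fl t x

/-- Riemann variable `z = u·N - σ`. -/
def z (t : ℝ) (x : E3) : ℝ := inner ℝ (m.uRing fl t x) (m.N t x) - m.sigmaRing γ fl t x

/-- `W`, defined by `w(x,t) = e^{-s/2} W(y,s) + κ(t)`. -/
def W (t : ℝ) (y : E3) : ℝ :=
  Real.exp (m.s t / 2) * (m.w γ fl t (m.unscale t y) - m.κ t)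

def Z (t : ℝ) (y : E3) : ℝ := m.z γ fl t (m.unscale t y)

/-- `A_ν`, the self-similar form of `u·T^ν`. -/
def A (ν : Fin 2) (t : ℝ) (y : E3) : ℝ :=
  inner ℝ (m.uRing fl t (m.unscale t y)) (m.Tan ν t (m.unscale t y))

def K (t : ℝ) (y : E3) : ℝ := fl.k t (m.physPos t (m.unscale t y))

/-- Normal component `ζ·N` of the specific vorticity. -/
def zetaN (t : ℝ) (x : E3) : ℝ := inner ℝ (m.zetaRing fl t x) (m.N t x)

/-- Tangential components `ζ·T^μ` of the specific vorticity. -/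
def zetaT (μ : Fin 2) (t : ℝ) (x : E3) : ℝ := inner ℝ (m.zetaRing fl t x) (m.Tan μ t x)

end Modulation

/-! ### The self-similar Burgers profile and the weights -/

/-- The one-dimensional profile `Ū`, the inverse function of `U ↦ -U - U³`. -/
def Ubar : ℝ → ℝ := Function.invFun (fun U : ℝ => -U - U ^ 3)

theorem Ubar_spec (y : ℝ) : -Ubar y - Ubar y ^ 3 = y := by
  have hsurj : Function.Surjective (fun U : ℝ => -U - U ^ 3) := by
    intro y
    have hc : ContinuousOn (fun U : ℝ => -U - U ^ 3) (Icc (-(|y| + 1)) (|y| + 1)) := by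
      fun_prop
    have h0 := abs_nonneg y
    have h1 := neg_abs_le y
    have h2 := le_abs_self y
    have h3 : 0 ≤ (|y| + 1) ^ 3 := by positivity
    obtain ⟨U, -, hU⟩ := intermediate_value_Icc' (by linarith) hc
      (show y ∈ Icc _ _ from ⟨by nlinarith, by nlinarith⟩)
    exact ⟨U, hU⟩
  exact Function.invFun_eq (hsurj y)

/-- `W̄(y) = ⟨y̌⟩^{1/2} Ū(⟨y̌⟩^{-3/2} y₁)` with `⟨y̌⟩ = 1 + y₂² + y₃²`. -/
def Wbar (y : E3) : ℝ :=
  (1 + y 1 ^ 2 + y 2 ^ 2) ^ (1 / 2 : ℝ)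
    * Ubar ((1 + y 1 ^ 2 + y 2 ^ 2) ^ (-(3 / 2) : ℝ) * y 0)

/-- `η(y) = 1 + y₁² + |y̌|⁶`. -/
def eta (y : E3) : ℝ := 1 + y 0 ^ 2 + (y 1 ^ 2 + y 2 ^ 2) ^ 3

/-- `η̃(y) = ε³ + y₁² + |y̌|⁶`. -/
def etaTilde (ε : ℝ) (y : E3) : ℝ := ε ^ 3 + y 0 ^ 2 + (y 1 ^ 2 + y 2 ^ 2) ^ 3

/-- The box `|x₁| ≤ 2 ε^{1/2}`, `|x̌| ≤ 2 ε^{1/6}`, which is `Y(s)` in front-adapted coordinates. -/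
def Box (ε : ℝ) : Set E3 :=
  {x | |x 0| ≤ 2 * ε ^ (1 / 2 : ℝ) ∧ Real.sqrt (x 1 ^ 2 + x 2 ^ 2) ≤ 2 * ε ^ (1 / 6 : ℝ)}

/-- The box `Y(s)`: `|y₁| ≤ 2 ε^{1/2} e^{3s/2}`, `|y̌| ≤ 2 ε^{1/6} e^{s/2}`. -/
def Ybox (ε s : ℝ) : Set E3 :=
  {y | |y 0| ≤ 2 * ε ^ (1 / 2 : ℝ) * Real.exp (3 / 2 * s) ∧
    Real.sqrt (y 1 ^ 2 + y 2 ^ 2) ≤ 2 * ε ^ (1 / 6 : ℝ) * Real.exp (s / 2)}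

/-! ### Standing assumptions on the solution and the modulation variables -/

/-- The modulation functions are `C¹`, have the prescribed initial values, keep `τ(t) > t`, and
realize the ten constraints `W = 0`, `∂₁W = -1`, `∂₂W = ∂₃W = 0`, `∇²W = 0` at `y = 0`. -/
structure IsModulated (γ κ₀ ε T : ℝ) (fl : Fluid) (m : Modulation) : Prop where
  smooth_κ : ContDiffOn ℝ 1 m.κ (Ico (-ε) T)
  smooth_τ : ContDiffOn ℝ 1 m.τ (Ico (-ε) T)
  smooth_ξ : ContDiffOn ℝ 1 m.ξ (Ico (-ε) T)
  smooth_n : ContDiffOn ℝ 1 m.n (Ico (-ε) T)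
  smooth_φ : ∀ μ ν, ContDiffOn ℝ 1 (fun t => m.φ t μ ν) (Ico (-ε) T)
  symm : ∀ t ∈ Ico (-ε) T, ∀ μ ν, m.φ t μ ν = m.φ t ν μ
  init_κ : m.κ (-ε) = κ₀
  init_τ : m.τ (-ε) = 0
  init_ξ : m.ξ (-ε) = 0
  init_n : m.n (-ε) = 0
  lt_τ : ∀ t ∈ Ico (-ε) T, t < m.τ t
  constraint : ∀ t ∈ Ico (-ε) T, ∀ b : Fin 3 → ℕ, order b ≤ 2 →
    pdIter b (m.W γ fl t) 0 = if b = ![1, 0, 0] then -1 else 0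

/-- Outside the box `Y(s)` the fluid is in a constant state with vanishing entropy. -/
def IsConstantOutside (ε T : ℝ) (fl : Fluid) (m : Modulation) : Prop :=
  ∀ t ∈ Ico (-ε) T, ∀ x : E3, x ∉ Box ε →
    fderiv ℝ (fl.u t) (m.physPos t x) = 0 ∧ fderiv ℝ (fl.ρ t) (m.physPos t x) = 0 ∧
      fl.k t (m.physPos t x) = 0

/-- Bootstrap assumptions on the modulation variables. -/
structure BootstrapModulation (γ a κ₀ M ε T : ℝ) (m : Modulation) : Prop where
  dκ : ∀ t ∈ Ico (-ε) T,
    |derivWithin m.κ (Ico (-ε) T) t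
      + betaOne γ * a * Real.exp (-(betaOne γ * a * (t + ε))) * κ₀| ≤ ε ^ (1 / 6 : ℝ)
  dτ : ∀ t ∈ Ico (-ε) T, |derivWithin m.τ (Ico (-ε) T) t|
    ≤ betaOne γ * |a| * Real.exp (-m.s t) + M * Real.exp (-m.s t)
  dξ : ∀ t ∈ Ico (-ε) T, ‖derivWithin m.ξ (Ico (-ε) T) t‖ ≤ M ^ (1 / 4 : ℝ)
  dn : ∀ t ∈ Ico (-ε) T, ‖derivWithin m.n (Ico (-ε) T) t‖ ≤ M ^ 2 * ε ^ (1 / 2 : ℝ)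
  dφ : ∀ t ∈ Ico (-ε) T, ∀ μ ν,
    |derivWithin (fun r => m.φ r μ ν) (Ico (-ε) T) t| ≤ M ^ 2
  κ_lower : ∀ t ∈ Ico (-ε) T, 1 / 2 * κ₀ ≤ m.κ t
  κ_upper : ∀ t ∈ Ico (-ε) T, m.κ t ≤ 2 * κ₀
  τ_le : ∀ t ∈ Ico (-ε) T, |m.τ t| ≤ M * ε
  ξ_le : ∀ t ∈ Ico (-ε) T, ‖m.ξ t‖ ≤ M ^ (1 / 4 : ℝ) * ε
  n_le : ∀ t ∈ Ico (-ε) T, ‖m.n t‖ ≤ M ^ 2 * ε ^ (3 / 2 : ℝ)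
  φ_le : ∀ t ∈ Ico (-ε) T, ∀ μ ν, |m.φ t μ ν| ≤ M ^ 2 * ε

/-- Bootstrap bounds for `Z`, `A` and `K` at time `t`, on `Y(s)`. -/
structure BootstrapZAK (γ M ε : ℝ) (fl : Fluid) (m : Modulation) (t : ℝ) : Prop where
  Z_one : ∀ y ∈ Ybox ε (m.s t), ∀ b : Fin 3 → ℕ, 1 ≤ b 0 → order b ≤ 2 →
    |pdIter b (m.Z γ fl t) y|
      ≤ M ^ ((1 + (torder b : ℝ)) / 2) * Real.exp (-(3 / 2) * m.s t)
  Z_check : ∀ y ∈ Ybox ε (m.s t), ∀ b : Fin 3 → ℕ, b 0 = 0 → order b ≤ 2 →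
    |pdIter b (m.Z γ fl t) y|
      ≤ M * ε ^ ((2 - (torder b : ℝ)) / 2) * Real.exp (-((torder b : ℝ) / 2) * m.s t)
  A_one : ∀ y ∈ Ybox ε (m.s t), ∀ ν,
    |pd 0 (m.A fl ν t) y| ≤ M * Real.exp (-(3 / 2) * m.s t)
  A_check : ∀ y ∈ Ybox ε (m.s t), ∀ ν, ∀ b : Fin 3 → ℕ, b 0 = 0 → order b ≤ 2 →
    |pdIter b (m.A fl ν t) y|
      ≤ M * ε ^ ((2 - (torder b : ℝ)) / 2) * Real.exp (-((torder b : ℝ) / 2) * m.s t)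
  K_one : ∀ y ∈ Ybox ε (m.s t),
    |pd 0 (m.K fl t) y| ≤ ε ^ (1 / 4 : ℝ) * Real.exp (-(3 / 2) * m.s t)
  K_mixed : ∀ y ∈ Ybox ε (m.s t), ∀ b : Fin 3 → ℕ, b 0 = 1 → torder b = 1 →
    |pdIter b (m.K fl t) y| ≤ ε ^ (1 / 8 : ℝ) * Real.exp (-(13 / 8) * m.s t)
  K_two : ∀ y ∈ Ybox ε (m.s t),
    |pdIter ![2, 0, 0] (m.K fl t) y|
      ≤ ε ^ (1 / 8 : ℝ) * Real.exp (-2 * m.s t) * eta y ^ (-(1 / 15) : ℝ)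
  K_check : ∀ y ∈ Ybox ε (m.s t), ∀ b : Fin 3 → ℕ, b 0 = 0 → torder b = 1 ∨ torder b = 2 →
    |pdIter b (m.K fl t) y| ≤ ε ^ (1 / 8 : ℝ) * Real.exp (-((torder b : ℝ) / 2) * m.s t)

/-- Bootstrap bounds for `W̃ = W - W̄` at time `t`, for `|y| ≤ l` and for `|y| ≤ L`. -/
structure BootstrapWtilde (γ M ε l L : ℝ) (fl : Fluid) (m : Modulation) (t : ℝ) : Prop where
  near : ∀ y ∈ Ybox ε (m.s t), ‖y‖ ≤ l → ∀ b : Fin 3 → ℕ, order b ≤ 3 →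
    |pdIter b (fun y => m.W γ fl t y - Wbar y) y|
      ≤ Real.log M ^ 4 * ε ^ (1 / 10 : ℝ) * ‖y‖ ^ (4 - order b)
        + M * ε ^ (1 / 4 : ℝ) * ‖y‖ ^ (3 - order b)
  near_four : ∀ y ∈ Ybox ε (m.s t), ‖y‖ ≤ l → ∀ b : Fin 3 → ℕ, order b = 4 →
    |pdIter b (fun y => m.W γ fl t y - Wbar y) y|
      ≤ ε ^ (1 / 10 : ℝ) * Real.log M ^ torder b
  zero_three : ∀ b : Fin 3 → ℕ, order b = 3 →
    |pdIter b (fun y => m.W γ fl t y - Wbar y) 0| ≤ ε ^ (1 / 4 : ℝ)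
  mid : ∀ y ∈ Ybox ε (m.s t), ‖y‖ ≤ L →
    |m.W γ fl t y - Wbar y| ≤ ε ^ (1 / 11 : ℝ) * eta y ^ (1 / 6 : ℝ)
  mid_one : ∀ y ∈ Ybox ε (m.s t), ‖y‖ ≤ L →
    |pd 0 (fun y => m.W γ fl t y - Wbar y) y| ≤ ε ^ (1 / 12 : ℝ) * eta y ^ (-(1 / 3) : ℝ)
  mid_check : ∀ y ∈ Ybox ε (m.s t), ‖y‖ ≤ L →
    Real.sqrt (pd 1 (fun y => m.W γ fl t y - Wbar y) y ^ 2
      + pd 2 (fun y => m.W γ fl t y - Wbar y) y ^ 2) ≤ ε ^ (1 / 13 : ℝ)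

/-- Bootstrap bounds for `W` at time `t`, on `Y(s)`. -/
structure BootstrapW (γ M ε L : ℝ) (fl : Fluid) (m : Modulation) (t : ℝ) : Prop where
  zero : ∀ y ∈ Ybox ε (m.s t),
    |m.W γ fl t y| ≤ (1 + ε ^ (1 / 20 : ℝ)) * eta y ^ (1 / 6 : ℝ)
  one_near : ∀ y ∈ Ybox ε (m.s t), ‖y‖ ≤ L →
    |pd 0 (m.W γ fl t) y|
      ≤ etaTilde ε ((1 / 2 : ℝ) • y) ^ (-(1 / 3) : ℝ)
        + if L ≤ ‖y‖ then 2 * eta y ^ (-(1 / 3) : ℝ) else 0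
  one_far : ∀ y ∈ Ybox ε (m.s t), L < ‖y‖ →
    |pd 0 (m.W γ fl t) y| ≤ 2 * eta y ^ (-(1 / 3) : ℝ)
  check : ∀ y ∈ Ybox ε (m.s t), ∀ b : Fin 3 → ℕ, b 0 = 0 → torder b = 1 →
    |pdIter b (m.W γ fl t) y| ≤ 1
  mixed : ∀ y ∈ Ybox ε (m.s t), ∀ b : Fin 3 → ℕ, b 0 = 1 → torder b = 1 →
    |pdIter b (m.W γ fl t) y| ≤ M ^ (2 / 3 : ℝ) * eta y ^ (-(1 / 3) : ℝ)
  two : ∀ y ∈ Ybox ε (m.s t),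
    |pdIter ![2, 0, 0] (m.W γ fl t) y| ≤ M ^ (1 / 3 : ℝ) * eta y ^ (-(1 / 3) : ℝ)
      * (eta y ^ (-(1 / 2) : ℝ)
          + Real.exp (-(4 / 5) * m.s t) * eta y ^ (2 / 5 : ℝ)) ^ (1 / 2 : ℝ)
  check_two : ∀ y ∈ Ybox ε (m.s t), ∀ b : Fin 3 → ℕ, b 0 = 0 → torder b = 2 →
    |pdIter b (m.W γ fl t) y| ≤ M * eta y ^ (-(1 / 6) : ℝ)

/-- All bootstrap assumptions on `[-ε, T)`. -/
structure Bootstrap (γ a κ₀ M ε T l L : ℝ) (fl : Fluid) (m : Modulation) : Prop where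
  modulation : BootstrapModulation γ a κ₀ M ε T m
  zak : ∀ t ∈ Ico (-ε) T, BootstrapZAK γ M ε fl m t
  wtilde : ∀ t ∈ Ico (-ε) T, BootstrapWtilde γ M ε l L fl m t
  w : ∀ t ∈ Ico (-ε) T, BootstrapW γ M ε L fl m t

/-! ### Quantities in the conclusion -/

/-- The damping factor `e^{-2 β₁ a (t + ε)}`. -/
def damp (γ a ε t : ℝ) : ℝ := Real.exp (-(2 * betaOne γ * a * (t + ε)))

/-- The source contribution `(1 - e^{-2 β₁ a (t + ε)}) / (2 β₁ a) + ε^{1/8}`. -/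
def source (γ a ε t : ℝ) : ℝ :=
  (1 - damp γ a ε t) / (2 * betaOne γ * a) + ε ^ (1 / 8 : ℝ)

/-- A shock forms at `T`: `τ(t) - t → 0` as `t → T`. -/
def IsShockTime (m : Modulation) (T : ℝ) : Prop :=
  Tendsto (fun t => m.τ t - t) (𝓝[<] T) (𝓝 0)

end DampedEuler

end

open DampedEuler

/-!
The proof follows the specific vorticity `ζ` along fluid particles. By the vorticity equation
(`Setup.hasDerivAt_zeta_path`) it is damped at rate `2 β₁ a`, stretched by `∇u`, and driven by the
baroclinic torque `ρ⁻³ ∇ρ × ∇p`. After the damping is factored out it remains to show that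
stretching, torque and the rotation of the frame change a tangential component by at most a small
multiple of `ε^{1/8}`. The other term of the admissible error is nonnegative (`rpow_le_source`).

*Size of the fields.* Outside the box the fluid is in a constant state, so every state is attained
in the box, by radial contraction in the moving coordinates; there the bootstrap assumptions give
`w = κ + O(ε^{1/6})` and `z = O(ε)` (`exists_stateFacts`). In the moving frame the only large
gradients are the normal derivatives of `u · N` and `σ`, which are controlled by `∂₁w`
(`exists_gradFacts`). The component `ζ · N` involves tangential derivatives of tangential velocities
only, so it is `O(ε^{1/2})`; stretching in a tangential direction is bounded, and the torque is at
most `ε^{1/8} (1 + |∂₁w|)` (`exists_vortFacts`).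

*Size of the damping.* In the far field the velocity decays freely while the density is constant;
the smallness of `z` ties the one to the other, whence `|a| (t + ε) = O(ε)`
(`exists_damping_bound`) and `τ = O(ε²)` (`exists_tau_bound`). These two facts give the value of the
damping factor at a shock (`exists_shock_bound`), and exclude a shock when `a ≥ 2 / (β₁ ε)`
(`eventually_strong_damping`).

*The torque is integrable in time.* In the variable `x` the bound on `∂₁W` reads
`|∂₁w| ≤ 4 |x₁|^{-2/3}`, uniformly in time. The time derivative of the constraint `W = 0` at the
origin shows that the blow-up location moves with speed close to `κ` (`exists_front_speed`), whereas
the particles move with speed close to `β₁ κ < κ`. So they cross the front transversally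
(`exists_transversality`), `|x₁|^{-2/3}` is integrable along their paths
(`abs_sub_le_of_transversal`), and the torque contributes `O(ε^{1/8 + 1/18})`
(`exists_increment_moderate`). The front speed is controlled only if `|β₁ a| ≤ ε^{-3/2}`; for
stronger damping the lifespan is `O(ε^{5/2})`, and a crude bound of the torque suffices
(`exists_increment_strong`).

The result is the transport statement `eventually_transport`. As the velocity is bounded, a particle
path leads back from every point to the initial time (`Setup.exists_particlePath`), and the bound on
the supremum follows.
-/

namespace DampedEuler

/-! ### Linear algebra of the rotation -/

/-- The plane in which the transversal components `n = (n₂, n₃)` live. -/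
abbrev E2 := EuclideanSpace ℝ (Fin 2)

/-- The standard basis vectors. -/
noncomputable abbrev bv (i : Fin 3) : E3 := EuclideanSpace.single i 1

theorem inner3 (v w : E3) : inner ℝ v w = v 0 * w 0 + v 1 * w 1 + v 2 * w 2 := by
  simp [PiLp.inner_apply, Fin.sum_univ_three]; ring

theorem act_apply (A : Matrix (Fin 3) (Fin 3) ℝ) (v : E3) (i : Fin 3) :
    act A v i = A i 0 * v 0 + A i 1 * v 1 + A i 2 * v 2 := by
  simp [act, Matrix.mulVec, dotProduct, Fin.sum_univ_three]

/-- `act A` as a continuous linear map. -/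
noncomputable def actL (A : Matrix (Fin 3) (Fin 3) ℝ) : E3 →L[ℝ] E3 :=
  LinearMap.toContinuousLinearMap
    { toFun := act A
      map_add' := fun v w => by ext i; simp [act_apply]; ring
      map_smul' := fun c v => by ext i; simp [act_apply]; ring }

theorem actL_apply (A : Matrix (Fin 3) (Fin 3) ℝ) (v : E3) : actL A v = act A v := rfl

theorem act_add (A : Matrix (Fin 3) (Fin 3) ℝ) (v w : E3) : act A (v + w) = act A v + act A w :=
  (actL A).map_add v w

theorem act_smul (A : Matrix (Fin 3) (Fin 3) ℝ) (c : ℝ) (v : E3) : act A (c • v) = c • act A v :=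
  (actL A).map_smul c v

theorem act_zero (A : Matrix (Fin 3) (Fin 3) ℝ) : act A 0 = 0 := (actL A).map_zero

theorem inner_act_transpose (A : Matrix (Fin 3) (Fin 3) ℝ) (v w : E3) :
    inner ℝ (act Aᵀ v) w = inner ℝ v (act A w) := by
  simp only [inner3, act_apply, Matrix.transpose_apply]; ring

theorem rot_sq {n : E2} (hn : ‖n‖ ≤ 1) :
    Real.sqrt (1 - n 0 ^ 2 - n 1 ^ 2) ^ 2 = 1 - n 0 ^ 2 - n 1 ^ 2 := by
  apply Real.sq_sqrt
  have : ‖n‖ ^ 2 = n 0 ^ 2 + n 1 ^ 2 := by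
    rw [EuclideanSpace.norm_sq_eq]; simp [Fin.sum_univ_two]
  nlinarith [norm_nonneg n]

theorem rot_transpose_mul {n : E2} (hn : ‖n‖ ≤ 1) : (rot n)ᵀ * rot n = 1 := by
  have h1 := rot_sq hn
  have h0 : (0:ℝ) < 1 + Real.sqrt (1 - n 0 ^ 2 - n 1 ^ 2) := by positivity
  unfold rot
  simp only
  generalize Real.sqrt (1 - n 0 ^ 2 - n 1 ^ 2) = d at *
  generalize n 0 = p at *
  generalize n 1 = q at *
  have h2 : d ^ 2 - (1 - p ^ 2 - q ^ 2) = 0 := by linarith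
  have hp : p ^ 2 = 1 - q ^ 2 - d ^ 2 := by linarith
  ext i j
  fin_cases i <;> fin_cases j <;> simp [Matrix.mul_apply, Fin.sum_univ_three] <;> field_simp <;>
    ring_nf <;> (try simp only [show p ^ 4 = p ^ 2 * p ^ 2 by ring, show p ^ 3 = p * p ^ 2 by ring, hp]) <;> ring

theorem rot_mul_transpose {n : E2} (hn : ‖n‖ ≤ 1) : rot n * (rot n)ᵀ = 1 :=
  mul_eq_one_comm.mp (rot_transpose_mul hn)

theorem act_act (A B : Matrix (Fin 3) (Fin 3) ℝ) (v : E3) : act A (act B v) = act (A * B) v := by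
  simp [act, Matrix.mulVec_mulVec]

theorem act_one (v : E3) : act 1 v = v := by
  simp [act]

theorem inner_act_act {n : E2} (hn : ‖n‖ ≤ 1) (v w : E3) :
    inner ℝ (act (rot n) v) (act (rot n) w) = inner ℝ v w := by
  rw [← inner_act_transpose, act_act, rot_transpose_mul hn, act_one]

theorem norm_act {n : E2} (hn : ‖n‖ ≤ 1) (v : E3) : ‖act (rot n) v‖ = ‖v‖ := by
  have := inner_act_act hn v v
  rw [real_inner_self_eq_norm_sq, real_inner_self_eq_norm_sq] at this
  exact (sq_eq_sq₀ (norm_nonneg _) (norm_nonneg _)).mp this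

/-! ### The moving frame -/

/-- `J` as a function of the slope `g = ∇f`. -/
noncomputable def slopeJ (g : Fin 2 → ℝ) : ℝ := Real.sqrt (1 + g 0 ^ 2 + g 1 ^ 2)

/-- The frame `(N, T², T³)` of a graph of slope `g`, before rotation. -/
noncomputable def slopeFrame (g : Fin 2 → ℝ) : Fin 3 → E3
  | 0 => !₂[1 / slopeJ g, -(g 0 / slopeJ g), -(g 1 / slopeJ g)]
  | 1 => !₂[g 0 / slopeJ g, 1 - g 0 * g 0 / (slopeJ g * (slopeJ g + 1)),
      - (g 0 * g 1 / (slopeJ g * (slopeJ g + 1)))]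
  | 2 => !₂[g 1 / slopeJ g, - (g 1 * g 0 / (slopeJ g * (slopeJ g + 1))),
      1 - g 1 * g 1 / (slopeJ g * (slopeJ g + 1))]

/-- The frame `(R N, R T², R T³)` in physical space, as a function of the direction `n` and the
slope `g = ∇f`. -/
noncomputable def frame (j : Fin 3) (q : E2 × (Fin 2 → ℝ)) : E3 :=
  act (rot q.1) (slopeFrame q.2 j)

set_option linter.unusedSimpArgs false

theorem slopeJ_sq (g : Fin 2 → ℝ) : slopeJ g ^ 2 = 1 + g 0 ^ 2 + g 1 ^ 2 :=
  Real.sq_sqrt (by nlinarith [sq_nonneg (g 0), sq_nonneg (g 1)])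

theorem one_le_slopeJ (g : Fin 2 → ℝ) : 1 ≤ slopeJ g := by
  rw [slopeJ, Real.one_le_sqrt]; nlinarith [sq_nonneg (g 0), sq_nonneg (g 1)]

theorem slopeFrame_zero (j : Fin 3) : slopeFrame 0 j = bv j := by
  fin_cases j <;> ext i <;> fin_cases i <;> simp [slopeFrame, slopeJ]

/-- The cross product of two vectors of `ℝ³`. -/
def cross (v w : E3) : E3 :=
  !₂[v 1 * w 2 - v 2 * w 1, v 2 * w 0 - v 0 * w 2, v 0 * w 1 - v 1 * w 0]

/-- The frame is positively oriented. -/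
theorem slopeFrame_cross (g : Fin 2 → ℝ) :
    cross (slopeFrame g 1) (slopeFrame g 2) = slopeFrame g 0 ∧
    cross (slopeFrame g 2) (slopeFrame g 0) = slopeFrame g 1 ∧
    cross (slopeFrame g 0) (slopeFrame g 1) = slopeFrame g 2 := by
  have h1 := slopeJ_sq g
  have h0 : 0 < slopeJ g := by linarith [one_le_slopeJ g]
  have h2 : 0 < slopeJ g + 1 := by linarith
  unfold slopeFrame cross
  generalize slopeJ g = J at *
  generalize g 0 = p at *
  generalize g 1 = q at *
  have hp : p ^ 2 = J ^ 2 - 1 - q ^ 2 := by linarith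
  refine ⟨?_, ?_, ?_⟩ <;> ext i <;> fin_cases i <;> simp <;> field_simp <;> ring_nf <;>
    (try simp only [show p ^ 4 = p ^ 2 * p ^ 2 by ring, show p ^ 3 = p * p ^ 2 by ring, hp]) <;> ring

/-- The frame is orthonormal, in the form of the expansion of a vector in it. -/
theorem slopeFrame_complete (g : Fin 2 → ℝ) (v : E3) :
    v = inner ℝ v (slopeFrame g 0) • slopeFrame g 0 + inner ℝ v (slopeFrame g 1) • slopeFrame g 1
      + inner ℝ v (slopeFrame g 2) • slopeFrame g 2 := by
  have h1 := slopeJ_sq g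
  have h0 : 0 < slopeJ g := by linarith [one_le_slopeJ g]
  have h2 : 0 < slopeJ g + 1 := by linarith
  simp only [inner3]
  unfold slopeFrame
  generalize slopeJ g = J at *
  generalize g 0 = p at *
  generalize g 1 = q at *
  have hp : p ^ 2 = J ^ 2 - 1 - q ^ 2 := by linarith
  ext i
  fin_cases i <;> simp <;> field_simp <;> ring_nf <;>
    (try simp only [show p ^ 4 = p ^ 2 * p ^ 2 by ring,
      show p ^ 3 = p * p ^ 2 by ring, hp]) <;> ring

theorem slopeFrame_norm (g : Fin 2 → ℝ) (j : Fin 3) : ‖slopeFrame g j‖ = 1 := by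
  have h1 := slopeJ_sq g
  have h0 : 0 < slopeJ g := by linarith [one_le_slopeJ g]
  have h2 : 0 < slopeJ g + 1 := by linarith
  rw [← sq_eq_sq₀ (norm_nonneg _) (by norm_num), ← real_inner_self_eq_norm_sq, inner3]
  unfold slopeFrame
  generalize slopeJ g = J at *
  generalize g 0 = p at *
  generalize g 1 = q at *
  have hp : p ^ 2 = J ^ 2 - 1 - q ^ 2 := by linarith
  fin_cases j <;> simp <;> field_simp <;> ring_nf <;>
    (try simp only [show p ^ 4 = p ^ 2 * p ^ 2 by ring,
      show p ^ 3 = p * p ^ 2 by ring, hp]) <;> ring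

theorem act_cross {n : E2} (hn : ‖n‖ ≤ 1) (v w : E3) :
    act (rot n) (cross v w) = cross (act (rot n) v) (act (rot n) w) := by
  have h1 := rot_sq hn
  have h0 : (0:ℝ) < 1 + Real.sqrt (1 - n 0 ^ 2 - n 1 ^ 2) := by positivity
  ext i
  fin_cases i <;> simp [cross, act_apply, rot] <;>
  (generalize Real.sqrt (1 - n 0 ^ 2 - n 1 ^ 2) = d at *
   generalize n 0 = p at *
   generalize n 1 = q at *
   have hp : p ^ 2 = 1 - q ^ 2 - d ^ 2 := by linarith
   field_simp
   ring_nf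
   (try simp only [show p ^ 4 = p ^ 2 * p ^ 2 by ring, show p ^ 3 = p * p ^ 2 by ring, hp])
   ring)

theorem frame_zero (j : Fin 3) : frame j 0 = bv j := by
  have : rot (0 : E2) = 1 := by
    ext i j; fin_cases i <;> fin_cases j <;> simp [rot]
  simp [frame, slopeFrame_zero, this, act_one]

theorem frame_norm {q : E2 × (Fin 2 → ℝ)} (hn : ‖q.1‖ ≤ 1) (j : Fin 3) : ‖frame j q‖ = 1 := by
  rw [frame, norm_act hn, slopeFrame_norm]

theorem frame_complete {q : E2 × (Fin 2 → ℝ)} (hn : ‖q.1‖ ≤ 1) (v : E3) :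
    v = inner ℝ v (frame 0 q) • frame 0 q + inner ℝ v (frame 1 q) • frame 1 q
      + inner ℝ v (frame 2 q) • frame 2 q := by
  simp only [frame, ← inner_act_transpose, ← act_smul, ← act_add]
  rw [← slopeFrame_complete, act_act, rot_mul_transpose hn, act_one]

/-- Rotations preserve the orientation, so the rotated frame is positively oriented. This turns a
component of `curl u` into a difference of two entries of `∇u` in the frame. -/
theorem frame_cross {q : E2 × (Fin 2 → ℝ)} (hn : ‖q.1‖ ≤ 1) :
    cross (frame 1 q) (frame 2 q) = frame 0 q ∧ cross (frame 2 q) (frame 0 q) = frame 1 q ∧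
      cross (frame 0 q) (frame 1 q) = frame 2 q := by
  obtain ⟨h1, h2, h3⟩ := slopeFrame_cross q.2
  simp only [frame, ← act_cross hn, h1, h2, h3, and_self]

theorem contDiffAt_slopeFrame (g : Fin 2 → ℝ) (j : Fin 3) :
    ContDiffAt ℝ 2 (fun g => slopeFrame g j) g := by
  have hJ : ContDiffAt ℝ 2 slopeJ g := by
    unfold slopeJ
    apply ContDiffAt.sqrt
    · fun_prop
    · positivity
  have h0 : ∀ g, slopeJ g ≠ 0 := fun g => by linarith [one_le_slopeJ g]
  have h1 : slopeJ g + 1 ≠ 0 := by linarith [one_le_slopeJ g]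
  have h2 := h0 g
  have h3 : slopeJ g * (slopeJ g + 1) ≠ 0 := mul_ne_zero h2 h1
  rw [contDiffAt_euclidean]
  intro i
  fin_cases j <;> fin_cases i <;> simp only [slopeFrame, Fin.zero_eta, Fin.isValue, Fin.mk_one,
    PiLp.toLp_apply, Matrix.cons_val_zero, Matrix.cons_val_one, Matrix.cons_val, Fin.reduceFinMk] <;>
    fun_prop (disch := assumption)

theorem contDiffAt_frame {q : E2 × (Fin 2 → ℝ)} (hn : ‖q.1‖ < 1) (j : Fin 3) :
    ContDiffAt ℝ 2 (frame j) q := by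
  have hs : ContDiffAt ℝ 2 (fun q : E2 × (Fin 2 → ℝ) => slopeFrame q.2 j) q :=
    (contDiffAt_slopeFrame q.2 j).comp q contDiffAt_snd
  have hs' := contDiffAt_euclidean.mp hs
  have hp : 0 < 1 - q.1 0 ^ 2 - q.1 1 ^ 2 := by
    have : ‖q.1‖ ^ 2 = q.1 0 ^ 2 + q.1 1 ^ 2 := by
      rw [EuclideanSpace.norm_sq_eq]; simp [Fin.sum_univ_two]
    nlinarith [norm_nonneg q.1]
  have hd : ContDiffAt ℝ 2 (fun q : E2 × (Fin 2 → ℝ) => Real.sqrt (1 - q.1 0 ^ 2 - q.1 1 ^ 2)) q := by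
    apply ContDiffAt.sqrt
    · fun_prop
    · exact hp.ne'
  have h1 : 1 + Real.sqrt (1 - q.1 0 ^ 2 - q.1 1 ^ 2) ≠ 0 := by positivity
  have := hs' 0
  have := hs' 1
  have := hs' 2
  rw [contDiffAt_euclidean]
  intro i
  simp only [frame, act_apply]
  fin_cases i <;> simp only [rot, Fin.zero_eta, Fin.isValue, Fin.mk_one, Matrix.of_apply,
    Matrix.cons_val_zero, Matrix.cons_val_one, Matrix.cons_val, Fin.reduceFinMk] <;>
    fun_prop (disch := assumption)

/-- The frame has bounded derivative near `(0, 0)`. -/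
theorem exists_frame_bound : ∃ K : ℝ, 0 < K ∧ ∀ q : E2 × (Fin 2 → ℝ), ‖q‖ ≤ 1 / 2 → ∀ j,
    DifferentiableAt ℝ (frame j) q ∧ ‖fderiv ℝ (frame j) q‖ ≤ K ∧ ‖frame j q - bv j‖ ≤ K * ‖q‖ := by
  have hc : IsCompact (Metric.closedBall (0 : E2 × (Fin 2 → ℝ)) (1 / 2)) :=
    isCompact_closedBall _ _
  have hlt : ∀ q ∈ Metric.closedBall (0 : E2 × (Fin 2 → ℝ)) (1 / 2), ‖q.1‖ < 1 := by
    intro q hq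
    rw [mem_closedBall_zero_iff] at hq
    linarith [norm_fst_le q]
  have hcont : ∀ j, ContinuousOn (fun q => fderiv ℝ (frame j) q) (Metric.closedBall 0 (1 / 2)) := by
    intro j q hq
    have := (contDiffAt_frame (hlt q hq) j).fderiv_right (m := 0) (by norm_num)
    exact this.continuousAt.continuousWithinAt
  choose K hK using fun j => hc.exists_bound_of_continuousOn (hcont j)
  refine ⟨|K 0| + |K 1| + |K 2| + 1, by positivity, fun q hq j => ?_⟩
  have hKj : K j ≤ |K 0| + |K 1| + |K 2| + 1 := by
    have a0 := abs_nonneg (K 0)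
    have a1 := abs_nonneg (K 1)
    have a2 := abs_nonneg (K 2)
    have b0 := le_abs_self (K j)
    fin_cases j <;> simp at b0 ⊢ <;> linarith
  have hq' : q ∈ Metric.closedBall (0 : E2 × (Fin 2 → ℝ)) (1 / 2) := by simpa using hq
  refine ⟨(contDiffAt_frame (hlt q hq') j).differentiableAt (by norm_num), (hK j q hq').trans hKj, ?_⟩
  have := (convex_closedBall (0 : E2 × (Fin 2 → ℝ)) (1 / 2)).norm_image_sub_le_of_norm_fderiv_le
    (f := frame j) (𝕜 := ℝ) (C := |K 0| + |K 1| + |K 2| + 1) (x := 0) (y := q)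
    (fun x hx => (contDiffAt_frame (hlt x hx) j).differentiableAt (by norm_num))
    (fun x hx => (hK j x hx).trans hKj) (by simp) hq'
  simpa [frame_zero] using this

/-! ### Modulated quantities in the physical frame -/

variable (m : Modulation) (γ : ℝ) (fl : Fluid)

/-- The rotated frame at time `t` and front-adapted position `x`. -/
noncomputable def Modulation.fr (j : Fin 3) (t : ℝ) (x : E3) : E3 := frame j (m.n t, m.frontD t x)

theorem N_eq (t : ℝ) (x : E3) : m.N t x = slopeFrame (m.frontD t x) 0 := rfl

theorem Tan_eq (μ : Fin 2) (t : ℝ) (x : E3) : m.Tan μ t x = slopeFrame (m.frontD t x) μ.succ := by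
  fin_cases μ <;> ext i <;> fin_cases i <;>
    simp [Modulation.Tan, slopeFrame, Modulation.J, slopeJ]

theorem inner_ring_N (v : E3) (t : ℝ) (x : E3) :
    inner ℝ (act (rot (m.n t))ᵀ v) (m.N t x) = inner ℝ v (m.fr 0 t x) := by
  rw [inner_act_transpose, N_eq]; rfl

theorem inner_ring_Tan (μ : Fin 2) (v : E3) (t : ℝ) (x : E3) :
    inner ℝ (act (rot (m.n t))ᵀ v) (m.Tan μ t x) = inner ℝ v (m.fr μ.succ t x) := by
  rw [inner_act_transpose, Tan_eq]; rfl

/-! ### The standing assumptions -/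

/-- The hypotheses on a solution and its modulation, bundled so that estimates can be stated as
consequences of them. -/
structure Setup (γ κ₀ M ε a T l L : ℝ) (fl : Fluid) (m : Modulation) : Prop where
  hγ : 1 < γ
  hκ₀ : 1 < κ₀
  hM : 1 < M
  hε : 0 < ε
  euler : IsEulerSolution γ a ε T fl
  modu : IsModulated γ κ₀ ε T fl m
  const : IsConstantOutside ε T fl m
  boot : Bootstrap γ a κ₀ M ε T l L fl m

theorem contDiff_slice {G : Type*} [NormedAddCommGroup G] [NormedSpace ℝ G] {n : WithTop ℕ∞}
    {F : ℝ → E3 → G} {S : Set ℝ} (hF : ContDiffOn ℝ n (fun q : ℝ × E3 => F q.1 q.2) (S ×ˢ univ))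
    {t : ℝ} (ht : t ∈ S) : ContDiff ℝ n (F t) := by
  rw [← contDiffOn_univ]
  exact hF.comp (f := fun x : E3 => (t, x)) (by fun_prop) (fun x _ => ⟨ht, mem_univ _⟩)

theorem norm_le_sum_abs (v : E3) : ‖v‖ ≤ |v 0| + |v 1| + |v 2| := by
  rw [EuclideanSpace.norm_eq, Real.sqrt_le_left (by positivity)]
  simp only [Fin.sum_univ_three, Real.norm_eq_abs, sq_abs]
  have h0 := abs_nonneg (v 0)
  have h1 := abs_nonneg (v 1)
  have h2 := abs_nonneg (v 2)
  nlinarith [sq_abs (v 0), sq_abs (v 1), sq_abs (v 2), mul_nonneg h0 h1, mul_nonneg h0 h2,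
    mul_nonneg h1 h2]

theorem abs_apply_le (v : E3) (i : Fin 3) : |v i| ≤ ‖v‖ := by
  simpa using PiLp.norm_apply_le v i

theorem norm_bv (i : Fin 3) : ‖bv i‖ = 1 := by simp

theorem vec_eq_sum (v : E3) : v = v 0 • bv 0 + v 1 • bv 1 + v 2 • bv 2 := by
  ext i; fin_cases i <;> simp

/-! ### The change of coordinates -/

section Coordinates

variable (m : Modulation)

theorem frontD_eq (t : ℝ) (x : E3) (μ : Fin 2) :
    m.frontD t x μ = m.φ t μ 0 * x 1 + m.φ t μ 1 * x 2 := by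
  simp [Modulation.frontD, Fin.sum_univ_two]

theorem front_eq (t : ℝ) (x : E3) :
    m.front t x = 1 / 2 * (m.φ t 0 0 * x 1 * x 1 + m.φ t 0 1 * x 1 * x 2 +
      (m.φ t 1 0 * x 2 * x 1 + m.φ t 1 1 * x 2 * x 2)) := by
  simp [Modulation.front, Fin.sum_univ_two]

/-- `x ↦ ∇f(x)` as a linear map. -/
noncomputable def Modulation.frontDL (t : ℝ) : E3 →L[ℝ] (Fin 2 → ℝ) :=
  LinearMap.toContinuousLinearMap
    { toFun := m.frontD t
      map_add' := fun v w => by ext i; simp [frontD_eq]; ring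
      map_smul' := fun c v => by ext i; simp [frontD_eq]; ring }

theorem frontDL_apply (t : ℝ) (x : E3) : m.frontDL t x = m.frontD t x := rfl

theorem frontD_bv_zero (t : ℝ) : m.frontD t (bv 0) = 0 := by
  ext μ; simp [frontD_eq]

theorem norm_frontD_le {t B : ℝ} (hB : ∀ μ ν, |m.φ t μ ν| ≤ B) (x : E3) :
    ‖m.frontD t x‖ ≤ B * (|x 1| + |x 2|) := by
  have hB0 : 0 ≤ B := (abs_nonneg _).trans (hB 0 0)
  rw [pi_norm_le_iff_of_nonneg (by positivity)]
  intro μ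
  rw [frontD_eq, Real.norm_eq_abs]
  refine (abs_add_le _ _).trans ?_
  rw [abs_mul, abs_mul, mul_add]
  gcongr <;> exact hB _ _

/-- The derivative of `x ↦ x + f(x) e₁`, followed by the rotation. -/
noncomputable def Modulation.posD (t : ℝ) (x : E3) : E3 →L[ℝ] E3 :=
  actL (rot (m.n t)) ∘L (ContinuousLinearMap.id ℝ E3 +
    (m.frontD t x 0 • EuclideanSpace.proj (𝕜 := ℝ) (1 : Fin 3) +
      m.frontD t x 1 • EuclideanSpace.proj (𝕜 := ℝ) (2 : Fin 3)).smulRight (bv 0))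

theorem physPos_eq (t : ℝ) (x : E3) :
    m.physPos t x = act (rot (m.n t)) (x + m.front t x • bv 0) + m.ξ t := by
  have : !₂[x 0 + m.front t x, x 1, x 2] = x + m.front t x • bv 0 := by
    ext i; fin_cases i <;> simp
  rw [Modulation.physPos, this]

theorem hasFDerivAt_front {t : ℝ} (hs : ∀ μ ν, m.φ t μ ν = m.φ t ν μ) (x : E3) :
    HasFDerivAt (m.front t) (m.frontD t x 0 • EuclideanSpace.proj (𝕜 := ℝ) (1 : Fin 3) +
      m.frontD t x 1 • EuclideanSpace.proj (𝕜 := ℝ) (2 : Fin 3)) x := by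
  have h1 : HasFDerivAt (fun x : E3 => x 1) (EuclideanSpace.proj (𝕜 := ℝ) (1 : Fin 3)) x :=
    (EuclideanSpace.proj (𝕜 := ℝ) (1 : Fin 3)).hasFDerivAt
  have h2 : HasFDerivAt (fun x : E3 => x 2) (EuclideanSpace.proj (𝕜 := ℝ) (2 : Fin 3)) x :=
    (EuclideanSpace.proj (𝕜 := ℝ) (2 : Fin 3)).hasFDerivAt
  have key := ((((h1.const_mul (m.φ t 0 0)).mul h1).add ((h1.const_mul (m.φ t 0 1)).mul h2)).add
    (((h2.const_mul (m.φ t 1 0)).mul h1).add ((h2.const_mul (m.φ t 1 1)).mul h2))).const_mul (1 / 2)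
  refine (key.congr_fderiv ?_).congr_of_eventuallyEq (Eventually.of_forall fun x => front_eq m t x)
  ext v
  simp [frontD_eq, hs 1 0]
  ring

theorem hasFDerivAt_physPos {t : ℝ} (hs : ∀ μ ν, m.φ t μ ν = m.φ t ν μ) (x : E3) :
    HasFDerivAt (m.physPos t) (m.posD t x) x := by
  have h := (hasFDerivAt_id x).add ((hasFDerivAt_front m hs x).smul_const (bv 0))
  have h2 := ((actL (rot (m.n t))).hasFDerivAt.comp x h).add_const (m.ξ t)
  refine h2.congr_of_eventuallyEq (Eventually.of_forall fun x => ?_)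
  rw [physPos_eq]; rfl

theorem posD_bv_zero (t : ℝ) (x : E3) : m.posD t x (bv 0) = act (rot (m.n t)) (bv 0) := by
  simp [Modulation.posD, actL_apply, act_zero]

theorem posD_bv_succ (t : ℝ) (x : E3) (μ : Fin 2) :
    m.posD t x (bv μ.succ) = act (rot (m.n t)) (bv μ.succ + m.frontD t x μ • bv 0) := by
  fin_cases μ <;> simp [Modulation.posD, actL_apply, act_add, act_smul]

/-- The inverse change of coordinates. -/
noncomputable def Modulation.invPos (t : ℝ) (p : E3) : E3 :=
  act (rot (m.n t))ᵀ (p - m.ξ t) - m.front t (act (rot (m.n t))ᵀ (p - m.ξ t)) • bv 0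

theorem front_add_smul (t c : ℝ) (x : E3) : m.front t (x + c • bv 0) = m.front t x := by
  simp [front_eq]

theorem front_sub_smul (t c : ℝ) (x : E3) : m.front t (x - c • bv 0) = m.front t x := by
  simp [front_eq]

theorem physPos_invPos {t : ℝ} (hn : ‖m.n t‖ ≤ 1) (p : E3) : m.physPos t (m.invPos t p) = p := by
  rw [physPos_eq, Modulation.invPos, front_sub_smul, sub_add_cancel, act_act, rot_mul_transpose hn,
    act_one, sub_add_cancel]

theorem invPos_physPos {t : ℝ} (hn : ‖m.n t‖ ≤ 1) (x : E3) : m.invPos t (m.physPos t x) = x := by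
  rw [physPos_eq, Modulation.invPos, add_sub_cancel_right, act_act, rot_transpose_mul hn,
    act_one, front_add_smul, add_sub_cancel_right]

end Coordinates

/-! ### Self-similar time -/

namespace Setup

variable {γ κ₀ M ε a T l L : ℝ} {fl : Fluid} {m : Modulation}

section
variable (H : Setup γ κ₀ M ε a T l L fl m) {t : ℝ} (ht : t ∈ Ico (-ε) T)
include H ht

theorem exp_neg_s : Real.exp (-m.s t) = m.τ t - t := by
  have := H.modu.lt_τ t ht
  rw [Modulation.s, neg_neg, Real.exp_log (by linarith)]

theorem tau_sub_le : m.τ t - t ≤ (M + 1) * ε := by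
  have := (abs_le.mp (H.boot.modulation.τ_le t ht)).2
  linarith [ht.1]

theorem t_lt : t < M * ε :=
  (H.modu.lt_τ t ht).trans_le (abs_le.mp (H.boot.modulation.τ_le t ht)).2

theorem contDiff_u : ContDiff ℝ 4 (fl.u t) := contDiff_slice H.euler.smooth_u ht
theorem contDiff_rho : ContDiff ℝ 4 (fl.ρ t) := contDiff_slice H.euler.smooth_rho ht
theorem contDiff_k : ContDiff ℝ 4 (fl.k t) := contDiff_slice H.euler.smooth_k ht

theorem differentiable_sigma : Differentiable ℝ (fl.sigma γ t) := by
  intro x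
  have h1 := (H.contDiff_rho ht).differentiable (by norm_num) x
  have h2 := (H.contDiff_k ht).differentiable (by norm_num) x
  have h3 := (H.euler.pos t ht x).ne'
  unfold Fluid.sigma
  have h4 : DifferentiableAt ℝ (fun x => fl.ρ t x ^ alphaC γ) x := h1.rpow_const (Or.inl h3)
  fun_prop

theorem sigma_pos (x : E3) : 0 < fl.sigma γ t x := by
  have h3 := H.euler.pos t ht x
  have : 0 < alphaC γ := by unfold alphaC; linarith [H.hγ]
  unfold Fluid.sigma
  positivity

end

end Setup

/-! ### Scaling -/

/-- The self-similar coordinates of `x`. -/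
noncomputable def Modulation.rescale (m : Modulation) (t : ℝ) (x : E3) : E3 :=
  !₂[Real.exp (3 / 2 * m.s t) * x 0, Real.exp (m.s t / 2) * x 1, Real.exp (m.s t / 2) * x 2]

section Scaling

variable (m : Modulation) (t : ℝ)

theorem unscale_rescale (x : E3) : m.unscale t (m.rescale t x) = x := by
  ext i
  fin_cases i <;> simp [Modulation.unscale, Modulation.rescale, ← mul_assoc, ← Real.exp_add] <;>
    ring_nf <;> simp

theorem rescale_mem {ε : ℝ} {x : E3} (hx : x ∈ Box ε) : m.rescale t x ∈ Ybox ε (m.s t) := by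
  obtain ⟨h0, h1⟩ := hx
  constructor
  · simp only [Modulation.rescale, PiLp.toLp_apply, Matrix.cons_val_zero, abs_mul, Real.abs_exp]
    rw [mul_comm]
    gcongr
  · simp only [Modulation.rescale, PiLp.toLp_apply, Matrix.cons_val_one, Matrix.cons_val]
    rw [show (Real.exp (m.s t / 2) * x 1) ^ 2 + (Real.exp (m.s t / 2) * x 2) ^ 2
      = Real.exp (m.s t / 2) ^ 2 * (x 1 ^ 2 + x 2 ^ 2) by ring, Real.sqrt_mul (by positivity),
      Real.sqrt_sq (by positivity), mul_comm]
    gcongr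

/-- The scaling as a linear map. -/
noncomputable def Modulation.unscaleL : E3 →L[ℝ] E3 :=
  LinearMap.toContinuousLinearMap
    { toFun := m.unscale t
      map_add' := fun v w => by ext i; fin_cases i <;> simp [Modulation.unscale] <;> ring
      map_smul' := fun c v => by ext i; fin_cases i <;> simp [Modulation.unscale] <;> ring }

theorem unscale_bv_zero : m.unscale t (bv 0) = Real.exp (-(3 / 2) * m.s t) • bv 0 := by
  ext i; fin_cases i <;> simp [Modulation.unscale]

theorem unscale_bv_succ (μ : Fin 2) :
    m.unscale t (bv μ.succ) = Real.exp (-(1 / 2) * m.s t) • bv μ.succ := by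
  ext i; fin_cases μ <;> fin_cases i <;> simp [Modulation.unscale]

theorem fderiv_unscale {h : E3 → ℝ} (hh : Differentiable ℝ h) (x v : E3) :
    fderiv ℝ (fun y => h (m.unscale t y)) (m.rescale t x) v = fderiv ℝ h x (m.unscale t v) := by
  have h1 : HasFDerivAt h (fderiv ℝ h x) (m.unscaleL t (m.rescale t x)) := by
    have : m.unscaleL t (m.rescale t x) = x := unscale_rescale m t x
    rw [this]; exact (hh x).hasFDerivAt
  have h2 := h1.comp (m.rescale t x) (m.unscaleL t).hasFDerivAt
  have h3 : fderiv ℝ (fun y => h (m.unscale t y)) (m.rescale t x) = _ := h2.fderiv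
  rw [h3]; rfl

theorem pd_zero_unscale {h : E3 → ℝ} (hh : Differentiable ℝ h) (x : E3) :
    pd 0 (fun y => h (m.unscale t y)) (m.rescale t x) = Real.exp (-(3 / 2) * m.s t) * pd 0 h x := by
  rw [pd, fderiv_unscale m t hh, unscale_bv_zero, map_smul]; rfl

theorem pd_succ_unscale {h : E3 → ℝ} (hh : Differentiable ℝ h) (x : E3) (μ : Fin 2) :
    pd μ.succ (fun y => h (m.unscale t y)) (m.rescale t x)
      = Real.exp (-(1 / 2) * m.s t) * pd μ.succ h x := by
  rw [pd, fderiv_unscale m t hh, unscale_bv_succ, map_smul]; rfl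

end Scaling

/-- The multi-index `e_i`. -/
def unitIdx (i : Fin 3) : Fin 3 → ℕ := ![![1, 0, 0], ![0, 1, 0], ![0, 0, 1]] i

theorem pdIter_unitIdx (i : Fin 3) (F : E3 → ℝ) : pdIter (unitIdx i) F = pd i F := by
  fin_cases i <;> simp [pdIter, unitIdx]

theorem pdIter_zero (F : E3 → ℝ) : pdIter 0 F = F := by
  simp [pdIter]

/-! ### Fields in front-adapted coordinates -/

section Fields

variable (m : Modulation) (fl : Fluid)

/-- The component of the velocity along the `j`-th frame vector. -/
noncomputable def Modulation.vel (j : Fin 3) (t : ℝ) (x : E3) : ℝ :=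
  inner ℝ (fl.u t (m.physPos t x)) (m.fr j t x)

theorem w_eq (γ t : ℝ) : m.w γ fl t =
    fun x => m.vel fl 0 t x + fl.sigma γ t (m.physPos t x) := by
  ext x; rw [Modulation.w, Modulation.uRing, inner_ring_N]; rfl

theorem z_eq (γ t : ℝ) : m.z γ fl t =
    fun x => m.vel fl 0 t x - fl.sigma γ t (m.physPos t x) := by
  ext x; rw [Modulation.z, Modulation.uRing, inner_ring_N]; rfl

theorem A_eq (ν : Fin 2) (t : ℝ) : m.A fl ν t =
    fun y => m.vel fl ν.succ t (m.unscale t y) := by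
  ext x; rw [Modulation.A, Modulation.uRing, inner_ring_Tan]; rfl

theorem zetaN_eq (t : ℝ) (x : E3) :
    m.zetaN fl t x = inner ℝ (fl.zeta t (m.physPos t x)) (m.fr 0 t x) := by
  rw [Modulation.zetaN, Modulation.zetaRing, inner_ring_N]

theorem zetaT_eq (μ : Fin 2) (t : ℝ) (x : E3) :
    m.zetaT fl μ t x = inner ℝ (fl.zeta t (m.physPos t x)) (m.fr μ.succ t x) := by
  rw [Modulation.zetaT, Modulation.zetaRing, inner_ring_Tan]

/-- The derivative of `x ↦ fr j t x`. -/
noncomputable def Modulation.frD (j : Fin 3) (t : ℝ) (x : E3) : E3 →L[ℝ] E3 :=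
  (fderiv ℝ (frame j) (m.n t, m.frontD t x)) ∘L ((0 : E3 →L[ℝ] E2).prod (m.frontDL t))

theorem hasFDerivAt_fr (j : Fin 3) {t : ℝ} (hn : ‖m.n t‖ < 1) (x : E3) :
    HasFDerivAt (m.fr j t) (m.frD j t x) x := by
  have h1 : HasFDerivAt (fun x => (m.n t, m.frontD t x)) ((0 : E3 →L[ℝ] E2).prod (m.frontDL t)) x :=
    (hasFDerivAt_const (m.n t) x).prodMk (m.frontDL t).hasFDerivAt
  have h2 : HasFDerivAt (frame j) (fderiv ℝ (frame j) (m.n t, m.frontD t x))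
      (m.n t, m.frontD t x) :=
    ((contDiffAt_frame (q := (m.n t, m.frontD t x)) hn j).differentiableAt (by norm_num)).hasFDerivAt
  exact h2.comp x h1

theorem frD_bv_zero (j : Fin 3) (t : ℝ) (x : E3) : m.frD j t x (bv 0) = 0 := by
  simp only [Modulation.frD, ContinuousLinearMap.comp_apply, ContinuousLinearMap.prod_apply,
    frontDL_apply, frontD_bv_zero]
  exact map_zero _

theorem hasFDerivAt_vel (j : Fin 3) {t : ℝ} (hn : ‖m.n t‖ < 1)
    (hs : ∀ μ ν, m.φ t μ ν = m.φ t ν μ) (hu : Differentiable ℝ (fl.u t)) (x : E3) :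
    HasFDerivAt (m.vel fl j t)
      (((fderivInnerCLM ℝ (fl.u t (m.physPos t x), m.fr j t x)).comp
        (((fderiv ℝ (fl.u t) (m.physPos t x)).comp (m.posD t x)).prod (m.frD j t x)))) x :=
  ((hu _).hasFDerivAt.comp x (hasFDerivAt_physPos m hs x)).inner ℝ (hasFDerivAt_fr m j hn x)

theorem pd_vel (j i : Fin 3) {t : ℝ} (hn : ‖m.n t‖ < 1)
    (hs : ∀ μ ν, m.φ t μ ν = m.φ t ν μ) (hu : Differentiable ℝ (fl.u t)) (x : E3) :
    pd i (m.vel fl j t) x =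
      inner ℝ (fderiv ℝ (fl.u t) (m.physPos t x) (m.posD t x (bv i))) (m.fr j t x)
        + inner ℝ (fl.u t (m.physPos t x)) (m.frD j t x (bv i)) := by
  rw [pd, (hasFDerivAt_vel m fl j hn hs hu x).fderiv]
  simp [add_comm]

theorem pd_comp_physPos (i : Fin 3) {t : ℝ} (hs : ∀ μ ν, m.φ t μ ν = m.φ t ν μ) {h : E3 → ℝ}
    (hh : Differentiable ℝ h) (x : E3) :
    pd i (fun x => h (m.physPos t x)) x = fderiv ℝ h (m.physPos t x) (m.posD t x (bv i)) := by
  have : HasFDerivAt (fun x => h (m.physPos t x)) _ x :=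
    (hh _).hasFDerivAt.comp x (hasFDerivAt_physPos m hs x)
  rw [pd, this.fderiv]; rfl

end Fields

/-! ### The bootstrap bounds in front-adapted coordinates -/

namespace Setup

variable {γ κ₀ M ε a T l L : ℝ} {fl : Fluid} {m : Modulation}
  (H : Setup γ κ₀ M ε a T l L fl m) {t : ℝ} (ht : t ∈ Ico (-ε) T)
include H ht

theorem symm (μ ν : Fin 2) : m.φ t μ ν = m.φ t ν μ := H.modu.symm t ht μ ν

theorem differentiable_u : Differentiable ℝ (fl.u t) := (H.contDiff_u ht).differentiable (by norm_num)
theorem differentiable_rho : Differentiable ℝ (fl.ρ t) :=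
  (H.contDiff_rho ht).differentiable (by norm_num)
theorem differentiable_k : Differentiable ℝ (fl.k t) := (H.contDiff_k ht).differentiable (by norm_num)

theorem differentiable_physPos : Differentiable ℝ (m.physPos t) :=
  fun x => (hasFDerivAt_physPos m (H.symm ht) x).differentiableAt

theorem differentiable_vel (hn : ‖m.n t‖ < 1) (j : Fin 3) : Differentiable ℝ (m.vel fl j t) :=
  fun x => (hasFDerivAt_vel m fl j hn (H.symm ht) (H.differentiable_u ht) x).differentiableAt

theorem differentiable_sigma_pos : Differentiable ℝ (fun x => fl.sigma γ t (m.physPos t x)) :=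
  (H.differentiable_sigma ht).comp (H.differentiable_physPos ht)

theorem differentiable_w (hn : ‖m.n t‖ < 1) : Differentiable ℝ (m.w γ fl t) := by
  rw [w_eq]; exact (H.differentiable_vel ht hn 0).add (H.differentiable_sigma_pos ht)

theorem differentiable_z (hn : ‖m.n t‖ < 1) : Differentiable ℝ (m.z γ fl t) := by
  rw [z_eq]; exact (H.differentiable_vel ht hn 0).sub (H.differentiable_sigma_pos ht)

theorem pd_W_zero (hn : ‖m.n t‖ < 1) (x : E3) :
    pd 0 (m.W γ fl t) (m.rescale t x) = Real.exp (-m.s t) * pd 0 (m.w γ fl t) x := by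
  have hd : Differentiable ℝ (fun x => Real.exp (m.s t / 2) * (m.w γ fl t x - m.κ t)) :=
    ((H.differentiable_w ht hn).sub_const _).const_mul _
  have := pd_zero_unscale m t hd x
  refine this.trans ?_
  have h2 : pd 0 (fun x => Real.exp (m.s t / 2) * (m.w γ fl t x - m.κ t)) x =
      Real.exp (m.s t / 2) * pd 0 (m.w γ fl t) x := by
    rw [pd, fderiv_const_mul ((H.differentiable_w ht hn x).sub_const _), fderiv_sub_const]
    rfl
  rw [h2, ← mul_assoc, ← Real.exp_add]
  ring_nf

theorem pd_W_succ (hn : ‖m.n t‖ < 1) (x : E3) (μ : Fin 2) :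
    pd μ.succ (m.W γ fl t) (m.rescale t x) = pd μ.succ (m.w γ fl t) x := by
  have hd : Differentiable ℝ (fun x => Real.exp (m.s t / 2) * (m.w γ fl t x - m.κ t)) :=
    ((H.differentiable_w ht hn).sub_const _).const_mul _
  have := pd_succ_unscale m t hd x μ
  refine this.trans ?_
  have h2 : pd μ.succ (fun x => Real.exp (m.s t / 2) * (m.w γ fl t x - m.κ t)) x =
      Real.exp (m.s t / 2) * pd μ.succ (m.w γ fl t) x := by
    rw [pd, fderiv_const_mul ((H.differentiable_w ht hn x).sub_const _), fderiv_sub_const]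
    rfl
  rw [h2, ← mul_assoc, ← Real.exp_add]
  ring_nf
  simp

theorem exp_s_pos_rpow : Real.exp (m.s t) = (m.τ t - t)⁻¹ := by
  rw [← H.exp_neg_s ht, Real.exp_neg, inv_inv]

theorem z_bound {x : E3} (hx : x ∈ Box ε) : |m.z γ fl t x| ≤ M * ε := by
  have := (H.boot.zak t ht).Z_check (m.rescale t x) (rescale_mem m t hx) 0 rfl (by simp [order])
  simpa [pdIter_zero, torder, Modulation.Z, unscale_rescale] using this

theorem vel_bound {x : E3} (hx : x ∈ Box ε) (ν : Fin 2) : |m.vel fl ν.succ t x| ≤ M * ε := by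
  have := (H.boot.zak t ht).A_check (m.rescale t x) (rescale_mem m t hx) ν 0 rfl (by simp [order])
  simpa [pdIter_zero, torder, A_eq, unscale_rescale] using this

theorem pd_z_zero (hn : ‖m.n t‖ < 1) {x : E3} (hx : x ∈ Box ε) : |pd 0 (m.z γ fl t) x| ≤ M := by
  have := (H.boot.zak t ht).Z_one (m.rescale t x) (rescale_mem m t hx) (unitIdx 0) (by simp [unitIdx])
    (by simp [order, unitIdx])
  rw [pdIter_unitIdx] at this
  have h2 := pd_zero_unscale m t (H.differentiable_z ht hn) x
  rw [show m.Z γ fl t = fun y => m.z γ fl t (m.unscale t y) from rfl, h2, abs_mul, Real.abs_exp,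
    mul_comm (M ^ _)] at this
  have h3 := le_of_mul_le_mul_left this (Real.exp_pos _)
  refine h3.trans ?_
  have : (M:ℝ) ^ ((1 + (torder (unitIdx 0) : ℝ)) / 2) ≤ M ^ (1:ℝ) :=
    Real.rpow_le_rpow_of_exponent_le H.hM.le (by simp [torder, unitIdx]; norm_num)
  simpa using this

theorem pd_z_succ (hn : ‖m.n t‖ < 1) {x : E3} (hx : x ∈ Box ε) (μ : Fin 2) :
    |pd μ.succ (m.z γ fl t) x| ≤ M * ε ^ (1 / 2 : ℝ) := by
  have := (H.boot.zak t ht).Z_check (m.rescale t x) (rescale_mem m t hx) (unitIdx μ.succ)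
    (by fin_cases μ <;> simp [unitIdx]) (by fin_cases μ <;> simp [order, unitIdx])
  rw [pdIter_unitIdx] at this
  have h2 := pd_succ_unscale m t (H.differentiable_z ht hn) x μ
  have h4 : torder (unitIdx μ.succ) = 1 := by fin_cases μ <;> simp [torder, unitIdx]
  rw [show m.Z γ fl t = fun y => m.z γ fl t (m.unscale t y) from rfl, h2, abs_mul, Real.abs_exp,
    h4, mul_comm (M * _)] at this
  norm_num at this
  simpa using le_of_mul_le_mul_left this (Real.exp_pos _)

theorem pd_vel_zero (hn : ‖m.n t‖ < 1) {x : E3} (hx : x ∈ Box ε) (ν : Fin 2) :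
    |pd 0 (m.vel fl ν.succ t) x| ≤ M := by
  have := (H.boot.zak t ht).A_one (m.rescale t x) (rescale_mem m t hx) ν
  have h2 := pd_zero_unscale m t (H.differentiable_vel ht hn ν.succ) x
  rw [A_eq, h2, abs_mul, Real.abs_exp, mul_comm M] at this
  exact le_of_mul_le_mul_left this (Real.exp_pos _)

theorem pd_vel_succ (hn : ‖m.n t‖ < 1) {x : E3} (hx : x ∈ Box ε) (ν μ : Fin 2) :
    |pd μ.succ (m.vel fl ν.succ t) x| ≤ M * ε ^ (1 / 2 : ℝ) := by
  have := (H.boot.zak t ht).A_check (m.rescale t x) (rescale_mem m t hx) ν (unitIdx μ.succ)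
    (by fin_cases μ <;> simp [unitIdx]) (by fin_cases μ <;> simp [order, unitIdx])
  rw [pdIter_unitIdx] at this
  have h2 := pd_succ_unscale m t (H.differentiable_vel ht hn ν.succ) x μ
  have h4 : torder (unitIdx μ.succ) = 1 := by fin_cases μ <;> simp [torder, unitIdx]
  rw [A_eq, h2, abs_mul, Real.abs_exp, h4, mul_comm (M * _)] at this
  norm_num at this
  simpa using le_of_mul_le_mul_left this (Real.exp_pos _)

theorem pd_k_zero {x : E3} (hx : x ∈ Box ε) :
    |pd 0 (fun x => fl.k t (m.physPos t x)) x| ≤ ε ^ (1 / 4 : ℝ) := by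
  have := (H.boot.zak t ht).K_one (m.rescale t x) (rescale_mem m t hx)
  have h2 := pd_zero_unscale m t ((H.differentiable_k ht).comp (H.differentiable_physPos ht)) x
  rw [show m.K fl t = fun y => (fl.k t ∘ m.physPos t) (m.unscale t y) from rfl, h2, abs_mul,
    Real.abs_exp, mul_comm (ε ^ _)] at this
  exact le_of_mul_le_mul_left this (Real.exp_pos _)

theorem pd_k_succ {x : E3} (hx : x ∈ Box ε) (μ : Fin 2) :
    |pd μ.succ (fun x => fl.k t (m.physPos t x)) x| ≤ ε ^ (1 / 8 : ℝ) := by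
  have h4 : torder (unitIdx μ.succ) = 1 := by fin_cases μ <;> simp [torder, unitIdx]
  have := (H.boot.zak t ht).K_check (m.rescale t x) (rescale_mem m t hx) (unitIdx μ.succ)
    (by fin_cases μ <;> simp [unitIdx]) (Or.inl h4)
  have h2 := pd_succ_unscale m t ((H.differentiable_k ht).comp (H.differentiable_physPos ht)) x μ
  rw [pdIter_unitIdx, show m.K fl t = fun y => (fl.k t ∘ m.physPos t) (m.unscale t y) from rfl, h2,
    abs_mul, Real.abs_exp, h4, mul_comm (ε ^ _)] at this
  norm_num at this
  change |pd μ.succ (fl.k t ∘ m.physPos t) x| ≤ _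
  simpa using le_of_mul_le_mul_left this (Real.exp_pos _)

theorem pd_w_succ (hn : ‖m.n t‖ < 1) {x : E3} (hx : x ∈ Box ε) (μ : Fin 2) :
    |pd μ.succ (m.w γ fl t) x| ≤ 1 := by
  have h4 : torder (unitIdx μ.succ) = 1 := by fin_cases μ <;> simp [torder, unitIdx]
  have := (H.boot.w t ht).check (m.rescale t x) (rescale_mem m t hx) (unitIdx μ.succ)
    (by fin_cases μ <;> simp [unitIdx]) h4
  rwa [pdIter_unitIdx, H.pd_W_succ ht hn] at this

/-- The two bounds for `∂₁W` in the bootstrap assumptions, combined. -/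
theorem pd_W_zero_le {x : E3} (hx : x ∈ Box ε) :
    |pd 0 (m.W γ fl t) (m.rescale t x)| ≤
      etaTilde ε ((1 / 2 : ℝ) • m.rescale t x) ^ (-(1 / 3) : ℝ)
        + 2 * eta (m.rescale t x) ^ (-(1 / 3) : ℝ) := by
  have hy := rescale_mem m t hx
  have h1 : 0 ≤ eta (m.rescale t x) ^ (-(1 / 3) : ℝ) := by
    apply Real.rpow_nonneg; unfold eta; positivity
  have h2 : 0 ≤ etaTilde ε ((1 / 2 : ℝ) • m.rescale t x) ^ (-(1 / 3) : ℝ) := by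
    have := H.hε
    apply Real.rpow_nonneg; unfold etaTilde; positivity
  rcases le_or_gt ‖m.rescale t x‖ L with h | h
  · refine ((H.boot.w t ht).one_near _ hy h).trans ?_
    split_ifs <;> linarith
  · refine ((H.boot.w t ht).one_far _ hy h).trans ?_
    linarith

/-- Back in the variable `x`, the decay of `∂₁W` like `|y₁|^{-2/3}` becomes a bound uniform in time:
the factors `e^s` cancel exactly. -/
theorem pd_w_zero_of_ne (hn : ‖m.n t‖ < 1) {x : E3} (hx : x ∈ Box ε) (h0 : x 0 ≠ 0) :
    |pd 0 (m.w γ fl t) x| ≤ 4 * |x 0| ^ (-(2 / 3) : ℝ) := by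
  have h1 := H.pd_W_zero_le ht hx
  have hε := H.hε
  set y := m.rescale t x with hy
  have hy0 : y 0 = Real.exp (3 / 2 * m.s t) * x 0 := by simp [hy, Modulation.rescale]
  have hpos : 0 < |x 0| := abs_pos.mpr h0
  have key : (y 0 ^ 2) ^ (-(1 / 3) : ℝ) = Real.exp (-m.s t) * |x 0| ^ (-(2 / 3) : ℝ) := by
    rw [hy0, mul_pow, ← sq_abs (x 0), Real.mul_rpow (by positivity) (by positivity),
      ← Real.rpow_natCast |x 0| 2, ← Real.rpow_mul hpos.le, ← Real.exp_nat_mul, ← Real.exp_mul]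
    norm_num
    left
    ring_nf
  have hyp : 0 < y 0 ^ 2 := by rw [hy0]; positivity
  have e1 : etaTilde ε ((1 / 2 : ℝ) • y) ^ (-(1 / 3) : ℝ) ≤ 2 * (y 0 ^ 2) ^ (-(1 / 3) : ℝ) := by
    calc etaTilde ε ((1 / 2 : ℝ) • y) ^ (-(1 / 3) : ℝ)
        ≤ (1 / 8 * y 0 ^ 2) ^ (-(1 / 3) : ℝ) := by
          apply Real.rpow_le_rpow_of_nonpos (by positivity) _ (by norm_num)
          simp only [etaTilde, PiLp.smul_apply, smul_eq_mul]
          have : 0 ≤ ((1 / 2 * y 1) ^ 2 + (1 / 2 * y 2) ^ 2) ^ 3 := by positivity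
          have : 0 < ε ^ 3 := by positivity
          nlinarith
      _ = 2 * (y 0 ^ 2) ^ (-(1 / 3) : ℝ) := by
          rw [Real.mul_rpow (by norm_num) (by positivity)]
          congr 1
          rw [show (1 / 8 : ℝ) = 2 ^ (-3 : ℝ) by norm_num, ← Real.rpow_mul (by norm_num)]
          norm_num
  have e2 : eta y ^ (-(1 / 3) : ℝ) ≤ (y 0 ^ 2) ^ (-(1 / 3) : ℝ) := by
    apply Real.rpow_le_rpow_of_nonpos (by positivity) _ (by norm_num)
    simp only [eta]
    have : 0 ≤ (y 1 ^ 2 + y 2 ^ 2) ^ 3 := by positivity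
    linarith
  rw [hy, H.pd_W_zero ht hn, abs_mul, Real.abs_exp, ← hy] at h1
  rw [key] at e1 e2
  have : Real.exp (-m.s t) * |pd 0 (m.w γ fl t) x| ≤
      Real.exp (-m.s t) * (4 * |x 0| ^ (-(2 / 3) : ℝ)) := by linarith
  exact le_of_mul_le_mul_left this (Real.exp_pos _)

/-- A crude bound that holds also on the front `x₁ = 0`; it uses only `etaTilde ≥ ε ^ 3`. -/
theorem pd_w_zero_le (hn : ‖m.n t‖ < 1) {x : E3} (hx : x ∈ Box ε) :
    |pd 0 (m.w γ fl t) x| ≤ (m.τ t - t)⁻¹ * (ε⁻¹ + 2) := by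
  have h1 := H.pd_W_zero_le ht hx
  have hε := H.hε
  set y := m.rescale t x with hy
  have e1 : etaTilde ε ((1 / 2 : ℝ) • y) ^ (-(1 / 3) : ℝ) ≤ ε⁻¹ := by
    calc etaTilde ε ((1 / 2 : ℝ) • y) ^ (-(1 / 3) : ℝ)
        ≤ (ε ^ 3) ^ (-(1 / 3) : ℝ) := by
          apply Real.rpow_le_rpow_of_nonpos (by positivity) _ (by norm_num)
          simp only [etaTilde, PiLp.smul_apply, smul_eq_mul]
          have : 0 ≤ ((1 / 2 * y 1) ^ 2 + (1 / 2 * y 2) ^ 2) ^ 3 := by positivity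
          nlinarith [sq_nonneg (y 0)]
      _ = ε⁻¹ := by
          rw [← Real.rpow_natCast ε 3, ← Real.rpow_mul hε.le, ← Real.rpow_neg_one]
          norm_num
  have e2 : eta y ^ (-(1 / 3) : ℝ) ≤ 1 := by
    apply Real.rpow_le_one_of_one_le_of_nonpos _ (by norm_num)
    simp only [eta]
    have : 0 ≤ (y 1 ^ 2 + y 2 ^ 2) ^ 3 := by positivity
    nlinarith [sq_nonneg (y 0)]
  rw [hy, H.pd_W_zero ht hn, abs_mul, Real.abs_exp, ← hy, Real.exp_neg] at h1
  rw [← H.exp_s_pos_rpow ht]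
  rw [inv_mul_le_iff₀ (Real.exp_pos _)] at h1
  refine h1.trans ?_
  gcongr
  linarith

/-- The Riemann variable `w` differs from its amplitude `κ` by `O(ε^{1/6})` throughout the box, since
`e^{-s/2} η^{1/6}` is of the size of `|x₁|^{1/3} + |x̌|` there. -/
theorem w_sub_kappa {x : E3} (hx : x ∈ Box ε) (hε1 : ε ≤ 1) :
    |m.w γ fl t x - m.κ t| ≤ 2 * ((M + 1) ^ 3 + 68) * ε ^ (1 / 6 : ℝ) := by
  have h1 := (H.boot.w t ht).zero (m.rescale t x) (rescale_mem m t hx)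
  have hε := H.hε
  have hM := H.hM
  set y := m.rescale t x with hy
  have hW : m.W γ fl t y = Real.exp (m.s t / 2) * (m.w γ fl t x - m.κ t) := by
    simp only [Modulation.W, hy, unscale_rescale]
  have he : Real.exp (-m.s t / 2) = (Real.exp (-m.s t) ^ 3) ^ (1 / 6 : ℝ) := by
    rw [← Real.exp_nat_mul, ← Real.exp_mul]; congr 1; push_cast; ring
  have heta : Real.exp (-m.s t) ^ 3 * eta y =
      Real.exp (-m.s t) ^ 3 + x 0 ^ 2 + (x 1 ^ 2 + x 2 ^ 2) ^ 3 := by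
    have p0 : Real.exp (-m.s t) ^ 3 * Real.exp (3 / 2 * m.s t) ^ 2 = 1 := by
      rw [← Real.exp_nat_mul, ← Real.exp_nat_mul, ← Real.exp_add, Real.exp_eq_one_iff]
      push_cast; ring
    have p1 : Real.exp (-m.s t) ^ 3 * Real.exp (m.s t / 2) ^ 6 = 1 := by
      rw [← Real.exp_nat_mul, ← Real.exp_nat_mul, ← Real.exp_add, Real.exp_eq_one_iff]
      push_cast; ring
    simp only [eta, hy, Modulation.rescale, PiLp.toLp_apply, Matrix.cons_val_zero,
      Matrix.cons_val_one, Matrix.cons_val]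
    linear_combination (x 0 ^ 2) * p0 + ((x 1 ^ 2 + x 2 ^ 2) ^ 3) * p1
  have hx0 : x 0 ^ 2 ≤ 4 * ε := by
    have := hx.1
    rw [← sq_abs]
    calc |x 0| ^ 2 ≤ (2 * ε ^ (1 / 2 : ℝ)) ^ 2 := by gcongr
      _ = 4 * ε := by
        rw [mul_pow, ← Real.rpow_natCast (ε ^ _), ← Real.rpow_mul hε.le]; norm_num
  have hx1 : (x 1 ^ 2 + x 2 ^ 2) ^ 3 ≤ 64 * ε := by
    have := hx.2
    calc (x 1 ^ 2 + x 2 ^ 2) ^ 3 = Real.sqrt (x 1 ^ 2 + x 2 ^ 2) ^ 6 := by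
          rw [show (6:ℕ) = 2 * 3 by norm_num, pow_mul, Real.sq_sqrt (by positivity)]
      _ ≤ (2 * ε ^ (1 / 6 : ℝ)) ^ 6 := by gcongr
      _ = 64 * ε := by
        rw [mul_pow, ← Real.rpow_natCast (ε ^ _), ← Real.rpow_mul hε.le]; norm_num
  have he3 : Real.exp (-m.s t) ^ 3 ≤ (M + 1) ^ 3 * ε := by
    rw [H.exp_neg_s ht]
    have := H.tau_sub_le ht
    have h0 := H.modu.lt_τ t ht
    calc (m.τ t - t) ^ 3 ≤ ((M + 1) * ε) ^ 3 := by gcongr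
      _ = (M + 1) ^ 3 * (ε * (ε * ε)) := by ring
      _ ≤ (M + 1) ^ 3 * (ε * (1 * 1)) := by gcongr
      _ = _ := by ring
  have heta0 : 0 ≤ eta y := by unfold eta; positivity
  have hC : (1:ℝ) ≤ (M + 1) ^ 3 + 68 := by
    have : (0:ℝ) ≤ (M + 1) ^ 3 := by positivity
    linarith
  have hsmall : ε ^ (1 / 20 : ℝ) ≤ 1 := Real.rpow_le_one hε.le hε1 (by norm_num)
  calc |m.w γ fl t x - m.κ t| = Real.exp (-m.s t / 2) * |m.W γ fl t y| := by
        rw [hW, abs_mul, Real.abs_exp, ← mul_assoc, ← Real.exp_add]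
        ring_nf; simp
    _ ≤ Real.exp (-m.s t / 2) * ((1 + ε ^ (1 / 20 : ℝ)) * eta y ^ (1 / 6 : ℝ)) := by gcongr
    _ = (1 + ε ^ (1 / 20 : ℝ)) * (Real.exp (-m.s t) ^ 3 * eta y) ^ (1 / 6 : ℝ) := by
        rw [he, Real.mul_rpow (by positivity) heta0]; ring
    _ ≤ 2 * (((M + 1) ^ 3 + 68) * ε) ^ (1 / 6 : ℝ) := by
        rw [heta]
        refine mul_le_mul (by linarith) (Real.rpow_le_rpow (by positivity) (by linarith)
          (by norm_num)) (by positivity) (by norm_num)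
    _ = 2 * (((M + 1) ^ 3 + 68) ^ (1 / 6 : ℝ) * ε ^ (1 / 6 : ℝ)) := by
        rw [Real.mul_rpow (by linarith) hε.le]
    _ ≤ 2 * (((M + 1) ^ 3 + 68) ^ (1 : ℝ) * ε ^ (1 / 6 : ℝ)) := by
        gcongr
        norm_num
    _ = _ := by rw [Real.rpow_one]; ring

end Setup

/-! ### Small `ε` -/

theorem eventually_mul_rpow_le (C : ℝ) {c p : ℝ} (hp : 0 < p) (hc : 0 < c) :
    ∀ᶠ ε in 𝓝[>] (0 : ℝ), C * ε ^ p ≤ c := by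
  have h1 : Tendsto (fun ε : ℝ => C * ε ^ p) (𝓝[>] 0) (𝓝 (C * 0 ^ p)) :=
    ((Real.continuousAt_rpow_const 0 p (Or.inr hp.le)).tendsto.const_mul C).mono_left
      nhdsWithin_le_nhds
  rw [Real.zero_rpow hp.ne', mul_zero] at h1
  exact (h1.eventually (gt_mem_nhds hc)).mono fun _ h => h.le

theorem eventually_le_const {c : ℝ} (hc : 0 < c) : ∀ᶠ ε in 𝓝[>] (0 : ℝ), ε ≤ c :=
  (eventually_mul_rpow_le 1 one_pos hc).mono fun ε h => by simpa using h

theorem eventually_pos : ∀ᶠ ε in 𝓝[>] (0 : ℝ), 0 < ε := eventually_mem_nhdsWithin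

/-! ### The frame is close to the standard one -/

/-- At time `t` the frame is `O(ε)`-close to the standard frame, with `O(ε)` derivatives in `x`. -/
structure FrameFacts (C ε : ℝ) (m : Modulation) (t : ℝ) : Prop where
  n_le : ‖m.n t‖ ≤ 1 / 2
  q_le : ∀ x : E3, |x 1| ≤ 1 → |x 2| ≤ 1 → ‖(m.n t, m.frontD t x)‖ ≤ 1 / 2
  fr_sub : ∀ x : E3, |x 1| ≤ 1 → |x 2| ≤ 1 → ∀ j, ‖m.fr j t x - bv j‖ ≤ C * ε
  frD_le : ∀ x : E3, |x 1| ≤ 1 → |x 2| ≤ 1 → ∀ j i, ‖m.frD j t x (bv i)‖ ≤ C * ε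

/-- The direction `n` and the curvature `φ` are `O(ε)`, and the frame is a smooth function of `n` and
the slope of the front. -/
theorem exists_frameFacts {M : ℝ} (hM : 1 < M) : ∃ C, 0 < C ∧ ∀ᶠ ε in 𝓝[>] (0 : ℝ),
    ∀ (γ κ₀ a T l L : ℝ) (fl : Fluid) (m : Modulation), Setup γ κ₀ M ε a T l L fl m →
      ∀ t ∈ Ico (-ε) T, FrameFacts C ε m t := by
  obtain ⟨K, hK, hb⟩ := exists_frame_bound
  refine ⟨2 * M ^ 2 * (K + 1), by positivity, ?_⟩
  filter_upwards [eventually_pos, eventually_le_const one_pos,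
    eventually_mul_rpow_le (2 * M ^ 2) one_pos (show (0:ℝ) < 1 / 2 by norm_num)]
    with ε hε hε1 hsm γ κ₀ a T l L fl m H t ht
  rw [Real.rpow_one] at hsm
  have hn : ‖m.n t‖ ≤ 2 * M ^ 2 * ε := by
    refine (H.boot.modulation.n_le t ht).trans ?_
    have : ε ^ (3 / 2 : ℝ) ≤ ε ^ (1 : ℝ) := Real.rpow_le_rpow_of_exponent_ge hε hε1 (by norm_num)
    rw [Real.rpow_one] at this
    have h0 : 0 ≤ M ^ 2 * ε := by positivity
    nlinarith [mul_le_mul_of_nonneg_left this (sq_nonneg M)]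
  have hg : ∀ x : E3, |x 1| ≤ 1 → |x 2| ≤ 1 → ‖m.frontD t x‖ ≤ 2 * M ^ 2 * ε := by
    intro x h1 h2
    refine (norm_frontD_le m (H.boot.modulation.φ_le t ht) x).trans ?_
    have h0 : 0 ≤ M ^ 2 * ε := by positivity
    nlinarith
  have hq : ∀ x : E3, |x 1| ≤ 1 → |x 2| ≤ 1 → ‖(m.n t, m.frontD t x)‖ ≤ 2 * M ^ 2 * ε :=
    fun x h1 h2 => norm_prod_le_iff.mpr ⟨hn, hg x h1 h2⟩
  have hbv : ∀ i, ‖m.frontD t (bv i)‖ ≤ 2 * M ^ 2 * ε := fun i =>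
    hg _ ((abs_apply_le _ _).trans (norm_bv i).le) ((abs_apply_le _ _).trans (norm_bv i).le)
  have hA : 0 ≤ 2 * M ^ 2 * ε := by positivity
  refine ⟨hn.trans hsm, fun x h1 h2 => (hq x h1 h2).trans hsm,
    fun x h1 h2 j => ?_, fun x h1 h2 j i => ?_⟩
  · refine (hb _ ((hq x h1 h2).trans hsm) j).2.2.trans ?_
    have := mul_le_mul_of_nonneg_left (hq x h1 h2) hK.le
    nlinarith
  · have h3 := (hb _ ((hq x h1 h2).trans hsm) j).2.1
    have h4 : ‖((0 : E2), m.frontD t (bv i))‖ ≤ 2 * M ^ 2 * ε :=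
      norm_prod_le_iff.mpr ⟨by simpa using hA, hbv i⟩
    calc ‖m.frD j t x (bv i)‖ = ‖fderiv ℝ (frame j) (m.n t, m.frontD t x)
          ((0 : E2), m.frontD t (bv i))‖ := rfl
      _ ≤ K * (2 * M ^ 2 * ε) :=
          (ContinuousLinearMap.le_opNorm _ _).trans (mul_le_mul h3 h4 (norm_nonneg _) hK.le)
      _ ≤ _ := by nlinarith

/-! ### Contraction onto the box -/

/-- The gauge of the box. -/
noncomputable def boxGauge (ε : ℝ) (x : E3) : ℝ :=
  max (|x 0| / (2 * ε ^ (1 / 2 : ℝ))) (Real.sqrt (x 1 ^ 2 + x 2 ^ 2) / (2 * ε ^ (1 / 6 : ℝ)))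

theorem mem_box_iff {ε : ℝ} (hε : 0 < ε) (x : E3) : x ∈ Box ε ↔ boxGauge ε x ≤ 1 := by
  rw [boxGauge, max_le_iff, div_le_one (by positivity), div_le_one (by positivity)]; rfl

theorem boxGauge_smul {ε : ℝ} {c : ℝ} (hc : 0 ≤ c) (x : E3) :
    boxGauge ε (c • x) = c * boxGauge ε x := by
  have : Real.sqrt ((c * x 1) ^ 2 + (c * x 2) ^ 2) = c * Real.sqrt (x 1 ^ 2 + x 2 ^ 2) := by
    rw [show (c * x 1) ^ 2 + (c * x 2) ^ 2 = c ^ 2 * (x 1 ^ 2 + x 2 ^ 2) by ring,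
      Real.sqrt_mul (by positivity), Real.sqrt_sq hc]
  simp only [boxGauge, PiLp.smul_apply, smul_eq_mul, abs_mul, abs_of_nonneg hc, this]
  rw [mul_max_of_nonneg _ _ hc, mul_div_assoc, mul_div_assoc]

theorem isClosed_box (ε : ℝ) : IsClosed (Box ε) := by
  have h1 : Continuous fun x : E3 => |x 0| := by fun_prop
  have h2 : Continuous fun x : E3 => Real.sqrt (x 1 ^ 2 + x 2 ^ 2) := by fun_prop
  exact (isClosed_le h1 continuous_const).inter (isClosed_le h2 continuous_const)

theorem box_zero_le {ε : ℝ} {x : E3} (hx : x ∈ Box ε) : |x 0| ≤ 2 * ε ^ (1 / 2 : ℝ) := hx.1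

theorem box_succ_le {ε : ℝ} {x : E3} (hx : x ∈ Box ε) :
    |x 1| ≤ 2 * ε ^ (1 / 6 : ℝ) ∧ |x 2| ≤ 2 * ε ^ (1 / 6 : ℝ) := by
  constructor <;> refine le_trans ?_ hx.2 <;> rw [← Real.sqrt_sq_eq_abs] <;>
    apply Real.sqrt_le_sqrt
  · nlinarith [sq_nonneg (x 2)]
  · nlinarith [sq_nonneg (x 1)]

namespace Setup

variable {γ κ₀ M ε a T l L : ℝ} {fl : Fluid} {m : Modulation}
  (H : Setup γ κ₀ M ε a T l L fl m) {t : ℝ} (ht : t ∈ Ico (-ε) T)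
include H ht

/-- A function with vanishing gradient outside the box is constant on the radial segment (in the
moving coordinates) from a point outside the box to the boundary of the box. -/
theorem comp_eq_of_fderiv_zero {G : Type*} [NormedAddCommGroup G] [NormedSpace ℝ G] {h : E3 → G}
    (hh : Differentiable ℝ h) (h0 : ∀ x ∉ Box ε, fderiv ℝ h (m.physPos t x) = 0) {x : E3}
    (hx : x ∉ Box ε) : h (m.physPos t x) = h (m.physPos t ((boxGauge ε x)⁻¹ • x)) := by
  have hε := H.hε
  have hg : 1 < boxGauge ε x := by rw [mem_box_iff hε] at hx; linarith
  set g := boxGauge ε x with hgdef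
  have hX := H.differentiable_physPos ht
  set f : ℝ → G := fun θ => h (m.physPos t ((1 - θ) • x)) with hf
  have hder : ∀ θ, HasDerivAt f (fderiv ℝ h (m.physPos t ((1 - θ) • x))
      (fderiv ℝ (m.physPos t) ((1 - θ) • x) ((-1 : ℝ) • x))) θ := by
    intro θ
    have h1 : HasDerivAt (fun θ : ℝ => (1 - θ) • x) ((-1 : ℝ) • x) θ :=
      ((hasDerivAt_id θ).const_sub 1).smul_const x
    exact (hh _).hasFDerivAt.comp_hasDerivAt θ ((hX _).hasFDerivAt.comp_hasDerivAt θ h1)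
  have hinv : g⁻¹ < 1 := inv_lt_one_of_one_lt₀ hg
  have hconst := constant_of_has_deriv_right_zero (f := f) (a := 0) (b := 1 - g⁻¹)
    (fun θ _ => (hder θ).continuousAt.continuousWithinAt) (fun θ hθ => by
      have hout : (1 - θ) • x ∉ Box ε := by
        have h1 : g⁻¹ < 1 - θ := by linarith [hθ.2]
        have h2 : 0 < g⁻¹ := by positivity
        rw [mem_box_iff hε, boxGauge_smul (by linarith), ← hgdef, not_le]
        calc (1:ℝ) = g⁻¹ * g := by field_simp
          _ < (1 - θ) * g := by gcongr
      have := (hder θ).hasDerivWithinAt (s := Ici θ)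
      rw [h0 _ hout] at this
      simpa using this)
  have := hconst (1 - g⁻¹) ⟨by linarith, le_rfl⟩
  simp only [hf, sub_sub_cancel, sub_zero, one_smul] at this
  exact this.symm

theorem continuous_invPos : Continuous (m.invPos t) := by
  have h1 : Continuous fun p => act (rot (m.n t))ᵀ (p - m.ξ t) :=
    (actL (rot (m.n t))ᵀ).continuous.comp (continuous_id.sub continuous_const)
  have h2 : Continuous (m.front t) :=
    (show Differentiable ℝ (m.front t) from
      fun x => (hasFDerivAt_front m (H.symm ht) x).differentiableAt).continuous
  unfold Modulation.invPos
  exact h1.sub ((h2.comp h1).smul continuous_const)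

/-- The complement of the box is open, so the vanishing of `k` there passes to the gradient. -/
theorem fderiv_k_outside (hn : ‖m.n t‖ ≤ 1) {x : E3} (hx : x ∉ Box ε) :
    fderiv ℝ (fl.k t) (m.physPos t x) = 0 := by
  have hopen : IsOpen {p | m.invPos t p ∉ Box ε} :=
    (isClosed_box ε).isOpen_compl.preimage (H.continuous_invPos ht)
  have hmem : m.physPos t x ∈ {p | m.invPos t p ∉ Box ε} := by
    rw [mem_ofPred_eq, invPos_physPos m hn]; exact hx
  have : fl.k t =ᶠ[𝓝 (m.physPos t x)] fun _ => 0 := by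
    filter_upwards [hopen.mem_nhds hmem] with p hp
    have := (H.const t ht _ hp).2.2
    rwa [physPos_invPos m hn] at this
  rw [this.fderiv_eq]; simp

/-- Outside the box the state is that of some point of the box. -/
theorem exists_box_state (hn : ‖m.n t‖ ≤ 1) (p : E3) : ∃ x ∈ Box ε,
    fl.u t p = fl.u t (m.physPos t x) ∧ fl.ρ t p = fl.ρ t (m.physPos t x) ∧
      fl.k t p = fl.k t (m.physPos t x) := by
  have hp := physPos_invPos m hn p
  set x := m.invPos t p
  by_cases hx : x ∈ Box ε
  · exact ⟨x, hx, by rw [hp], by rw [hp], by rw [hp]⟩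
  · have hε := H.hε
    have hg : 1 < boxGauge ε x := by rw [mem_box_iff hε] at hx; linarith
    refine ⟨(boxGauge ε x)⁻¹ • x, ?_, ?_, ?_, ?_⟩
    · rw [mem_box_iff hε, boxGauge_smul (by positivity), inv_mul_cancel₀ (by positivity)]
    · rw [← hp]
      exact H.comp_eq_of_fderiv_zero ht (H.differentiable_u ht) (fun x hx => (H.const t ht x hx).1) hx
    · rw [← hp]
      exact H.comp_eq_of_fderiv_zero ht (H.differentiable_rho ht)
        (fun x hx => (H.const t ht x hx).2.1) hx
    · rw [← hp]
      exact H.comp_eq_of_fderiv_zero ht (H.differentiable_k ht)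
        (fun x hx => H.fderiv_k_outside ht hn hx) hx

/-- The entropy is small. -/
theorem k_le (hn : ‖m.n t‖ ≤ 1) (hε1 : ε ≤ 1) {x : E3} (hx : x ∈ Box ε) :
    |fl.k t (m.physPos t x)| ≤ 5 * ε ^ (1 / 4 : ℝ) := by
  have hε := H.hε
  set f : ℝ → ℝ := fun θ => fl.k t (m.physPos t (x + θ • bv 0)) with hf
  have hcomp : Differentiable ℝ (fun x => fl.k t (m.physPos t x)) :=
    (H.differentiable_k ht).comp (H.differentiable_physPos ht)
  have hder : ∀ θ, HasDerivAt f (pd 0 (fun x => fl.k t (m.physPos t x)) (x + θ • bv 0)) θ := by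
    intro θ
    have h1 : HasDerivAt (fun θ : ℝ => x + θ • bv 0) (bv 0) θ := by
      simpa using ((hasDerivAt_id (𝕜 := ℝ) θ).smul_const (bv 0)).const_add x
    exact (hcomp _).hasFDerivAt.comp_hasDerivAt θ h1
  have hb : ∀ θ : ℝ, ‖pd 0 (fun x => fl.k t (m.physPos t x)) (x + θ • bv 0)‖ ≤ ε ^ (1 / 4 : ℝ) := by
    intro θ
    by_cases hin : x + θ • bv 0 ∈ Box ε
    · exact H.pd_k_zero ht hin
    · rw [pd_comp_physPos m 0 (H.symm ht) (H.differentiable_k ht), H.fderiv_k_outside ht hn hin]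
      simpa using by positivity
  have hmv := convex_univ.norm_image_sub_le_of_norm_hasDerivWithin_le (f := f)
    (fun θ _ => (hder θ).hasDerivWithinAt) (fun θ _ => hb θ) (mem_univ 0) (mem_univ (5:ℝ))
  have hout : x + (5:ℝ) • bv 0 ∉ Box ε := by
    intro hin
    have h1 := (abs_le.mp hin.1).2
    have h2 := (abs_le.mp hx.1).1
    have h3 : ε ^ (1 / 2 : ℝ) ≤ 1 := Real.rpow_le_one hε.le hε1 (by norm_num)
    simp at h1
    norm_num at h2 h3
    linarith
  have hend : f 5 = 0 := (H.const t ht _ hout).2.2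
  rw [hend] at hmv
  simp [hf] at hmv
  norm_num at hmv ⊢
  linarith

end Setup

/-! ### Bounds for the state -/

/-- Bounds for velocity, sound speed, density and entropy at time `t`. -/
structure StateFacts (γ κ₀ C ε : ℝ) (fl : Fluid) (m : Modulation) (t : ℝ) : Prop where
  u_le : ∀ p, ‖fl.u t p‖ ≤ 2 * κ₀
  u_dir : ∀ p, |inner ℝ (fl.u t p) (m.fr 0 t 0) - m.κ t / 2| ≤ C * ε ^ (1 / 6 : ℝ)
  u_sub : ∀ p, |fl.u t p 0 - fl.sigma γ t p| ≤ C * ε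
  sigma_ge : ∀ p, κ₀ / 8 ≤ fl.sigma γ t p
  sigma_le : ∀ p, fl.sigma γ t p ≤ 2 * κ₀
  rho_ge : ∀ p, C⁻¹ ≤ fl.ρ t p
  rho_le : ∀ p, fl.ρ t p ≤ C

set_option maxHeartbeats 800000 in
/-- In the box `w = κ + O(ε^{1/6})`, while `z` and the tangential velocity are `O(ε)` and `k` is
small. Hence `u · N` and `σ` are close to `κ / 2` there, and by contraction onto the box everywhere;
the density is recovered from `σ` and `k`. -/
theorem exists_stateFacts {γ κ₀ M : ℝ} (hγ : 1 < γ) (hκ₀ : 1 < κ₀) (hM : 1 < M) :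
    ∃ C, 0 < C ∧ ∀ᶠ ε in 𝓝[>] (0 : ℝ),
    ∀ (a T l L : ℝ) (fl : Fluid) (m : Modulation), Setup γ κ₀ M ε a T l L fl m →
      ∀ t ∈ Ico (-ε) T, StateFacts γ κ₀ C ε fl m t := by
  obtain ⟨C₁, hC₁, h1⟩ := exists_frameFacts hM
  have hα : 0 < alphaC γ := by unfold alphaC; linarith
  obtain ⟨C₂, hC₂⟩ : ∃ C, C = 2 * ((M + 1) ^ 3 + 68) := ⟨_, rfl⟩
  have hC₂' : 0 < C₂ := by rw [hC₂]; positivity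
  obtain ⟨R₁, hR₁⟩ : ∃ C, C = (alphaC γ * (κ₀ / 8) * Real.exp (-(1 / 2))) ^ (alphaC γ)⁻¹ := ⟨_, rfl⟩
  obtain ⟨R₂, hR₂⟩ : ∃ C, C = (alphaC γ * (2 * κ₀) * Real.exp (1 / 2)) ^ (alphaC γ)⁻¹ := ⟨_, rfl⟩
  have hR₁p : 0 < R₁ := by rw [hR₁]; positivity
  have hR₂p : 0 < R₂ := by rw [hR₂]; positivity
  refine ⟨C₂ + M + 4 * κ₀ * C₁ + R₁⁻¹ + R₂, by positivity, ?_⟩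
  filter_upwards [eventually_pos, eventually_le_const one_pos, h1,
    eventually_mul_rpow_le (C₂ + M) (show (0:ℝ) < 1 / 6 by norm_num) (show (0:ℝ) < 1 / 8 by norm_num),
    eventually_mul_rpow_le 2 (show (0:ℝ) < 1 / 6 by norm_num) one_pos,
    eventually_mul_rpow_le (2 * M) one_pos (show (0:ℝ) < 1 / 4 by norm_num),
    eventually_mul_rpow_le 5 (show (0:ℝ) < 1 / 4 by norm_num) one_pos]
    with ε hε hε1 h1 hs1 hs2 hs3 hs4 a T l L fl m H t ht
  obtain F := h1 γ κ₀ a T l L fl m H t ht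
  have hn : ‖m.n t‖ ≤ 1 := F.n_le.trans (by norm_num)
  rw [Real.rpow_one] at hs3
  have hεε : ε ≤ ε ^ (1 / 6 : ℝ) := by
    simpa using Real.rpow_le_rpow_of_exponent_ge hε hε1 (show (1 / 6 : ℝ) ≤ 1 by norm_num)
  have hκl := H.boot.modulation.κ_lower t ht
  have hκu := H.boot.modulation.κ_upper t ht
  have hbox : ∀ x ∈ Box ε, |x 1| ≤ 1 ∧ |x 2| ≤ 1 := fun x hx =>
    ⟨(box_succ_le hx).1.trans hs2, (box_succ_le hx).2.trans hs2⟩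
  -- `u · N = (w + z) / 2` and `σ = (w - z) / 2`
  have hv0 : ∀ x ∈ Box ε, |m.vel fl 0 t x - m.κ t / 2| ≤ (C₂ + M) / 2 * ε ^ (1 / 6 : ℝ) := by
    intro x hx
    have hw := H.w_sub_kappa ht hx hε1
    rw [← hC₂] at hw
    have hz := H.z_bound ht hx
    rw [w_eq] at hw
    rw [z_eq] at hz
    rw [abs_le] at hw hz ⊢
    have : M * ε ≤ M * ε ^ (1 / 6 : ℝ) := by gcongr
    constructor <;> nlinarith
  have hs0 : ∀ x ∈ Box ε, |fl.sigma γ t (m.physPos t x) - m.κ t / 2|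
      ≤ (C₂ + M) / 2 * ε ^ (1 / 6 : ℝ) := by
    intro x hx
    have hw := H.w_sub_kappa ht hx hε1
    rw [← hC₂] at hw
    have hz := H.z_bound ht hx
    rw [w_eq] at hw
    rw [z_eq] at hz
    rw [abs_le] at hw hz ⊢
    have : M * ε ≤ M * ε ^ (1 / 6 : ℝ) := by gcongr
    constructor <;> nlinarith
  have hu0 : ∀ x ∈ Box ε, ‖fl.u t (m.physPos t x)‖ ≤ 2 * κ₀ := by
    intro x hx
    have hfc := frame_complete (q := (m.n t, m.frontD t x)) hn (fl.u t (m.physPos t x))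
    have e0 := frame_norm (q := (m.n t, m.frontD t x)) hn
    have b0 := hv0 x hx
    have b1 := H.vel_bound ht hx 0
    have b2 := H.vel_bound ht hx 1
    have hle : ‖fl.u t (m.physPos t x)‖ ≤
        |m.vel fl 0 t x| + |m.vel fl 1 t x| + |m.vel fl 2 t x| := by
      rw [hfc]
      refine (norm_add₃_le).trans ?_
      simp only [norm_smul, e0, mul_one, Real.norm_eq_abs]
      exact le_rfl
    have : |m.vel fl 0 t x| ≤ κ₀ + 1 / 16 := by
      rw [abs_le] at b0 ⊢
      constructor <;> nlinarith
    simp only [Fin.succ_zero_eq_one, Fin.succ_one_eq_two] at b1 b2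
    linarith
  -- the frame vectors at two points differ by `O(ε)`
  have hue : ∀ x ∈ Box ε, ∀ j, ∀ y : E3, |y 1| ≤ 1 → |y 2| ≤ 1 →
      |inner ℝ (fl.u t (m.physPos t x)) (m.fr j t y) - m.vel fl j t x| ≤ 4 * κ₀ * C₁ * ε := by
    intro x hx j y hy1 hy2
    have h3 := F.fr_sub x (hbox x hx).1 (hbox x hx).2 j
    have h4 := F.fr_sub y hy1 hy2 j
    rw [Modulation.vel, ← inner_sub_right]
    refine (abs_real_inner_le_norm _ _).trans ?_
    have h5 : ‖m.fr j t y - m.fr j t x‖ ≤ 2 * C₁ * ε := by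
      calc ‖m.fr j t y - m.fr j t x‖ = ‖(m.fr j t y - bv j) - (m.fr j t x - bv j)‖ := by
            congr 1; abel
        _ ≤ _ := norm_sub_le _ _
        _ ≤ _ := by linarith
    calc _ ≤ 2 * κ₀ * (2 * C₁ * ε) :=
          mul_le_mul (hu0 x hx) h5 (norm_nonneg _) (by positivity)
      _ = _ := by ring
  have hsig : ∀ p x, fl.ρ t p = fl.ρ t (m.physPos t x) → fl.k t p = fl.k t (m.physPos t x) →
      fl.sigma γ t p = fl.sigma γ t (m.physPos t x) := by
    intro p x h2 h3; rw [Fluid.sigma, Fluid.sigma, h2, h3]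
  have hκp : 0 < m.κ t := by linarith
  have hsigl : ∀ p, κ₀ / 8 ≤ fl.sigma γ t p := by
    intro p
    obtain ⟨x, hx, hpu, hpr, hpk⟩ := H.exists_box_state ht hn p
    rw [hsig p x hpr hpk]
    have := (abs_le.mp (hs0 x hx)).1
    nlinarith
  have hsigu : ∀ p, fl.sigma γ t p ≤ 2 * κ₀ := by
    intro p
    obtain ⟨x, hx, hpu, hpr, hpk⟩ := H.exists_box_state ht hn p
    rw [hsig p x hpr hpk]
    have := (abs_le.mp (hs0 x hx)).2
    nlinarith
  have hk : ∀ p, |fl.k t p| ≤ 1 := by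
    intro p
    obtain ⟨x, hx, hpu, hpr, hpk⟩ := H.exists_box_state ht hn p
    rw [hpk]
    exact (H.k_le ht hn hε1 hx).trans hs4
  have hrho : ∀ p, fl.ρ t p =
      (alphaC γ * fl.sigma γ t p * Real.exp (-(fl.k t p / 2))) ^ (alphaC γ)⁻¹ := by
    intro p
    have hp := H.euler.pos t ht p
    have : alphaC γ * fl.sigma γ t p * Real.exp (-(fl.k t p / 2)) = fl.ρ t p ^ alphaC γ := by
      rw [Fluid.sigma, Real.exp_neg]; field_simp
    rw [this, ← Real.rpow_mul hp.le, mul_inv_cancel₀ hα.ne', Real.rpow_one]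
  have hr1 : ∀ p, R₁ ≤ fl.ρ t p := by
    intro p
    rw [hrho p, hR₁]
    have := (abs_le.mp (hk p)).2
    exact Real.rpow_le_rpow (by positivity) (mul_le_mul
      (mul_le_mul_of_nonneg_left (hsigl p) hα.le) (Real.exp_le_exp.mpr (by linarith))
      (by positivity) (mul_nonneg hα.le (H.sigma_pos ht p).le)) (by positivity)
  have hr2 : ∀ p, fl.ρ t p ≤ R₂ := by
    intro p
    rw [hrho p, hR₂]
    have := (abs_le.mp (hk p)).1
    have h3 := H.sigma_pos ht p
    exact Real.rpow_le_rpow (by positivity) (mul_le_mul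
      (mul_le_mul_of_nonneg_left (hsigu p) hα.le) (Real.exp_le_exp.mpr (by linarith))
      (by positivity) (by positivity)) (by positivity)
  have hR₁i : 0 < R₁⁻¹ := by positivity
  have hcp : 0 < 4 * κ₀ * C₁ := by positivity
  have hlast : ∀ {X Y : ℝ}, 0 < Y → X ≤ (C₂ + M + 4 * κ₀ * C₁) * Y →
      X ≤ (C₂ + M + 4 * κ₀ * C₁ + R₁⁻¹ + R₂) * Y := by
    intro X Y hY h
    nlinarith [mul_pos hR₁i hY, mul_pos hR₂p hY]
  have hε6 : 0 < ε ^ (1 / 6 : ℝ) := by positivity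
  refine ⟨?_, ?_, ?_, hsigl, hsigu, ?_, ?_⟩
  · intro p
    obtain ⟨x, hx, hpu, hpr, hpk⟩ := H.exists_box_state ht hn p
    rw [hpu]; exact hu0 x hx
  · intro p
    obtain ⟨x, hx, hpu, hpr, hpk⟩ := H.exists_box_state ht hn p
    rw [hpu]
    have e1 := hue x hx 0 0 (by simp) (by simp)
    have e2 := hv0 x hx
    apply hlast hε6
    have : 4 * κ₀ * C₁ * ε ≤ 4 * κ₀ * C₁ * ε ^ (1 / 6 : ℝ) := by gcongr
    rw [abs_le] at e1 e2 ⊢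
    constructor <;> nlinarith
  · intro p
    obtain ⟨x, hx, hpu, hpr, hpk⟩ := H.exists_box_state ht hn p
    rw [hsig p x hpr hpk, hpu]
    apply hlast hε
    have hz := H.z_bound ht hx
    rw [z_eq] at hz
    have h3 := F.fr_sub x (hbox x hx).1 (hbox x hx).2 0
    have e1 : |fl.u t (m.physPos t x) 0 - m.vel fl 0 t x| ≤ 2 * κ₀ * (C₁ * ε) := by
      have : fl.u t (m.physPos t x) 0 = inner ℝ (fl.u t (m.physPos t x)) (bv 0) := by
        simp [inner3]
      rw [this, Modulation.vel, ← inner_sub_right]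
      refine (abs_real_inner_le_norm _ _).trans ?_
      rw [norm_sub_rev] at h3
      exact mul_le_mul (hu0 x hx) h3 (norm_nonneg _) (by positivity)
    have : 0 < C₂ * ε := by positivity
    have : 0 < κ₀ * (C₁ * ε) := by positivity
    simp only at hz
    rw [abs_le] at e1 hz ⊢
    constructor <;> nlinarith
  · intro p
    refine le_trans ?_ (hr1 p)
    rw [inv_le_comm₀ (by positivity) hR₁p]
    linarith
  · intro p
    refine (hr2 p).trans ?_
    linarith

/-! ### Vector calculus and thermodynamics -/

/-- The gradient of a scalar function. -/
noncomputable def grad (h : E3 → ℝ) (x : E3) : E3 := !₂[pd 0 h x, pd 1 h x, pd 2 h x]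

theorem inner_grad (h : E3 → ℝ) (x v : E3) : inner ℝ (grad h x) v = fderiv ℝ h x v := by
  conv_rhs => rw [vec_eq_sum v]
  simp [inner3, grad, pd]
  ring

theorem inner_cross_cross (v w a b : E3) : inner ℝ (cross v w) (cross a b) =
    inner ℝ v a * inner ℝ w b - inner ℝ v b * inner ℝ w a := by
  simp [inner3, cross]; ring

theorem pd_component {u : E3 → E3} {x : E3} (hu : DifferentiableAt ℝ u x) (i j : Fin 3) :
    pd i (fun z => u z j) x = fderiv ℝ u x (bv i) j := by
  have : HasFDerivAt (fun z => u z j) ((EuclideanSpace.proj (𝕜 := ℝ) j).comp (fderiv ℝ u x)) x :=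
    (EuclideanSpace.proj (𝕜 := ℝ) j).hasFDerivAt.comp x hu.hasFDerivAt
  rw [pd, this.fderiv]; rfl

/-- The curl is twice the antisymmetric part of the gradient. -/
theorem inner_curl_cross {u : E3 → E3} {x : E3} (hu : DifferentiableAt ℝ u x) (a b : E3) :
    inner ℝ (curl u x) (cross a b) =
      inner ℝ (fderiv ℝ u x a) b - inner ℝ (fderiv ℝ u x b) a := by
  rw [vec_eq_sum a, vec_eq_sum b]
  simp [inner3, curl, cross, pd_component hu]
  ring

theorem curl_eq_zero {u : E3 → E3} {x : E3} (hu : DifferentiableAt ℝ u x) (h : fderiv ℝ u x = 0) :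
    curl u x = 0 := by
  ext i; fin_cases i <;> simp [curl, pd_component hu, h]

/-- Logarithmic differentiation of `σ = ρ^α e^{k/2} / α`. -/
theorem hasFDerivAt_soundSpeed {E : Type*} [NormedAddCommGroup E] [NormedSpace ℝ E] {α : ℝ}
    (hα : α ≠ 0) {ρ k : E → ℝ} {p : E} (hρ : 0 < ρ p) (h1 : DifferentiableAt ℝ ρ p)
    (h2 : DifferentiableAt ℝ k p) :
    HasFDerivAt (fun x => 1 / α * ρ x ^ α * Real.exp (k x / 2))
      ((1 / α * ρ p ^ α * Real.exp (k p / 2)) • ((α / ρ p) • fderiv ℝ ρ p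
        + (1 / 2 : ℝ) • fderiv ℝ k p)) p := by
  have h1 := (h1.hasFDerivAt.rpow_const (p := α) (Or.inl hρ.ne')).const_mul (1 / α)
  have h2 := (h2.hasFDerivAt.mul_const (1 / 2 : ℝ)).exp
  refine ((h1.mul h2).congr_of_eventuallyEq
    (Eventually.of_forall fun x => by simp [div_eq_mul_inv])).congr_fderiv ?_
  ext v
  simp only [add_apply, smul_apply, smul_eq_mul]
  rw [Real.rpow_sub_one hρ.ne', show k p * (1 / 2) = k p / 2 by ring]
  field_simp
  ring

namespace Setup

variable {γ κ₀ M ε a T l L : ℝ} {fl : Fluid} {m : Modulation}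
  (H : Setup γ κ₀ M ε a T l L fl m)
include H

theorem alpha_pos : 0 < alphaC γ := by unfold alphaC; linarith [H.hγ]

theorem pressure_eq {t : ℝ} (ht : t ∈ Ico (-ε) T) (p : E3) : fl.pressure γ t p =
    fl.ρ t p * (alphaC γ * fl.sigma γ t p) ^ 2 / γ := by
  have hρ := H.euler.pos t ht p
  have hα := H.alpha_pos
  have hγ := H.hγ
  have e1 : alphaC γ * fl.sigma γ t p = fl.ρ t p ^ alphaC γ * Real.exp (fl.k t p / 2) := by
    rw [Fluid.sigma]; field_simp
  have e2 : fl.ρ t p ^ γ = fl.ρ t p * (fl.ρ t p ^ alphaC γ) ^ 2 := by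
    rw [← Real.rpow_natCast, ← Real.rpow_mul hρ.le, ← Real.rpow_one_add' hρ.le]
    · congr 1; simp [alphaC]
    · simp [alphaC]; linarith
  have e3 : Real.exp (fl.k t p) = Real.exp (fl.k t p / 2) ^ 2 := by
    rw [← Real.exp_nat_mul]; congr 1; push_cast; ring
  rw [Fluid.pressure, e1, e2, e3]
  ring

theorem fderiv_sigma {t : ℝ} (ht : t ∈ Ico (-ε) T) (p : E3) :
    fderiv ℝ (fl.sigma γ t) p = fl.sigma γ t p • ((alphaC γ / fl.ρ t p) • fderiv ℝ (fl.ρ t) p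
      + (1 / 2 : ℝ) • fderiv ℝ (fl.k t) p) :=
  (hasFDerivAt_soundSpeed H.alpha_pos.ne' (H.euler.pos t ht p) (H.differentiable_rho ht p)
    (H.differentiable_k ht p)).fderiv

theorem hasFDerivAt_pressure {t : ℝ} (ht : t ∈ Ico (-ε) T) (p : E3) :
    HasFDerivAt (fl.pressure γ t) (fl.pressure γ t p • ((γ / fl.ρ t p) • fderiv ℝ (fl.ρ t) p
      + fderiv ℝ (fl.k t) p)) p := by
  have hρ := H.euler.pos t ht p
  have hγ := H.hγ
  have h1 := ((H.differentiable_rho ht p).hasFDerivAt.rpow_const (p := γ)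
    (Or.inl hρ.ne')).const_mul (1 / γ)
  have h2 := ((H.differentiable_k ht p).hasFDerivAt).exp
  refine ((h1.mul h2).congr_of_eventuallyEq (f₁ := fl.pressure γ t)
    (Eventually.of_forall fun x => by simp [Fluid.pressure])).congr_fderiv ?_
  ext v
  simp only [Fluid.pressure, add_apply, smul_apply,
    smul_eq_mul]
  rw [Real.rpow_sub_one hρ.ne']
  field_simp
  ring

/-- The baroclinic torque involves only the sound speed and the entropy. -/
theorem baroclinic_eq {t : ℝ} (ht : t ∈ Ico (-ε) T) (p v w : E3) :
    1 / fl.ρ t p ^ 3 * inner ℝ (cross (grad (fl.ρ t) p) (grad (fl.pressure γ t) p)) (cross v w) =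
      alphaC γ * fl.sigma γ t p / (γ * fl.ρ t p) *
        (fderiv ℝ (fl.sigma γ t) p v * fderiv ℝ (fl.k t) p w -
          fderiv ℝ (fl.sigma γ t) p w * fderiv ℝ (fl.k t) p v) := by
  have hρ := H.euler.pos t ht p
  have hα := H.alpha_pos
  have hγ : 0 < γ := by linarith [H.hγ]
  rw [inner_cross_cross]
  simp only [inner_grad]
  rw [(H.hasFDerivAt_pressure ht p).fderiv, H.fderiv_sigma ht, H.pressure_eq ht]
  simp only [add_apply, smul_apply, smul_eq_mul]
  field_simp
  ring

end Setup

/-! ### Change of basis between coordinate and frame vectors -/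

/-- The tangent vectors of the frame are bounded combinations of the coordinate tangent vectors of
the graph. -/
theorem slopeFrame_succ_eq (g : Fin 2 → ℝ) (ν : Fin 2) : ∃ c d : ℝ,
    slopeFrame g ν.succ = c • (bv 1 + g 0 • bv 0) + d • (bv 2 + g 1 • bv 0) ∧
      (‖g‖ ≤ 1 / 2 → |c| ≤ 2 ∧ |d| ≤ 2) := by
  have h1 := slopeJ_sq g
  have hJ1 := one_le_slopeJ g
  have h0 : 0 < slopeJ g := by linarith
  have h2 : 0 < slopeJ g + 1 := by linarith
  have hb : ∀ μ ν, ‖g‖ ≤ 1 / 2 → |g μ * g ν / (slopeJ g * (slopeJ g + 1))| ≤ 1 := by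
    intro μ ν hg
    have e1 : |g μ| ≤ 1 / 2 := (norm_le_pi_norm g μ).trans hg
    have e2 : |g ν| ≤ 1 / 2 := (norm_le_pi_norm g ν).trans hg
    rw [abs_div, abs_mul, abs_of_pos (mul_pos h0 h2)]
    rw [div_le_one (mul_pos h0 h2)]
    nlinarith [abs_nonneg (g μ), abs_nonneg (g ν)]
  refine ⟨(if ν = 0 then 1 else 0) - g ν * g 0 / (slopeJ g * (slopeJ g + 1)),
    (if ν = 1 then 1 else 0) - g ν * g 1 / (slopeJ g * (slopeJ g + 1)), ?_, ?_⟩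
  · unfold slopeFrame
    generalize slopeJ g = J at *
    generalize hp : g 0 = p at *
    generalize hq : g 1 = q at *
    have hp : p ^ 2 = J ^ 2 - 1 - q ^ 2 := by linarith
    ext i
    fin_cases ν <;> fin_cases i <;> simp [*] <;> field_simp <;> ring_nf <;>
    (try simp only [show p ^ 3 = p * p ^ 2 by ring, hp]) <;> ring
  · intro hg
    constructor
    · refine (abs_sub _ _).trans ?_
      have := hb ν 0 hg
      split_ifs <;> simp <;> linarith
    · refine (abs_sub _ _).trans ?_
      have := hb ν 1 hg
      split_ifs <;> simp <;> linarith

/-- The normal in terms of `e₁` and the coordinate tangent vectors of the graph. -/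
theorem slopeFrame_zero_eq (g : Fin 2 → ℝ) :
    slopeFrame g 0 = slopeJ g • bv 0 + (-(g 0 / slopeJ g)) • (bv 1 + g 0 • bv 0)
      + (-(g 1 / slopeJ g)) • (bv 2 + g 1 • bv 0) := by
  have h1 := slopeJ_sq g
  have hJ1 := one_le_slopeJ g
  have h0 : 0 < slopeJ g := by linarith
  unfold slopeFrame
  generalize slopeJ g = J at *
  ext i
  fin_cases i <;> simp
  field_simp
  linarith

section Basis

variable (m : Modulation) {t : ℝ} {x : E3}

/-- Bounds for a linear form on the tangent coordinate vectors bound it on `T²`, `T³`. -/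
theorem abs_fr_succ_le (hg : ‖m.frontD t x‖ ≤ 1 / 2) (Λ : E3 →L[ℝ] ℝ) {B : ℝ}
    (hB : ∀ μ : Fin 2, |Λ (m.posD t x (bv μ.succ))| ≤ B) (ν : Fin 2) :
    |Λ (m.fr ν.succ t x)| ≤ 4 * B := by
  obtain ⟨c, d, he, hcd⟩ := slopeFrame_succ_eq (m.frontD t x) ν
  obtain ⟨hc, hd⟩ := hcd hg
  have h0 := hB 0
  have h1 := hB 1
  rw [posD_bv_succ] at h0 h1
  have : m.fr ν.succ t x = c • act (rot (m.n t)) (bv 1 + m.frontD t x 0 • bv 0)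
      + d • act (rot (m.n t)) (bv 2 + m.frontD t x 1 • bv 0) := by
    rw [Modulation.fr, frame, he, act_add, act_smul, act_smul]
  rw [this, map_add, map_smul, map_smul, smul_eq_mul, smul_eq_mul]
  refine (abs_add_le _ _).trans ?_
  rw [abs_mul, abs_mul]
  have := mul_le_mul hc h0 (abs_nonneg _) (by norm_num)
  have := mul_le_mul hd h1 (abs_nonneg _) (by norm_num)
  simp only [Fin.succ_zero_eq_one, Fin.succ_one_eq_two] at *
  linarith

/-- The normal `N` combines `∂₁X` and the tangent coordinate vectors, which transfers bounds for a
linear form to it. -/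
theorem abs_fr_zero_le (hg : ‖m.frontD t x‖ ≤ 1 / 2) (Λ : E3 →L[ℝ] ℝ) {A B : ℝ}
    (hA : |Λ (m.posD t x (bv 0))| ≤ A)
    (hB : ∀ μ : Fin 2, |Λ (m.posD t x (bv μ.succ))| ≤ B) :
    |Λ (m.fr 0 t x)| ≤ 2 * A + 2 * B := by
  have h0 := hB 0
  have h1 := hB 1
  rw [posD_bv_succ] at h0 h1
  rw [posD_bv_zero] at hA
  have hJ1 := one_le_slopeJ (m.frontD t x)
  have e0 : |m.frontD t x 0| ≤ 1 / 2 := (norm_le_pi_norm _ _).trans hg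
  have e1 : |m.frontD t x 1| ≤ 1 / 2 := (norm_le_pi_norm _ _).trans hg
  have hJ2 : slopeJ (m.frontD t x) ≤ 2 := by
    have := slopeJ_sq (m.frontD t x)
    have := sq_abs (m.frontD t x 0)
    have := sq_abs (m.frontD t x 1)
    nlinarith [abs_nonneg (m.frontD t x 0), abs_nonneg (m.frontD t x 1)]
  have hc : ∀ μ, |m.frontD t x μ| ≤ 1 / 2 → |-(m.frontD t x μ / slopeJ (m.frontD t x))| ≤ 1 := by
    intro μ h
    rw [abs_neg, abs_div, abs_of_pos (by linarith : 0 < slopeJ (m.frontD t x)),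
      div_le_one (by linarith)]
    linarith
  have : m.fr 0 t x = slopeJ (m.frontD t x) • act (rot (m.n t)) (bv 0)
      + (-(m.frontD t x 0 / slopeJ (m.frontD t x))) •
        act (rot (m.n t)) (bv 1 + m.frontD t x 0 • bv 0)
      + (-(m.frontD t x 1 / slopeJ (m.frontD t x))) •
        act (rot (m.n t)) (bv 2 + m.frontD t x 1 • bv 0) := by
    rw [Modulation.fr, frame, slopeFrame_zero_eq, act_add, act_add, act_smul, act_smul, act_smul]
  rw [this, map_add, map_add, map_smul, map_smul, map_smul, smul_eq_mul, smul_eq_mul, smul_eq_mul]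
  refine (abs_add_three _ _ _).trans ?_
  rw [abs_mul, abs_mul, abs_mul]
  have := mul_le_mul (hc 0 e0) h0 (abs_nonneg _) (by norm_num)
  have := mul_le_mul (hc 1 e1) h1 (abs_nonneg _) (by norm_num)
  have : |slopeJ (m.frontD t x)| ≤ 2 := by rw [abs_of_nonneg (by linarith)]; exact hJ2
  have := mul_le_mul this hA (abs_nonneg _) (by norm_num)
  simp only [Fin.succ_zero_eq_one, Fin.succ_one_eq_two] at *
  linarith

end Basis

/-! ### Gradient bounds in the box -/

/-- Bounds for the gradients of velocity, sound speed and entropy at a point of the box, in the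
moving frame. Only normal derivatives of `u · N` and `σ` are not bounded: they are controlled by
`∂₁w`. -/
structure GradFacts (γ C ε : ℝ) (fl : Fluid) (m : Modulation) (t : ℝ) (x : E3) : Prop where
  u_tt : ∀ μ ν : Fin 2, |inner ℝ (fderiv ℝ (fl.u t) (m.physPos t x) (m.fr μ.succ t x))
    (m.fr ν.succ t x)| ≤ C * ε ^ (1 / 2 : ℝ)
  u_tn : ∀ μ : Fin 2, |inner ℝ (fderiv ℝ (fl.u t) (m.physPos t x) (m.fr μ.succ t x))
    (m.fr 0 t x)| ≤ C
  u_nt : ∀ ν : Fin 2, |inner ℝ (fderiv ℝ (fl.u t) (m.physPos t x) (m.fr 0 t x))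
    (m.fr ν.succ t x)| ≤ C
  u_nn : |inner ℝ (fderiv ℝ (fl.u t) (m.physPos t x) (m.fr 0 t x)) (m.fr 0 t x)|
    ≤ C * (1 + |pd 0 (m.w γ fl t) x|)
  sigma_t : ∀ μ : Fin 2, |fderiv ℝ (fl.sigma γ t) (m.physPos t x) (m.fr μ.succ t x)| ≤ C
  sigma_n : |fderiv ℝ (fl.sigma γ t) (m.physPos t x) (m.fr 0 t x)|
    ≤ C * (1 + |pd 0 (m.w γ fl t) x|)
  k_le : ∀ j, |fderiv ℝ (fl.k t) (m.physPos t x) (m.fr j t x)| ≤ C * ε ^ (1 / 8 : ℝ)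

/-- The velocity derivatives are those of `vel`, up to derivatives of the frame, which are `O(ε)`. The
normal velocity and `σ` are expressed by `w` and `z`, and only `∂₁w` is large. -/
theorem exists_gradFacts {γ κ₀ M : ℝ} (hγ : 1 < γ) (hκ₀ : 1 < κ₀) (hM : 1 < M) :
    ∃ C, 0 < C ∧ ∀ᶠ ε in 𝓝[>] (0 : ℝ),
    ∀ (a T l L : ℝ) (fl : Fluid) (m : Modulation), Setup γ κ₀ M ε a T l L fl m →
      ∀ t ∈ Ico (-ε) T, ∀ x ∈ Box ε, GradFacts γ C ε fl m t x := by
  obtain ⟨C₁, hC₁, h1⟩ := exists_frameFacts hM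
  obtain ⟨C₂, hC₂, h2⟩ := exists_stateFacts hγ hκ₀ hM
  obtain ⟨B, hB⟩ : ∃ B, B = M + 2 * κ₀ * C₁ + 1 := ⟨_, rfl⟩
  have hBM : M ≤ B := by rw [hB]; nlinarith [mul_pos (show 0 < κ₀ by linarith) hC₁]
  have hB1 : 1 ≤ B := hM.le.trans hBM
  refine ⟨8 * B, by linarith, ?_⟩
  filter_upwards [eventually_pos, eventually_le_const one_pos, h1, h2,
    eventually_mul_rpow_le 2 (show (0:ℝ) < 1 / 6 by norm_num) one_pos]
    with ε hε hε1 h1 h2 hs2 a T l L fl m H t ht x hx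
  have F := h1 γ κ₀ a T l L fl m H t ht
  have S := h2 a T l L fl m H t ht
  have hn : ‖m.n t‖ < 1 := F.n_le.trans_lt (by norm_num)
  have hx1 : |x 1| ≤ 1 := (box_succ_le hx).1.trans hs2
  have hx2 : |x 2| ≤ 1 := (box_succ_le hx).2.trans hs2
  have hg : ‖m.frontD t x‖ ≤ 1 / 2 := (norm_snd_le _).trans (F.q_le x hx1 hx2)
  have hh0 : 0 < ε ^ (1 / 2 : ℝ) := by positivity
  have hh1 : ε ^ (1 / 2 : ℝ) ≤ 1 := Real.rpow_le_one hε.le hε1 (by norm_num)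
  have hε2 : ε ≤ ε ^ (1 / 2 : ℝ) := by
    simpa using Real.rpow_le_rpow_of_exponent_ge hε hε1 (show (1 / 2 : ℝ) ≤ 1 by norm_num)
  set D := fderiv ℝ (fl.u t) (m.physPos t x) with hD
  have hfr : ∀ j i, |inner ℝ (fl.u t (m.physPos t x)) (m.frD j t x (bv i))| ≤
      2 * κ₀ * C₁ * ε := by
    intro j i
    refine (abs_real_inner_le_norm _ _).trans ?_
    have := mul_le_mul (S.u_le (m.physPos t x)) (F.frD_le x hx1 hx2 j i) (norm_nonneg _)
      (by linarith)
    linarith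
  have hpd := fun j i => pd_vel m fl j i hn (H.symm ht) (H.differentiable_u ht) x
  have hw : ∀ i, pd i (m.w γ fl t) x = pd i (m.vel fl 0 t) x
      + pd i (fun x => fl.sigma γ t (m.physPos t x)) x := by
    intro i
    rw [w_eq, pd, fderiv_fun_add (H.differentiable_vel ht hn 0 x) (H.differentiable_sigma_pos ht x)]
    rfl
  have hz : ∀ i, pd i (m.z γ fl t) x = pd i (m.vel fl 0 t) x
      - pd i (fun x => fl.sigma γ t (m.physPos t x)) x := by
    intro i
    rw [z_eq, pd, fderiv_fun_sub (H.differentiable_vel ht hn 0 x) (H.differentiable_sigma_pos ht x)]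
    rfl
  have hsig := fun i => pd_comp_physPos m i (H.symm ht) (H.differentiable_sigma ht) x
  have hk := fun i => pd_comp_physPos m i (H.symm ht) (H.differentiable_k ht) x
  have hκC : 0 < 2 * κ₀ * C₁ := by positivity
  have hκε : 2 * κ₀ * C₁ * ε ≤ 2 * κ₀ * C₁ * ε ^ (1 / 2 : ℝ) := by gcongr
  have hκ1 : 2 * κ₀ * C₁ * ε ≤ 2 * κ₀ * C₁ := by nlinarith
  -- bounds on coordinate vectors
  have b_tt : ∀ μ ν : Fin 2, |inner ℝ (D (m.posD t x (bv μ.succ))) (m.fr ν.succ t x)|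
      ≤ B * ε ^ (1 / 2 : ℝ) := by
    intro μ ν
    have h3 := H.pd_vel_succ ht hn hx ν μ
    have h4 := hfr ν.succ μ.succ
    rw [hpd] at h3
    rw [abs_le] at h3 h4 ⊢
    rw [hB]
    constructor <;> nlinarith
  have b_nt : ∀ ν : Fin 2, |inner ℝ (D (m.posD t x (bv 0))) (m.fr ν.succ t x)| ≤ B := by
    intro ν
    have h3 := H.pd_vel_zero ht hn hx ν
    rw [hpd, frD_bv_zero, inner_zero_right, add_zero] at h3
    exact h3.trans hBM
  have hzs : ∀ μ : Fin 2, |pd μ.succ (m.z γ fl t) x| ≤ M := fun μ =>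
    (H.pd_z_succ ht hn hx μ).trans (by nlinarith)
  have b_tn : ∀ μ : Fin 2, |inner ℝ (D (m.posD t x (bv μ.succ))) (m.fr 0 t x)| ≤ B := by
    intro μ
    have h3 := H.pd_w_succ ht hn hx μ
    have h4 := hzs μ
    have h5 := hfr 0 μ.succ
    rw [hw] at h3
    rw [hz] at h4
    have h6 := hpd 0 μ.succ
    rw [abs_le] at h3 h4 h5 ⊢
    rw [hB]
    constructor <;> linarith
  have b_nn : |inner ℝ (D (m.posD t x (bv 0))) (m.fr 0 t x)| ≤ B * (1 + |pd 0 (m.w γ fl t) x|) := by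
    have h3 := hw 0
    have h4 := H.pd_z_zero ht hn hx
    have h6 := hpd 0 0
    rw [hz] at h4
    rw [frD_bv_zero, inner_zero_right, add_zero] at h6
    have h7 := le_abs_self (pd 0 (m.w γ fl t) x)
    have h8 := neg_abs_le (pd 0 (m.w γ fl t) x)
    have h9 := mul_le_mul_of_nonneg_right hB1 (abs_nonneg (pd 0 (m.w γ fl t) x))
    rw [abs_le] at h4 ⊢
    constructor <;> linarith
  have b_st : ∀ μ : Fin 2, |fderiv ℝ (fl.sigma γ t) (m.physPos t x) (m.posD t x (bv μ.succ))|
      ≤ B := by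
    intro μ
    have h3 := H.pd_w_succ ht hn hx μ
    have h4 := hzs μ
    rw [hw, hsig] at h3
    rw [hz, hsig] at h4
    rw [abs_le] at h3 h4 ⊢
    constructor <;> linarith
  have b_sn : |fderiv ℝ (fl.sigma γ t) (m.physPos t x) (m.posD t x (bv 0))|
      ≤ B * (1 + |pd 0 (m.w γ fl t) x|) := by
    have h3 := hw 0
    have h4 := H.pd_z_zero ht hn hx
    rw [hz, hsig] at h4
    rw [hsig] at h3
    have h7 := le_abs_self (pd 0 (m.w γ fl t) x)
    have h8 := neg_abs_le (pd 0 (m.w γ fl t) x)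
    have h9 := mul_le_mul_of_nonneg_right hB1 (abs_nonneg (pd 0 (m.w γ fl t) x))
    rw [abs_le] at h4 ⊢
    constructor <;> linarith
  have he8 : 0 < ε ^ (1 / 8 : ℝ) := by positivity
  have b_kt : ∀ μ : Fin 2, |fderiv ℝ (fl.k t) (m.physPos t x) (m.posD t x (bv μ.succ))|
      ≤ ε ^ (1 / 8 : ℝ) := by
    intro μ
    have := H.pd_k_succ ht hx μ
    rwa [hk] at this
  have b_kn : |fderiv ℝ (fl.k t) (m.physPos t x) (m.posD t x (bv 0))| ≤ ε ^ (1 / 8 : ℝ) := by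
    have := H.pd_k_zero ht hx
    rw [hk] at this
    exact this.trans (Real.rpow_le_rpow_of_exponent_ge hε hε1 (by norm_num))
  have hBw : 0 ≤ B * |pd 0 (m.w γ fl t) x| := by positivity
  -- change of basis
  let Λ : Fin 3 → E3 →L[ℝ] ℝ := fun j => (innerSL ℝ (m.fr j t x)).comp D
  have hΛ : ∀ j v, Λ j v = inner ℝ (D v) (m.fr j t x) := fun j v => by
    rw [real_inner_comm]; rfl
  refine ⟨fun μ ν => ?_, fun μ => ?_, fun ν => ?_, ?_, fun μ => ?_, ?_, fun j => ?_⟩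
  · rw [← hΛ]
    refine (abs_fr_succ_le m hg (Λ ν.succ) (fun μ => by rw [hΛ]; exact b_tt μ ν) μ).trans ?_
    nlinarith
  · rw [← hΛ]
    refine (abs_fr_succ_le m hg (Λ 0) (fun μ => by rw [hΛ]; exact b_tn μ) μ).trans ?_
    linarith
  · rw [← hΛ]
    refine (abs_fr_zero_le m hg (Λ ν.succ) (A := B) (B := B * ε ^ (1 / 2 : ℝ)) (by rw [hΛ]; exact b_nt ν)
      (fun μ => by rw [hΛ]; exact b_tt μ ν)).trans ?_
    nlinarith
  · rw [← hΛ]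
    refine (abs_fr_zero_le m hg (Λ 0) (A := B * (1 + |pd 0 (m.w γ fl t) x|)) (B := B) (by rw [hΛ]; exact b_nn)
      (fun μ => by rw [hΛ]; exact b_tn μ)).trans ?_
    linarith
  · refine (abs_fr_succ_le m hg _ b_st μ).trans ?_
    linarith
  · refine (abs_fr_zero_le m hg _ b_sn b_st).trans ?_
    linarith
  · have hall : |fderiv ℝ (fl.k t) (m.physPos t x) (m.fr j t x)| ≤ 4 * ε ^ (1 / 8 : ℝ) := by
      refine Fin.cases ?_ (fun μ => ?_) j
      · refine (abs_fr_zero_le m hg _ b_kn b_kt).trans ?_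
        linarith
      · exact abs_fr_succ_le m hg _ b_kt μ
    nlinarith

/-! ### Joint derivatives in time and space -/

section Joint

variable {G : Type*} [NormedAddCommGroup G] [NormedSpace ℝ G] {F : ℝ → E3 → G} {t : ℝ} {p : E3}

theorem fderiv_slice (hF : DifferentiableAt ℝ (fun q : ℝ × E3 => F q.1 q.2) (t, p)) (v : E3) :
    fderiv ℝ (F t) p v = fderiv ℝ (fun q : ℝ × E3 => F q.1 q.2) (t, p) (0, v) := by
  have h1 : HasFDerivAt (fun x : E3 => (t, x)) (ContinuousLinearMap.inr ℝ ℝ E3) p :=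
    hasFDerivAt_prodMk_right t p
  have h2 : HasFDerivAt (F t) _ p := hF.hasFDerivAt.comp p h1
  rw [h2.fderiv]; rfl

theorem hasDerivAt_time (hF : DifferentiableAt ℝ (fun q : ℝ × E3 => F q.1 q.2) (t, p)) :
    HasDerivAt (fun r => F r p) (fderiv ℝ (fun q : ℝ × E3 => F q.1 q.2) (t, p) (1, 0)) t := by
  have h1 : HasDerivAt (fun r : ℝ => (r, p)) ((1 : ℝ), (0 : E3)) t :=
    (hasDerivAt_id t).prodMk (hasDerivAt_const t p)
  exact hF.hasFDerivAt.comp_hasDerivAt (f := fun r : ℝ => (r, p)) t h1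

theorem hasDerivAt_path (hF : DifferentiableAt ℝ (fun q : ℝ × E3 => F q.1 q.2) (t, p))
    {c : ℝ → E3} {v : E3} (hp : c t = p) (hc : HasDerivAt c v t) :
    HasDerivAt (fun r => F r (c r)) (fderiv ℝ (fun q : ℝ × E3 => F q.1 q.2) (t, p) (1, v)) t := by
  have h1 : HasDerivAt (fun r : ℝ => (r, c r)) ((1 : ℝ), v) t := (hasDerivAt_id t).prodMk hc
  subst hp
  exact hF.hasFDerivAt.comp_hasDerivAt (f := fun r : ℝ => (r, c r)) t h1

theorem fderiv_one_vec (f : ℝ × E3 → G) (q : ℝ × E3) (v : E3) :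
    fderiv ℝ f q (1, v) = fderiv ℝ f q (1, 0) + fderiv ℝ f q (0, v) := by
  rw [← map_add]; simp

theorem strip_mem_nhds {ε T t : ℝ} (ht : t ∈ Ioo (-ε) T) (p : E3) :
    Ico (-ε) T ×ˢ (univ : Set E3) ∈ 𝓝 (t, p) :=
  prod_mem_nhds (Ico_mem_nhds ht.1 ht.2) univ_mem

theorem hasDerivAt_of_components {f : ℝ → E3} {f' : E3} {t : ℝ}
    (h : ∀ i, HasDerivAt (fun r => f r i) (f' i) t) : HasDerivAt f f' t := by
  have := (((h 0).smul_const (bv 0)).add ((h 1).smul_const (bv 1))).add ((h 2).smul_const (bv 2))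
  rw [← vec_eq_sum] at this
  exact this.congr_of_eventuallyEq (Eventually.of_forall fun r => vec_eq_sum (f r))

end Joint

theorem sum_mul_pd {h : E3 → ℝ} (v p : E3) : ∑ i, v i * pd i h p = fderiv ℝ h p v := by
  conv_rhs => rw [vec_eq_sum v]
  simp [Fin.sum_univ_three, pd]

namespace Setup

variable {γ κ₀ M ε a T l L : ℝ} {fl : Fluid} {m : Modulation}
  (H : Setup γ κ₀ M ε a T l L fl m) {t : ℝ} (ht : t ∈ Ioo (-ε) T)
include H ht

theorem contDiffAt_u (p : E3) : ContDiffAt ℝ 4 (fun q : ℝ × E3 => fl.u q.1 q.2) (t, p) :=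
  H.euler.smooth_u.contDiffAt (strip_mem_nhds ht p)

theorem contDiffAt_rho (p : E3) : ContDiffAt ℝ 4 (fun q : ℝ × E3 => fl.ρ q.1 q.2) (t, p) :=
  H.euler.smooth_rho.contDiffAt (strip_mem_nhds ht p)

theorem contDiffAt_k (p : E3) : ContDiffAt ℝ 4 (fun q : ℝ × E3 => fl.k q.1 q.2) (t, p) :=
  H.euler.smooth_k.contDiffAt (strip_mem_nhds ht p)

theorem contDiffAt_pressure (p : E3) :
    ContDiffAt ℝ 4 (fun q : ℝ × E3 => fl.pressure γ q.1 q.2) (t, p) := by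
  have h1 := (H.contDiffAt_rho ht p).rpow_const_of_ne (p := γ)
    (H.euler.pos t (Ioo_subset_Ico_self ht) p).ne'
  exact (contDiffAt_const.mul h1).mul (H.contDiffAt_k ht p).exp

theorem contDiffAt_sigma (p : E3) :
    ContDiffAt ℝ 4 (fun q : ℝ × E3 => fl.sigma γ q.1 q.2) (t, p) := by
  have h1 := (H.contDiffAt_rho ht p).rpow_const_of_ne (p := alphaC γ)
    (H.euler.pos t (Ioo_subset_Ico_self ht) p).ne'
  exact (contDiffAt_const.mul h1).mul ((H.contDiffAt_k ht p).div_const 2).exp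

/-- The momentum equation as a statement on the joint derivative in time and space along the particle
direction `(1, 2 β₁ u)`. Inside the open time interval the one-sided time derivative is two-sided. -/
theorem momentum_joint (p : E3) (j : Fin 3) :
    fderiv ℝ (fun q : ℝ × E3 => fl.u q.1 q.2 j) (t, p) (1, (2 * betaOne γ) • fl.u t p) =
      -(2 * betaOne γ) * ((fl.ρ t p)⁻¹ *
        fderiv ℝ (fun q : ℝ × E3 => fl.pressure γ q.1 q.2) (t, p) (0, bv j) + a * fl.u t p j) := by
  have ht' := Ioo_subset_Ico_self ht
  have hd : DifferentiableAt ℝ (fun q : ℝ × E3 => fl.u q.1 q.2 j) (t, p) :=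
    ((contDiffAt_euclidean.mp (H.contDiffAt_u ht p)) j).differentiableAt (by norm_num)
  have hp : DifferentiableAt ℝ (fun q : ℝ × E3 => fl.pressure γ q.1 q.2) (t, p) :=
    (H.contDiffAt_pressure ht p).differentiableAt (by norm_num)
  have := H.euler.momentum t ht' p j
  rw [derivWithin_of_mem_nhds (Ico_mem_nhds ht.1 ht.2),
    (hasDerivAt_time (F := fun r x => fl.u r x j) hd).deriv, sum_mul_pd,
    fderiv_slice (F := fun r x => fl.u r x j) hd] at this
  rw [fderiv_one_vec, show ((0 : ℝ), (2 * betaOne γ) • fl.u t p) =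
    (2 * betaOne γ) • ((0 : ℝ), fl.u t p) by simp, map_smul, smul_eq_mul, this, pd,
    fderiv_slice hp]
  ring

theorem mass_joint (p : E3) :
    fderiv ℝ (fun q : ℝ × E3 => fl.ρ q.1 q.2) (t, p) (1, (2 * betaOne γ) • fl.u t p) =
      -(2 * betaOne γ) * (fl.ρ t p * ∑ i, pd i (fun z => fl.u t z i) p) := by
  have ht' := Ioo_subset_Ico_self ht
  have hd : DifferentiableAt ℝ (fun q : ℝ × E3 => fl.ρ q.1 q.2) (t, p) :=
    (H.contDiffAt_rho ht p).differentiableAt (by norm_num)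
  have := H.euler.mass t ht' p
  rw [derivWithin_of_mem_nhds (Ico_mem_nhds ht.1 ht.2),
    (hasDerivAt_time hd).deriv, sum_mul_pd, fderiv_slice hd] at this
  rw [fderiv_one_vec, show ((0 : ℝ), (2 * betaOne γ) • fl.u t p) =
    (2 * betaOne γ) • ((0 : ℝ), fl.u t p) by simp, map_smul, smul_eq_mul, this]
  ring

theorem entropy_joint (p : E3) :
    fderiv ℝ (fun q : ℝ × E3 => fl.k q.1 q.2) (t, p) (1, (2 * betaOne γ) • fl.u t p) = 0 := by
  have ht' := Ioo_subset_Ico_self ht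
  have hd : DifferentiableAt ℝ (fun q : ℝ × E3 => fl.k q.1 q.2) (t, p) :=
    (H.contDiffAt_k ht p).differentiableAt (by norm_num)
  have := H.euler.entropy t ht' p
  rw [derivWithin_of_mem_nhds (Ico_mem_nhds ht.1 ht.2),
    (hasDerivAt_time hd).deriv, sum_mul_pd, fderiv_slice hd] at this
  rw [fderiv_one_vec, show ((0 : ℝ), (2 * betaOne γ) • fl.u t p) =
    (2 * betaOne γ) • ((0 : ℝ), fl.u t p) by simp, map_smul, smul_eq_mul, this]

/-- Derivative of a velocity gradient along a particle path. The Hessian of the pressure enters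
through a symmetric matrix `S`, whose value does not matter for the vorticity. -/
theorem hasDerivAt_pd_u_path {c : ℝ → E3}
    (hc : HasDerivAt c ((2 * betaOne γ) • fl.u t (c t)) t) : ∃ S : Fin 3 → Fin 3 → ℝ,
    (∀ i j, S i j = S j i) ∧ ∀ i j,
      HasDerivAt (fun r => pd i (fun z => fl.u r z j) (c r))
        (2 * betaOne γ * ((fl.ρ t (c t))⁻¹ ^ 2 * pd i (fl.ρ t) (c t) *
            pd j (fl.pressure γ t) (c t) - S i j - a * pd i (fun z => fl.u t z j) (c t)
          - ∑ k, pd i (fun z => fl.u t z k) (c t) * pd k (fun z => fl.u t z j) (c t))) t := by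
  have ht' := Ioo_subset_Ico_self ht
  set p := c t with hpdef
  set β := 2 * betaOne γ
  set P : ℝ × E3 → ℝ := fun q => fl.pressure γ q.1 q.2 with hP
  have hρp := (H.euler.pos t ht' p).ne'
  have hPc := H.contDiffAt_pressure ht p
  have hPd : DifferentiableAt ℝ P (t, p) := hPc.differentiableAt (by norm_num)
  have hP2 : DifferentiableAt ℝ (fderiv ℝ P) (t, p) :=
    (hPc.fderiv_right (m := 1) (by norm_num)).differentiableAt (by norm_num)
  have hud : DifferentiableAt ℝ (fun q : ℝ × E3 => fl.u q.1 q.2) (t, p) :=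
    (H.contDiffAt_u ht p).differentiableAt (by norm_num)
  have hρd : DifferentiableAt ℝ (fun q : ℝ × E3 => fl.ρ q.1 q.2) (t, p) :=
    (H.contDiffAt_rho ht p).differentiableAt (by norm_num)
  refine ⟨fun i j => (fl.ρ t p)⁻¹ * fderiv ℝ (fderiv ℝ P) (t, p) (0, bv i) (0, bv j), ?_, ?_⟩
  · intro i j
    have := (hPc.isSymmSndFDerivAt (by simp; norm_num)).eq (0, bv i) (0, bv j)
    simp only [this, hP]
  intro i j
  set f : ℝ × E3 → ℝ := fun q => fl.u q.1 q.2 j with hf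
  have hfc : ∀ q ∈ Ioo (-ε) T ×ˢ (univ : Set E3), ContDiffAt ℝ 4 f q := fun q hq =>
    (contDiffAt_euclidean.mp (H.contDiffAt_u hq.1 q.2)) j
  have hfd : DifferentiableAt ℝ f (t, p) := (hfc _ ⟨ht, mem_univ _⟩).differentiableAt (by norm_num)
  have hf2 : DifferentiableAt ℝ (fderiv ℝ f) (t, p) :=
    ((hfc _ ⟨ht, mem_univ _⟩).fderiv_right (m := 1) (by norm_num)).differentiableAt (by norm_num)
  have hsymm := ((hfc (t, p) ⟨ht, mem_univ _⟩).isSymmSndFDerivAt (by simp; norm_num)).eq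
    (0, bv i) (1, β • fl.u t p)
  -- differentiate along the path
  have hpath : HasDerivAt (fun r => fderiv ℝ f (r, c r) (0, bv i))
      (fderiv ℝ (fderiv ℝ f) (t, p) (1, β • fl.u t p) (0, bv i)) t := by
    have h1 : HasDerivAt (fun r : ℝ => (r, c r)) ((1 : ℝ), β • fl.u t p) t :=
      (hasDerivAt_id t).prodMk hc
    have h2 : HasDerivAt (fun r => fderiv ℝ f (r, c r)) _ t :=
      (hf2.hasFDerivAt (x := (t, p))).comp_hasDerivAt (f := fun r : ℝ => (r, c r)) t h1
    simpa using h2.clm_apply (hasDerivAt_const t ((0 : ℝ), bv i))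
  have heq : (fun r => pd i (fun z => fl.u r z j) (c r)) =ᶠ[𝓝 t]
      fun r => fderiv ℝ f (r, c r) (0, bv i) := by
    filter_upwards [Ioo_mem_nhds ht.1 ht.2] with r hr
    exact fderiv_slice (F := fun r x => fl.u r x j)
      ((hfc (r, c r) ⟨hr, mem_univ _⟩).differentiableAt (by norm_num)) _
  refine (hpath.congr_of_eventuallyEq heq).congr_deriv ?_
  -- differentiate the momentum equation in the direction `i`
  have hline : HasDerivAt (fun s : ℝ => (t, p + s • bv i)) ((0 : ℝ), bv i) 0 := by
    have : HasDerivAt (fun s : ℝ => p + s • bv i) (bv i) 0 := by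
      simpa using ((hasDerivAt_id (𝕜 := ℝ) 0).smul_const (bv i)).const_add p
    exact (hasDerivAt_const (0:ℝ) t).prodMk this
  have hline0 : (t, p + (0:ℝ) • bv i) = (t, p) := by simp
  have hcomp : ∀ {G : Type} [NormedAddCommGroup G] [NormedSpace ℝ G] {h : ℝ × E3 → G},
      DifferentiableAt ℝ h (t, p) →
      HasDerivAt (fun s : ℝ => h (t, p + s • bv i)) (fderiv ℝ h (t, p) (0, bv i)) 0 := by
    intro G _ _ h hh
    exact HasFDerivAt.comp_hasDerivAt_of_eq (0:ℝ) hh.hasFDerivAt hline hline0.symm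
  have e1 := (hcomp hf2).clm_apply
    ((hasDerivAt_const (0:ℝ) (1:ℝ)).prodMk ((hcomp hud).const_smul β))
  have e2 := ((hcomp hρd).inv (by simpa using hρp)).mul
    ((hcomp hP2).clm_apply (hasDerivAt_const (0:ℝ) ((0 : ℝ), bv j)))
  have e3 := e1.add ((e2.add ((hcomp hfd).const_mul a)).const_mul β)
  have hzero : (fun s : ℝ => fderiv ℝ f (t, p + s • bv i) (1, β • fl.u t (p + s • bv i)) +
      β * ((fl.ρ t (p + s • bv i))⁻¹ * fderiv ℝ P (t, p + s • bv i) (0, bv j)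
        + a * f (t, p + s • bv i))) = fun _ => 0 := by
    ext s
    rw [H.momentum_joint ht (p + s • bv i) j]
    ring
  have e4 := e3.unique (by
    refine (hasDerivAt_const (0:ℝ) (0:ℝ)).congr_of_eventuallyEq (Eventually.of_forall fun s => ?_)
    exact congrFun hzero s)
  simp only [zero_smul, add_zero, map_zero] at e4
  have hDu : fderiv ℝ f (t, p) (0, β • fderiv ℝ (fun q : ℝ × E3 => fl.u q.1 q.2) (t, p) (0, bv i))
      = β * ∑ k, pd i (fun z => fl.u t z k) p * pd k (fun z => fl.u t z j) p := by
    rw [show ((0 : ℝ), β • fderiv ℝ (fun q : ℝ × E3 => fl.u q.1 q.2) (t, p) (0, bv i)) =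
      β • ((0 : ℝ), fderiv ℝ (fun q : ℝ × E3 => fl.u q.1 q.2) (t, p) (0, bv i)) by simp, map_smul,
      smul_eq_mul, ← fderiv_slice (F := fun r x => fl.u r x j) hfd, ← fderiv_slice hud]
    congr 1
    rw [← sum_mul_pd]
    simp only [pd_component (H.differentiable_u ht' p)]
  rw [hDu] at e4
  rw [← hsymm, pd, pd, pd, fderiv_slice hρd, fderiv_slice hPd,
    fderiv_slice (F := fun r x => fl.u r x j) hfd]
  simp only [hP, hf, Pi.smul_apply, Pi.inv_apply, zero_smul, add_zero] at e4 ⊢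
  linear_combination e4

/-- The specific vorticity equation: along a particle path `ζ` is stretched by `∇u`, damped at rate
`a`, and driven by the baroclinic torque. The symmetric second derivatives of the pressure drop out
of the curl, and the compression term cancels against the continuity equation. -/
theorem hasDerivAt_zeta_path {c : ℝ → E3}
    (hc : HasDerivAt c ((2 * betaOne γ) • fl.u t (c t)) t) :
    HasDerivAt (fun r => fl.zeta r (c r)) ((2 * betaOne γ) •
      (fderiv ℝ (fl.u t) (c t) (fl.zeta t (c t)) - a • fl.zeta t (c t) +
        (1 / fl.ρ t (c t) ^ 3) • cross (grad (fl.ρ t) (c t)) (grad (fl.pressure γ t) (c t)))) t := by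
  have ht' := Ioo_subset_Ico_self ht
  obtain ⟨S, hS, hd⟩ := H.hasDerivAt_pd_u_path ht hc
  have hρp := (H.euler.pos t ht' (c t)).ne'
  have hρ := hasDerivAt_path ((H.contDiffAt_rho ht (c t)).differentiableAt (by norm_num)) rfl hc
  rw [H.mass_joint ht] at hρ
  have hu := H.differentiable_u ht' (c t)
  have hω : ∀ i j k l, HasDerivAt (fun r => (1 / fl.ρ r (c r)) *
      (pd i (fun z => fl.u r z j) (c r) - pd k (fun z => fl.u r z l) (c r))) _ t := fun i j k l =>
    ((hasDerivAt_const t (1:ℝ)).div hρ hρp).mul ((hd i j).sub (hd k l))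
  have hv : ∀ i, fderiv ℝ (fl.u t) (c t) (fl.zeta t (c t)) i =
      ∑ k, fl.zeta t (c t) k * pd k (fun z => fl.u t z i) (c t) := by
    intro i
    conv_lhs => rw [vec_eq_sum (fl.zeta t (c t))]
    simp [Fin.sum_univ_three, pd_component hu]
  apply hasDerivAt_of_components
  intro i
  fin_cases i
  · refine ((hω 1 2 2 1).congr_of_eventuallyEq (Eventually.of_forall fun r => by
      simp [Fluid.zeta, curl])).congr_deriv ?_
    simp only [PiLp.smul_apply, PiLp.add_apply, PiLp.sub_apply, smul_eq_mul, Fin.zero_eta, hv]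
    simp only [Fluid.zeta, curl, cross, grad, Fin.sum_univ_three, PiLp.smul_apply, smul_eq_mul,
      PiLp.toLp_apply, Matrix.cons_val_zero, Matrix.cons_val_one, Matrix.cons_val, Pi.div_apply, hS 2 1]
    field_simp
    ring
  · refine ((hω 2 0 0 2).congr_of_eventuallyEq (Eventually.of_forall fun r => by
      simp [Fluid.zeta, curl])).congr_deriv ?_
    simp only [PiLp.smul_apply, PiLp.add_apply, PiLp.sub_apply, smul_eq_mul, Fin.mk_one, hv]
    simp only [Fluid.zeta, curl, cross, grad, Fin.sum_univ_three, PiLp.smul_apply, smul_eq_mul,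
      PiLp.toLp_apply, Matrix.cons_val_zero, Matrix.cons_val_one, Matrix.cons_val, Pi.div_apply, hS 2 0]
    field_simp
    ring
  · refine ((hω 0 1 1 0).congr_of_eventuallyEq (Eventually.of_forall fun r => by
      simp [Fluid.zeta, curl])).congr_deriv ?_
    simp only [PiLp.smul_apply, PiLp.add_apply, PiLp.sub_apply, smul_eq_mul, Fin.reduceFinMk, hv]
    simp only [Fluid.zeta, curl, cross, grad, Fin.sum_univ_three, PiLp.smul_apply, smul_eq_mul,
      PiLp.toLp_apply, Matrix.cons_val_zero, Matrix.cons_val_one, Matrix.cons_val, Pi.div_apply, hS 1 0]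
    field_simp
    ring

end Setup

/-! ### The far field and the size of the damping -/

theorem left_mem {ε T t : ℝ} (ht : t ∈ Ico (-ε) T) : -ε ∈ Ico (-ε) T := ⟨le_rfl, ht.1.trans_lt ht.2⟩

theorem joint_zero_of_fderiv_zero {G : Type*} [NormedAddCommGroup G] [NormedSpace ℝ G]
    {F : ℝ → E3 → G} {t : ℝ} {p v : E3}
    (hF : DifferentiableAt ℝ (fun q : ℝ × E3 => F q.1 q.2) (t, p)) (h0 : fderiv ℝ (F t) p = 0) :
    fderiv ℝ (fun q : ℝ × E3 => F q.1 q.2) (t, p) (1, v) =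
      fderiv ℝ (fun q : ℝ × E3 => F q.1 q.2) (t, p) (1, 0) := by
  rw [fderiv_one_vec, ← fderiv_slice hF, h0]; simp

theorem continuousOn_slice {G : Type*} [TopologicalSpace G] {F : ℝ → E3 → G}
    {ε T : ℝ} (hF : ContinuousOn (fun q : ℝ × E3 => F q.1 q.2) (Ico (-ε) T ×ˢ univ)) {t : ℝ}
    (ht : t ∈ Ico (-ε) T) {c : ℝ → E3} (hc : ContinuousOn c (Icc (-ε) t)) :
    ContinuousOn (fun r => F r (c r)) (Icc (-ε) t) := by
  refine hF.comp (f := fun r => (r, c r)) (continuousOn_id.prodMk hc) ?_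
  intro r hr
  exact ⟨⟨hr.1, hr.2.trans_lt ht.2⟩, mem_univ _⟩

theorem eq_of_hasDerivAt_zero {f : ℝ → ℝ} {x y : ℝ} (hxy : x ≤ y) (hc : ContinuousOn f (Icc x y))
    (hd : ∀ r ∈ Ioo x y, HasDerivAt f 0 r) : f y = f x := by
  rcases hxy.eq_or_lt with rfl | h
  · rfl
  · obtain ⟨r, -, hr⟩ := exists_hasDerivAt_eq_slope f (fun _ => 0) h hc hd
    have : y - x ≠ 0 := by linarith
    field_simp at hr
    linarith

theorem abs_le_of_abs_exp_sub_one_le {y δ : ℝ} (h : |Real.exp (-y) - 1| ≤ δ) (hδ : δ ≤ 1 / 2) :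
    |y| ≤ 2 * δ := by
  have h1 := Real.add_one_le_exp (-y)
  have h2 := Real.add_one_le_exp y
  have h3 : Real.exp (-y) * Real.exp y = 1 := by rw [← Real.exp_add]; simp
  have h4 := Real.exp_pos y
  obtain ⟨h5, h6⟩ := abs_le.mp h
  rw [abs_le]
  constructor <;> nlinarith

namespace Setup

variable {γ κ₀ M ε a T l L : ℝ} {fl : Fluid} {m : Modulation}
  (H : Setup γ κ₀ M ε a T l L fl m)
include H

theorem betaOne_pos : 0 < betaOne γ := by
  have := H.alpha_pos
  unfold betaOne
  positivity

theorem betaOne_lt_one : betaOne γ < 1 := by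
  have := H.alpha_pos
  unfold betaOne
  rw [div_lt_one (by linarith)]
  linarith

theorem betaOne_mul : betaOne γ * (1 + alphaC γ) = 1 := by
  have := H.alpha_pos
  unfold betaOne
  field_simp

theorem theta_le {t : ℝ} (ht : t ∈ Ico (-ε) T) : t + ε ≤ (M + 1) * ε := by
  linarith [H.t_lt ht]

/-- Points of the box are close to the origin of the moving frame. -/
theorem norm_physPos_sub_le {t : ℝ} (ht : t ∈ Ico (-ε) T) (hn : ‖m.n t‖ ≤ 1) (hε1 : ε ≤ 1)
    {x : E3} (hx : x ∈ Box ε) : ‖m.physPos t x - m.ξ t‖ ≤ (6 + 8 * M ^ 2) * ε ^ (1 / 6 : ℝ) := by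
  have hε := H.hε
  have h1 := box_zero_le hx
  obtain ⟨h2, h3⟩ := box_succ_le hx
  have e1 : ε ^ (1 / 2 : ℝ) ≤ ε ^ (1 / 6 : ℝ) :=
    Real.rpow_le_rpow_of_exponent_ge hε hε1 (by norm_num)
  have e2 : ε ^ (1 / 6 : ℝ) ≤ 1 := Real.rpow_le_one hε.le hε1 (by norm_num)
  have e3 : ε ≤ ε ^ (1 / 6 : ℝ) := by
    simpa using Real.rpow_le_rpow_of_exponent_ge hε hε1 (show (1 / 6 : ℝ) ≤ 1 by norm_num)
  have hf : |m.front t x| ≤ 8 * M ^ 2 * ε ^ (1 / 6 : ℝ) := by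
    have hφ := H.boot.modulation.φ_le t ht
    have hM0 : 0 ≤ M ^ 2 * ε := by have := H.hM; positivity
    have hq : ∀ μ ν, ∀ y z : ℝ, |y| ≤ 2 → |z| ≤ 2 → |m.φ t μ ν * y * z| ≤ M ^ 2 * ε * 2 * 2 := by
      intro μ ν y z hy hz
      rw [abs_mul, abs_mul]
      have := hφ μ ν
      gcongr
    have h2' : |x 1| ≤ 2 := by linarith
    have h3' : |x 2| ≤ 2 := by linarith
    have q1 := hq 0 0 _ _ h2' h2'
    have q2 := hq 0 1 _ _ h2' h3'
    have q3 := hq 1 0 _ _ h3' h2'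
    have q4 := hq 1 1 _ _ h3' h3'
    have : M ^ 2 * ε ≤ M ^ 2 * ε ^ (1 / 6 : ℝ) := by gcongr
    rw [front_eq]
    rw [abs_le] at q1 q2 q3 q4 ⊢
    constructor <;> linarith
  rw [physPos_eq, add_sub_cancel_right, norm_act hn]
  refine (norm_add_le _ _).trans ?_
  have := norm_le_sum_abs x
  rw [norm_smul, norm_bv, mul_one, Real.norm_eq_abs]
  linarith

end Setup

/-- The damping acts little during the lifespan of the solution. At a fixed point of the far field
the fluid is in a constant state, so the density, hence `σ`, is constant in time and the velocity is
damped freely, like `e^{-2 β₁ a (t + ε)}`. But `z = O(ε)` forces `u₁ = σ + O(ε)` at all times, so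
the damping factor is `1 + O(ε)`. -/
theorem exists_damping_bound {γ κ₀ M : ℝ} (hγ : 1 < γ) (hκ₀ : 1 < κ₀) (hM : 1 < M) :
    ∃ C, 0 < C ∧ ∀ᶠ ε in 𝓝[>] (0 : ℝ),
    ∀ (a T l L : ℝ) (fl : Fluid) (m : Modulation), Setup γ κ₀ M ε a T l L fl m →
      ∀ t ∈ Ico (-ε) T, |2 * betaOne γ * a * (t + ε)| ≤ C * ε := by
  obtain ⟨C₁, hC₁, h1⟩ := exists_frameFacts hM
  obtain ⟨C₂, hC₂, h2⟩ := exists_stateFacts hγ hκ₀ hM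
  refine ⟨64 * C₂, by positivity, ?_⟩
  filter_upwards [eventually_pos, eventually_le_const one_pos, h1, h2,
    eventually_mul_rpow_le (6 + 8 * M ^ 2) (show (0:ℝ) < 1 / 6 by norm_num)
      (show (0:ℝ) < 1 / 4 by norm_num),
    eventually_mul_rpow_le (M ^ (1 / 4 : ℝ)) one_pos (show (0:ℝ) < 1 / 4 by norm_num),
    eventually_mul_rpow_le (32 * C₂) one_pos (show (0:ℝ) < 1 / 2 by norm_num)]
    with ε hε hε1 h1 h2 hs1 hs2 hs3 a T l L fl m H t ht
  rw [Real.rpow_one] at hs2 hs3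
  -- the fixed point `e₁` is outside the box at all times
  have hout : ∀ r ∈ Ico (-ε) T, m.invPos r (bv 0) ∉ Box ε := by
    intro r hr hin
    have F := h1 γ κ₀ a T l L fl m H r hr
    have hn : ‖m.n r‖ ≤ 1 := F.n_le.trans (by norm_num)
    have h3 := H.norm_physPos_sub_le hr hn hε1 hin
    rw [physPos_invPos m hn] at h3
    have h4 := H.boot.modulation.ξ_le r hr
    have h5 := norm_sub_norm_le (bv 0) (m.ξ r)
    rw [norm_bv] at h5
    linarith
  have hpos : ∀ r ∈ Ico (-ε) T, m.physPos r (m.invPos r (bv 0)) = bv 0 := fun r hr =>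
    physPos_invPos m ((h1 γ κ₀ a T l L fl m H r hr).n_le.trans (by norm_num)) _
  have hk0 : ∀ r ∈ Ico (-ε) T, fl.k r (bv 0) = 0 := by
    intro r hr
    have := (H.const r hr _ (hout r hr)).2.2
    rwa [hpos r hr] at this
  have hDu : ∀ r ∈ Ico (-ε) T, fderiv ℝ (fl.u r) (bv 0) = 0 := by
    intro r hr
    have := (H.const r hr _ (hout r hr)).1
    rwa [hpos r hr] at this
  have hDρ : ∀ r ∈ Ico (-ε) T, fderiv ℝ (fl.ρ r) (bv 0) = 0 := by
    intro r hr
    have := (H.const r hr _ (hout r hr)).2.1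
    rwa [hpos r hr] at this
  have hDk : ∀ r ∈ Ico (-ε) T, fderiv ℝ (fl.k r) (bv 0) = 0 := by
    intro r hr
    have F := h1 γ κ₀ a T l L fl m H r hr
    have := H.fderiv_k_outside hr (F.n_le.trans (by norm_num)) (hout r hr)
    rwa [hpos r hr] at this
  have hcu : ContinuousOn (fun r => fl.u r (bv 0)) (Icc (-ε) t) :=
    continuousOn_slice (F := fl.u) H.euler.smooth_u.continuousOn ht continuousOn_const
  have hcρ : ContinuousOn (fun r => fl.ρ r (bv 0)) (Icc (-ε) t) :=
    continuousOn_slice (F := fl.ρ) H.euler.smooth_rho.continuousOn ht continuousOn_const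
  have hsub : ∀ r ∈ Ioo (-ε) t, r ∈ Ioo (-ε) T := fun r hr => ⟨hr.1, hr.2.trans ht.2⟩
  have hρ : fl.ρ t (bv 0) = fl.ρ (-ε) (bv 0) := by
    refine eq_of_hasDerivAt_zero ht.1 hcρ fun r hr => ?_
    have hr1 := hsub r hr
    have hr2 := Ioo_subset_Ico_self hr1
    have hd := (H.contDiffAt_rho hr1 (bv 0)).differentiableAt (by norm_num)
    refine (hasDerivAt_time hd).congr_deriv ?_
    rw [← joint_zero_of_fderiv_zero (v := (2 * betaOne γ) • fl.u r (bv 0)) hd (hDρ r hr2),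
      H.mass_joint hr1]
    simp [pd_component (H.differentiable_u hr2 (bv 0)), hDu r hr2]
  have hu : Real.exp (2 * betaOne γ * a * (t + ε)) * fl.u t (bv 0) 0 = fl.u (-ε) (bv 0) 0 := by
    have := eq_of_hasDerivAt_zero
      (f := fun r => Real.exp (2 * betaOne γ * a * (r + ε)) * fl.u r (bv 0) 0) ht.1
      ((by fun_prop : ContinuousOn (fun r => Real.exp (2 * betaOne γ * a * (r + ε)))
        (Icc (-ε) t)).mul (by fun_prop)) (fun r hr => by
      have hr1 := hsub r hr
      have hr2 := Ioo_subset_Ico_self hr1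
      have hd := ((contDiffAt_euclidean.mp (H.contDiffAt_u hr1 (bv 0))) 0).differentiableAt
        (by norm_num : (4 : WithTop ℕ∞) ≠ 0)
      have hDu0 : fderiv ℝ (fun x => fl.u r x 0) (bv 0) = 0 := by
        have h3 : HasFDerivAt (fun z => fl.u r z 0) ((EuclideanSpace.proj (𝕜 := ℝ) (0 : Fin 3)).comp
            (fderiv ℝ (fl.u r) (bv 0))) (bv 0) :=
          (EuclideanSpace.proj (𝕜 := ℝ) (0 : Fin 3)).hasFDerivAt.comp _
            (H.differentiable_u hr2 (bv 0)).hasFDerivAt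
        rw [h3.fderiv, hDu r hr2]; simp
      have hp0 : fderiv ℝ (fun q : ℝ × E3 => fl.pressure γ q.1 q.2) (r, bv 0) (0, bv 0) = 0 := by
        rw [← fderiv_slice ((H.contDiffAt_pressure hr1 (bv 0)).differentiableAt (by norm_num)),
          (H.hasFDerivAt_pressure hr2 (bv 0)).fderiv, hDρ r hr2, hDk r hr2]
        simp
      have h4 := hasDerivAt_time (F := fun r x => fl.u r x 0) hd
      rw [← joint_zero_of_fderiv_zero (F := fun r x => fl.u r x 0)
        (v := (2 * betaOne γ) • fl.u r (bv 0)) hd hDu0, H.momentum_joint hr1, hp0] at h4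
      have h5 : HasDerivAt (fun r => Real.exp (2 * betaOne γ * a * (r + ε)))
          (Real.exp (2 * betaOne γ * a * (r + ε)) * (2 * betaOne γ * a)) r := by
        simpa using (((hasDerivAt_id r).add_const ε).const_mul (2 * betaOne γ * a)).exp
      refine (h5.mul h4).congr_deriv ?_
      ring)
    simpa using this
  have hσ : fl.sigma γ t (bv 0) = fl.sigma γ (-ε) (bv 0) := by
    rw [Fluid.sigma, Fluid.sigma, hρ, hk0 t ht, hk0 _ (left_mem ht)]
  have S := h2 a T l L fl m H t ht
  have S0 := h2 a T l L fl m H _ (left_mem ht)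
  have b1 := S.u_sub (bv 0)
  have b2 := S0.u_sub (bv 0)
  have b3 := S0.sigma_ge (bv 0)
  rw [hσ] at b1
  have h_decay : fl.u t (bv 0) 0 = Real.exp (-(2 * betaOne γ * a * (t + ε))) * fl.u (-ε) (bv 0) 0 := by
    rw [← hu, ← mul_assoc, ← Real.exp_add]; simp
  have hu0 : 1 / 16 ≤ fl.u (-ε) (bv 0) 0 := by
    have := (abs_le.mp b2).1
    linarith
  have key : |Real.exp (-(2 * betaOne γ * a * (t + ε))) - 1| ≤ 32 * C₂ * ε := by
    have h6 : |(Real.exp (-(2 * betaOne γ * a * (t + ε))) - 1) * fl.u (-ε) (bv 0) 0| ≤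
        2 * (C₂ * ε) := by
      rw [sub_mul, one_mul, ← h_decay]
      rw [abs_le] at b1 b2 ⊢
      constructor <;> linarith
    rw [abs_mul, abs_of_pos (by linarith : 0 < fl.u (-ε) (bv 0) 0)] at h6
    nlinarith [abs_nonneg (Real.exp (-(2 * betaOne γ * a * (t + ε))) - 1)]
  have := abs_le_of_abs_exp_sub_one_le key hs3
  linarith

namespace Setup

variable {γ κ₀ M ε a T l L : ℝ} {fl : Fluid} {m : Modulation}
  (H : Setup γ κ₀ M ε a T l L fl m) {t : ℝ} (ht : t ∈ Ico (-ε) T)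
include H ht

/-- Since `e^{-s} = τ - t = O(ε)`, the bootstrap bound for the derivative of `τ` integrates to this. -/
theorem abs_tau_le : |m.τ t| ≤ (betaOne γ * |a| + M) * ((M + 1) * ε) * (t + ε) := by
  have hβ := H.betaOne_pos
  have hM := H.hM
  have := (convex_Ico (-ε) T).norm_image_sub_le_of_norm_derivWithin_le (f := m.τ)
    (C := (betaOne γ * |a| + M) * ((M + 1) * ε))
    (H.modu.smooth_τ.differentiableOn (by norm_num)) (fun r hr => by
      refine (H.boot.modulation.dτ r hr).trans ?_
      rw [← add_mul, H.exp_neg_s hr]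
      have := H.tau_sub_le hr
      gcongr) (left_mem ht) ht
  rw [H.modu.init_τ, sub_zero, Real.norm_eq_abs, Real.norm_eq_abs, sub_neg_eq_add,
    abs_of_nonneg (by linarith [ht.1] : 0 ≤ t + ε)] at this
  exact this

/-- The bootstrap bound for the derivative of `κ`, integrated: to leading order `κ` is damped
freely. -/
theorem abs_kappa_sub_le : |m.κ t - κ₀ * Real.exp (-(betaOne γ * a * (t + ε)))| ≤
    ε ^ (1 / 6 : ℝ) * ((M + 1) * ε) := by
  have hε := H.hε
  have hud := uniqueDiffOn_Ico (-ε) T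
  have he : ∀ r, HasDerivAt (fun r => κ₀ * Real.exp (-(betaOne γ * a * (r + ε))))
      (κ₀ * (Real.exp (-(betaOne γ * a * (r + ε))) * (-(betaOne γ * a)))) r := by
    intro r
    simpa using ((((hasDerivAt_id r).add_const ε).const_mul (betaOne γ * a)).neg.exp).const_mul κ₀
  have hd : ∀ r ∈ Ico (-ε) T, HasDerivWithinAt
      (fun r => m.κ r - κ₀ * Real.exp (-(betaOne γ * a * (r + ε)))) (derivWithin m.κ (Ico (-ε) T) r
      - κ₀ * (Real.exp (-(betaOne γ * a * (r + ε))) * (-(betaOne γ * a)))) (Ico (-ε) T) r :=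
    fun r hr => (H.modu.smooth_κ.differentiableOn (by norm_num) r hr).hasDerivWithinAt.sub
      (he r).hasDerivWithinAt
  have := (convex_Ico (-ε) T).norm_image_sub_le_of_norm_hasDerivWithin_le hd
    (C := ε ^ (1 / 6 : ℝ)) (fun r hr => by
      refine le_trans (le_of_eq ?_) (H.boot.modulation.dκ r hr)
      rw [Real.norm_eq_abs]
      congr 1
      ring) (left_mem ht) ht
  simp only [H.modu.init_κ, neg_add_cancel, mul_zero, neg_zero, Real.exp_zero, mul_one, sub_self,
    sub_zero, Real.norm_eq_abs, sub_neg_eq_add, abs_of_nonneg (by linarith [ht.1] : 0 ≤ t + ε)]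
    at this
  have h2 := H.theta_le ht
  exact this.trans (by gcongr)

end Setup

/-! ### Bounds for the vorticity and its sources -/

/-- Bounds for the specific vorticity and for the terms of its evolution equation. -/
structure VortFacts (γ C ε : ℝ) (fl : Fluid) (m : Modulation) (t : ℝ) (x : E3) : Prop where
  normal : |inner ℝ (fl.zeta t (m.physPos t x)) (m.fr 0 t x)| ≤ C * ε ^ (1 / 2 : ℝ)
  norm_le : ‖fl.zeta t (m.physPos t x)‖ ≤ C
  stretch : ∀ μ : Fin 2, |inner ℝ (fderiv ℝ (fl.u t) (m.physPos t x)
    (fl.zeta t (m.physPos t x))) (m.fr μ.succ t x)| ≤ C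
  torque : ∀ μ : Fin 2, |inner ℝ ((1 / fl.ρ t (m.physPos t x) ^ 3) •
    cross (grad (fl.ρ t) (m.physPos t x)) (grad (fl.pressure γ t) (m.physPos t x)))
      (m.fr μ.succ t x)| ≤ C * ε ^ (1 / 8 : ℝ) * (1 + |pd 0 (m.w γ fl t) x|)

/-- The component `ζ · N = ζ · (T² × T³)` involves only tangential derivatives of tangential velocities,
which are `O(ε^{1/2})`. A tangential component involves `∂_N (u · T)` and `∂_T (u · N)`, but not the
large derivative `∂_N (u · N)`, so it is bounded; and so is the stretching term in a tangential
direction. The torque contains `∂_N σ` multiplied by a tangential derivative of `k`. -/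
theorem exists_vortFacts {γ κ₀ M : ℝ} (hγ : 1 < γ) (hκ₀ : 1 < κ₀) (hM : 1 < M) :
    ∃ C, 0 < C ∧ ∀ᶠ ε in 𝓝[>] (0 : ℝ),
    ∀ (a T l L : ℝ) (fl : Fluid) (m : Modulation), Setup γ κ₀ M ε a T l L fl m →
      ∀ t ∈ Ico (-ε) T, ∀ x ∈ Box ε, VortFacts γ C ε fl m t x := by
  obtain ⟨C₁, hC₁, h1⟩ := exists_frameFacts hM
  obtain ⟨C₂, hC₂, h2⟩ := exists_stateFacts hγ hκ₀ hM
  obtain ⟨C₃, hC₃, h3⟩ := exists_gradFacts hγ hκ₀ hM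
  have hα : 0 < alphaC γ := by unfold alphaC; linarith
  obtain ⟨Z, hZ⟩ : ∃ Z, Z = C₂ * (2 * C₃) := ⟨_, rfl⟩
  have hZp : 0 < Z := by rw [hZ]; positivity
  obtain ⟨B, hB⟩ : ∃ B, B = alphaC γ * (2 * κ₀) * C₂ * (2 * C₃ * C₃) := ⟨_, rfl⟩
  have hBp : 0 < B := by rw [hB]; positivity
  refine ⟨3 * Z + 3 * Z * C₃ + B, by positivity, ?_⟩
  filter_upwards [eventually_pos, eventually_le_const one_pos, h1, h2, h3]
    with ε hε hε1 h1 h2 h3 a T l L fl m H t ht x hx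
  have F := h1 γ κ₀ a T l L fl m H t ht
  have S := h2 a T l L fl m H t ht
  have D := h3 a T l L fl m H t ht x hx
  have hn : ‖m.n t‖ ≤ 1 := F.n_le.trans (by norm_num)
  have hh0 : 0 < ε ^ (1 / 2 : ℝ) := by positivity
  have hh1 : ε ^ (1 / 2 : ℝ) ≤ 1 := Real.rpow_le_one hε.le hε1 (by norm_num)
  set p := m.physPos t x
  have hρ := H.euler.pos t ht p
  have hρi : |1 / fl.ρ t p| ≤ C₂ := by
    rw [abs_of_pos (by positivity), one_div, inv_le_comm₀ hρ hC₂]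
    exact S.rho_ge p
  have hu := H.differentiable_u ht p
  obtain ⟨hx0, hx1, hx2⟩ := frame_cross (q := (m.n t, m.frontD t x)) hn
  have u12 := D.u_tt 0 1
  have u21 := D.u_tt 1 0
  have un1 := D.u_nt 0
  have un2 := D.u_nt 1
  have u1n := D.u_tn 0
  have u2n := D.u_tn 1
  simp only [Fin.succ_zero_eq_one, Fin.succ_one_eq_two] at u12 u21 un1 un2 u1n u2n
  have hz : ∀ v w : E3, ∀ A B : ℝ, |inner ℝ (fderiv ℝ (fl.u t) p v) w| ≤ A →
      |inner ℝ (fderiv ℝ (fl.u t) p w) v| ≤ B →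
      |inner ℝ (fl.zeta t p) (cross v w)| ≤ C₂ * (A + B) := by
    intro v w A B hA hB
    rw [Fluid.zeta, inner_smul_left, inner_curl_cross hu, abs_mul]
    refine mul_le_mul (by simpa using hρi) ((abs_sub _ _).trans (by linarith)) (abs_nonneg _) hC₂.le
  have hz0 : |inner ℝ (fl.zeta t p) (m.fr 0 t x)| ≤ Z * ε ^ (1 / 2 : ℝ) := by
    have := hz (m.fr 1 t x) (m.fr 2 t x) _ _ u12 u21
    rw [show cross (m.fr 1 t x) (m.fr 2 t x) = m.fr 0 t x from hx0] at this
    rw [hZ]; linarith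
  have hz1 : |inner ℝ (fl.zeta t p) (m.fr 1 t x)| ≤ Z := by
    have := hz (m.fr 2 t x) (m.fr 0 t x) _ _ u2n un2
    rw [show cross (m.fr 2 t x) (m.fr 0 t x) = m.fr 1 t x from hx1] at this
    rw [hZ]; linarith
  have hz2 : |inner ℝ (fl.zeta t p) (m.fr 2 t x)| ≤ Z := by
    have := hz (m.fr 0 t x) (m.fr 1 t x) _ _ un1 u1n
    rw [show cross (m.fr 0 t x) (m.fr 1 t x) = m.fr 2 t x from hx2] at this
    rw [hZ]; linarith
  have hz0' : |inner ℝ (fl.zeta t p) (m.fr 0 t x)| ≤ Z := hz0.trans (by nlinarith)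
  have hzc : fl.zeta t p = inner ℝ (fl.zeta t p) (m.fr 0 t x) • m.fr 0 t x
      + inner ℝ (fl.zeta t p) (m.fr 1 t x) • m.fr 1 t x
      + inner ℝ (fl.zeta t p) (m.fr 2 t x) • m.fr 2 t x :=
    frame_complete (q := (m.n t, m.frontD t x)) hn _
  have e0 : ∀ j, ‖m.fr j t x‖ = 1 := frame_norm (q := (m.n t, m.frontD t x)) hn
  have hZC : 0 < Z * C₃ := by positivity
  refine ⟨?_, ?_, fun μ => ?_, fun μ => ?_⟩
  · refine hz0.trans ?_
    gcongr
    linarith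
  · rw [hzc]
    refine (norm_add₃_le).trans ?_
    simp only [norm_smul, e0, mul_one, Real.norm_eq_abs]
    linarith
  · have hst : ∀ j, |inner ℝ (fderiv ℝ (fl.u t) p (m.fr j t x)) (m.fr μ.succ t x)| ≤ C₃ := by
      intro j
      refine Fin.cases (D.u_nt μ) (fun ν => (D.u_tt ν μ).trans ?_) j
      nlinarith
    rw [hzc, map_add, map_add, map_smul, map_smul, map_smul, inner_add_left, inner_add_left,
      inner_smul_left, inner_smul_left, inner_smul_left]
    refine (abs_add_three _ _ _).trans ?_
    rw [abs_mul, abs_mul, abs_mul]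
    simp only [conj_trivial]
    have m0 := mul_le_mul hz0' (hst 0) (abs_nonneg _) hZp.le
    have m1 := mul_le_mul hz1 (hst 1) (abs_nonneg _) hZp.le
    have m2 := mul_le_mul hz2 (hst 2) (abs_nonneg _) hZp.le
    linarith
  · have he : ∃ v w : E3, ∃ ν : Fin 2, m.fr μ.succ t x = cross v w ∧
        ((v = m.fr 0 t x ∧ w = m.fr ν.succ t x) ∨ (w = m.fr 0 t x ∧ v = m.fr ν.succ t x)) := by
      fin_cases μ
      · exact ⟨m.fr 2 t x, m.fr 0 t x, 1, hx1.symm, Or.inr ⟨rfl, rfl⟩⟩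
      · exact ⟨m.fr 0 t x, m.fr 1 t x, 0, hx2.symm, Or.inl ⟨rfl, rfl⟩⟩
    obtain ⟨v, w, ν, hvw, hor⟩ := he
    rw [hvw, inner_smul_left, conj_trivial, H.baroclinic_eq ht, abs_mul]
    have hσ := H.sigma_pos ht p
    have hc : |alphaC γ * fl.sigma γ t p / (γ * fl.ρ t p)| ≤ alphaC γ * (2 * κ₀) * C₂ := by
      rw [abs_of_pos (by positivity), show alphaC γ * fl.sigma γ t p / (γ * fl.ρ t p) =
        alphaC γ * fl.sigma γ t p * (1 / fl.ρ t p) * (1 / γ) by field_simp]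
      have g1 : 1 / γ ≤ 1 := by rw [div_le_one (by linarith)]; linarith
      have g2 := S.sigma_le p
      have g3 : 1 / fl.ρ t p ≤ C₂ := (le_abs_self _).trans hρi
      calc _ ≤ alphaC γ * (2 * κ₀) * C₂ * 1 := by gcongr
        _ = _ := by ring
    have hw0 := abs_nonneg (pd 0 (m.w γ fl t) x)
    set w0 := |pd 0 (m.w γ fl t) x|
    have hn1 : |fderiv ℝ (fl.sigma γ t) p (m.fr 0 t x) * fderiv ℝ (fl.k t) p (m.fr ν.succ t x)| ≤
        C₃ * (1 + w0) * (C₃ * ε ^ (1 / 8 : ℝ)) := by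
      rw [abs_mul]
      exact mul_le_mul D.sigma_n (D.k_le _) (abs_nonneg _) (by positivity)
    have hn2 : |fderiv ℝ (fl.sigma γ t) p (m.fr ν.succ t x) * fderiv ℝ (fl.k t) p (m.fr 0 t x)| ≤
        C₃ * (1 + w0) * (C₃ * ε ^ (1 / 8 : ℝ)) := by
      rw [abs_mul]
      refine mul_le_mul ((D.sigma_t ν).trans ?_) (D.k_le _) (abs_nonneg _) (by positivity)
      nlinarith
    have hd : |fderiv ℝ (fl.sigma γ t) p v * fderiv ℝ (fl.k t) p w -
          fderiv ℝ (fl.sigma γ t) p w * fderiv ℝ (fl.k t) p v| ≤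
        2 * C₃ * C₃ * ε ^ (1 / 8 : ℝ) * (1 + w0) := by
      rw [abs_le] at hn1 hn2 ⊢
      rcases hor with ⟨rfl, rfl⟩ | ⟨rfl, rfl⟩ <;> constructor <;> linarith
    calc _ ≤ alphaC γ * (2 * κ₀) * C₂ * (2 * C₃ * C₃ * ε ^ (1 / 8 : ℝ) * (1 + w0)) :=
          mul_le_mul hc hd (abs_nonneg _) (by positivity)
      _ = B * ε ^ (1 / 8 : ℝ) * (1 + w0) := by rw [hB]; ring
      _ ≤ _ := by
        gcongr
        linarith

/-! ### Speed of the blow-up location -/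

/-- The trace of a linear map in an orthonormal frame. -/
theorem sum_inner_frame {q : E2 × (Fin 2 → ℝ)} (hn : ‖q.1‖ ≤ 1) (D : E3 →L[ℝ] E3) :
    inner ℝ (D (frame 0 q)) (frame 0 q) + inner ℝ (D (frame 1 q)) (frame 1 q)
      + inner ℝ (D (frame 2 q)) (frame 2 q) = ∑ i, D (bv i) i := by
  have hδ : ∀ i k, bv i k = frame 0 q i * frame 0 q k + frame 1 q i * frame 1 q k
      + frame 2 q i * frame 2 q k := by
    intro i k
    have := congrArg (fun v : E3 => v k) (frame_complete hn (bv i))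
    simp only [PiLp.add_apply, PiLp.smul_apply, smul_eq_mul] at this
    rw [this]
    fin_cases i <;> simp [inner3]
  have hD : ∀ v k, D v k = v 0 * D (bv 0) k + v 1 * D (bv 1) k + v 2 * D (bv 2) k := by
    intro v k
    conv_lhs => rw [vec_eq_sum v]
    simp
  have h00 := hδ 0 0
  have h11 := hδ 1 1
  have h22 := hδ 2 2
  have h01 := hδ 0 1
  have h02 := hδ 0 2
  have h12 := hδ 1 2
  simp only [PiLp.single_apply, Fin.reduceEq, if_true, if_false] at h00 h11 h22 h01 h02 h12
  simp only [inner3, Fin.sum_univ_three]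
  rw [hD (frame 0 q), hD (frame 0 q), hD (frame 0 q), hD (frame 1 q), hD (frame 1 q),
    hD (frame 1 q), hD (frame 2 q), hD (frame 2 q), hD (frame 2 q)]
  linear_combination (-D (bv 0) 0) * h00 - D (bv 1) 1 * h11 - D (bv 2) 2 * h22
    - (D (bv 0) 1 + D (bv 1) 0) * h01 - (D (bv 0) 2 + D (bv 2) 0) * h02
    - (D (bv 1) 2 + D (bv 2) 1) * h12

theorem zero_mem_box {ε : ℝ} (hε : 0 < ε) : (0 : E3) ∈ Box ε := by
  constructor <;> simp <;> positivity

theorem posD_zero (m : Modulation) (t : ℝ) (i : Fin 3) : m.posD t 0 (bv i) = m.fr i t 0 := by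
  have h0 : m.frontD t 0 = 0 := (m.frontDL t).map_zero
  refine Fin.cases ?_ (fun μ => ?_) i
  · rw [posD_bv_zero, Modulation.fr, frame, h0, slopeFrame_zero]
  · rw [posD_bv_succ, Modulation.fr, frame, h0, slopeFrame_zero]; simp

theorem physPos_zero (m : Modulation) (t : ℝ) : m.physPos t 0 = m.ξ t := by
  rw [physPos_eq]; simp [front_eq, act_zero]

theorem rescale_zero (m : Modulation) (t : ℝ) : m.rescale t 0 = 0 := by
  ext i; fin_cases i <;> simp [Modulation.rescale]

namespace Setup

variable {γ κ₀ M ε a T l L : ℝ} {fl : Fluid} {m : Modulation}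
  (H : Setup γ κ₀ M ε a T l L fl m) {t : ℝ}
include H

theorem w_zero (ht : t ∈ Ico (-ε) T) : m.w γ fl t 0 = m.κ t := by
  have := H.modu.constraint t ht 0 (by simp [order])
  rw [pdIter_zero, if_neg (by intro h; simpa using congrFun h 0), ← rescale_zero m t,
    Modulation.W, unscale_rescale] at this
  have h2 := (mul_eq_zero.mp this).resolve_left (Real.exp_pos _).ne'
  linarith

theorem pd_w_zero_zero (ht : t ∈ Ico (-ε) T) (hn : ‖m.n t‖ < 1) :
    pd 0 (m.w γ fl t) 0 = -(m.τ t - t)⁻¹ := by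
  have := H.modu.constraint t ht (unitIdx 0) (by simp [order, unitIdx])
  rw [pdIter_unitIdx, if_pos (by simp [unitIdx]), ← rescale_zero m t, H.pd_W_zero ht hn,
    H.exp_neg_s ht] at this
  have h0 := H.modu.lt_τ t ht
  have h1 : m.τ t - t ≠ 0 := by linarith
  field_simp
  linarith

theorem pd_w_succ_zero (ht : t ∈ Ico (-ε) T) (hn : ‖m.n t‖ < 1) (μ : Fin 2) :
    pd μ.succ (m.w γ fl t) 0 = 0 := by
  have := H.modu.constraint t ht (unitIdx μ.succ) (by fin_cases μ <;> simp [order, unitIdx])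
  rwa [pdIter_unitIdx, if_neg (by
    intro h; have := congrFun h 0; fin_cases μ <;> simp [unitIdx] at this), ← rescale_zero m t,
    H.pd_W_succ ht hn] at this

/-- The momentum equation in a fixed direction, in terms of sound speed and entropy. -/
theorem inner_momentum (ht : t ∈ Ioo (-ε) T) (p e : E3) :
    inner ℝ (fderiv ℝ (fun q : ℝ × E3 => fl.u q.1 q.2) (t, p) (1, (2 * betaOne γ) • fl.u t p)) e =
      -(2 * betaOne γ) * (alphaC γ * fl.sigma γ t p * fderiv ℝ (fl.sigma γ t) p e
        - alphaC γ * fl.sigma γ t p ^ 2 / (2 * γ) * fderiv ℝ (fl.k t) p e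
        + a * inner ℝ (fl.u t p) e) := by
  have ht' := Ioo_subset_Ico_self ht
  have hρ := H.euler.pos t ht' p
  have hα := H.alpha_pos
  have hγ : 0 < γ := by linarith [H.hγ]
  have hud : DifferentiableAt ℝ (fun q : ℝ × E3 => fl.u q.1 q.2) (t, p) :=
    (H.contDiffAt_u ht p).differentiableAt (by norm_num)
  have hp : DifferentiableAt ℝ (fun q : ℝ × E3 => fl.pressure γ q.1 q.2) (t, p) :=
    (H.contDiffAt_pressure ht p).differentiableAt (by norm_num)
  have hj : ∀ j, fderiv ℝ (fun q : ℝ × E3 => fl.u q.1 q.2) (t, p)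
      (1, (2 * betaOne γ) • fl.u t p) j = -(2 * betaOne γ) * ((fl.ρ t p)⁻¹ *
        fderiv ℝ (fl.pressure γ t) p (bv j) + a * fl.u t p j) := by
    intro j
    have h1 : HasFDerivAt (fun q : ℝ × E3 => fl.u q.1 q.2 j)
        ((EuclideanSpace.proj (𝕜 := ℝ) j).comp
          (fderiv ℝ (fun q : ℝ × E3 => fl.u q.1 q.2) (t, p))) (t, p) :=
      (EuclideanSpace.proj (𝕜 := ℝ) j).hasFDerivAt.comp _ hud.hasFDerivAt
    have h2 := H.momentum_joint ht p j
    rw [h1.fderiv, ← fderiv_slice hp] at h2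
    exact h2
  have hsum : fderiv ℝ (fl.pressure γ t) p e = e 0 * fderiv ℝ (fl.pressure γ t) p (bv 0)
      + e 1 * fderiv ℝ (fl.pressure γ t) p (bv 1) + e 2 * fderiv ℝ (fl.pressure γ t) p (bv 2) := by
    conv_lhs => rw [vec_eq_sum e]
    simp
  have hpe : (fl.ρ t p)⁻¹ * fderiv ℝ (fl.pressure γ t) p e =
      alphaC γ * fl.sigma γ t p * fderiv ℝ (fl.sigma γ t) p e
        - alphaC γ * fl.sigma γ t p ^ 2 / (2 * γ) * fderiv ℝ (fl.k t) p e := by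
    rw [(H.hasFDerivAt_pressure ht' p).fderiv, H.fderiv_sigma ht', H.pressure_eq ht']
    simp only [add_apply, smul_apply, smul_eq_mul]
    field_simp
    simp only [alphaC]
    ring
  rw [← hpe, hsum]
  simp only [inner3, hj]
  ring

/-- The sound speed equation. -/
theorem sigma_joint (ht : t ∈ Ioo (-ε) T) (p : E3) :
    fderiv ℝ (fun q : ℝ × E3 => fl.sigma γ q.1 q.2) (t, p) (1, (2 * betaOne γ) • fl.u t p) =
      -(2 * betaOne γ) * (alphaC γ * fl.sigma γ t p * ∑ i, fderiv ℝ (fl.u t) p (bv i) i) := by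
  have ht' := Ioo_subset_Ico_self ht
  have hρ := H.euler.pos t ht' p
  have h := hasFDerivAt_soundSpeed (ρ := fun q : ℝ × E3 => fl.ρ q.1 q.2)
    (k := fun q : ℝ × E3 => fl.k q.1 q.2) (p := (t, p)) H.alpha_pos.ne' hρ
    ((H.contDiffAt_rho ht p).differentiableAt (by norm_num))
    ((H.contDiffAt_k ht p).differentiableAt (by norm_num))
  have h2 : fderiv ℝ (fun q : ℝ × E3 => fl.sigma γ q.1 q.2) (t, p) = _ := h.fderiv
  rw [h2]
  simp only [add_apply, smul_apply, smul_eq_mul, H.mass_joint ht, H.entropy_joint ht,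
    pd_component (H.differentiable_u ht' p)]
  rw [Fluid.sigma]
  field_simp
  ring

end Setup

/-- Algebra of the front speed. Here `x = τ - t`, `ue = u · e`, `s = σ` and `ξe = ξ' · e` at the origin
of the moving coordinates, and `h` is the time derivative of the constraint `w = κ` there. -/
theorem front_speed_solve {x β α a κ κ' z ξe ue s Rem : ℝ} (hx : x ≠ 0) (hβα : β * (1 + α) = 1)
    (hw : ue + s = κ) (hz : ue - s = z)
    (h : κ' = (ξe - 2 * β * ue) * -x⁻¹ + 2 * β * α * s * x⁻¹ - 2 * β * a * ue + Rem) :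
    ξe - κ = β * (1 - α) * z - x * (κ' + β * a * κ + β * a * z - Rem) := by
  have h6 : ue = (κ + z) / 2 := by linarith
  have h7 : s = (κ - z) / 2 := by linarith
  subst h6 h7
  have h5 : x * x⁻¹ = 1 := mul_inv_cancel₀ hx
  linear_combination x * h - (ξe - β * (κ + z) - β * α * (κ - z)) * h5 + κ * hβα

/-- The right side of `front_speed_solve` is small. The term `κ' + β a κ` is bounded by the bootstrap
assumption on `κ'`, up to `|β a| O(ε) = O(ε ^ (-1/2))`, although `β a κ` alone may be as large as
`ε ^ (-3/2)`; the factor `x` gains a power of `ε`. -/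
theorem front_speed_le {ε M R β α a x κ κ' κ₀ z Rem θ : ℝ} (hε : 0 < ε) (hε1 : ε ≤ 1) (hM : 1 ≤ M)
    (hR : 0 ≤ R) (hβ : 0 < β) (hβ1 : β < 1) (hβα : β * (1 + α) = 1) (hx : 0 < x)
    (hxle : x ≤ (M + 1) * ε) (hz : |z| ≤ M * ε) (hRem : |Rem| ≤ R)
    (hκ' : |κ' + β * a * Real.exp (-(β * a * θ)) * κ₀| ≤ ε ^ (1 / 6 : ℝ))
    (hκ : |κ - κ₀ * Real.exp (-(β * a * θ))| ≤ ε ^ (1 / 6 : ℝ) * ((M + 1) * ε))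
    (hb : |β * a| ≤ ε ^ (-(3 / 2) : ℝ)) :
    |β * (1 - α) * z - x * (κ' + β * a * κ + β * a * z - Rem)| ≤
      (M + (M + 1) * (2 + R) + (M + 1) * (2 * M + 1)) * ε ^ (1 / 2 : ℝ) := by
  have hsix : ε ^ (1 / 6 : ℝ) ≤ 1 := Real.rpow_le_one hε.le hε1 (by norm_num)
  have hhalfp : 0 < ε ^ (1 / 2 : ℝ) := by positivity
  have hε2 : ε ≤ ε ^ (1 / 2 : ℝ) := by
    simpa using Real.rpow_le_rpow_of_exponent_ge hε hε1 (show (1 / 2 : ℝ) ≤ 1 by norm_num)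
  set b := β * a with hbdef
  set E := Real.exp (-(b * θ)) with hE
  have hME : 0 < (M + 1) * ε := by positivity
  have hsum : |κ' + b * κ + b * z - Rem| ≤ 1 + R + |b| * ((2 * M + 1) * ε) := by
    have t1 : |b * (κ - κ₀ * E)| ≤ |b| * ((M + 1) * ε) := by
      rw [abs_mul]
      have := hκ.trans (mul_le_of_le_one_left hME.le hsix)
      gcongr
    have t2 : |b * z| ≤ |b| * (M * ε) := by rw [abs_mul]; gcongr
    have t3 := hκ'.trans hsix
    have e1 : κ' + b * κ + b * z - Rem =
      (κ' + b * E * κ₀) + b * (κ - κ₀ * E) + b * z - Rem := by ring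
    have e2 : |b| * ((2 * M + 1) * ε) = |b| * ((M + 1) * ε) + |b| * (M * ε) := by ring
    rw [e1, e2]
    rw [abs_le] at t1 t2 t3 hRem ⊢
    constructor <;> linarith
  have hbε : |b| * (ε * ε) ≤ ε ^ (1 / 2 : ℝ) := by
    calc |b| * (ε * ε) ≤ ε ^ (-(3 / 2) : ℝ) * (ε * ε) := by gcongr
      _ = ε ^ (-(3 / 2) : ℝ) * ε ^ (2 : ℝ) := by rw [Real.rpow_two]; ring
      _ = ε ^ (1 / 2 : ℝ) := by rw [← Real.rpow_add hε]; norm_num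
  have hαβ1 : |β * (1 - α)| ≤ 1 := by
    have h : β * (1 - α) = 2 * β - 1 := by linear_combination -hβα
    rw [h, abs_le]
    constructor <;> linarith
  have f1 : |β * (1 - α) * z| ≤ M * ε := by
    rw [abs_mul]
    calc _ ≤ 1 * (M * ε) := mul_le_mul hαβ1 hz (abs_nonneg _) (by norm_num)
      _ = _ := one_mul _
  have f2 : |x * (κ' + b * κ + b * z - Rem)| ≤
      (M + 1) * (1 + R) * ε + (M + 1) * (2 * M + 1) * (|b| * (ε * ε)) := by
    rw [abs_mul, abs_of_pos hx]
    calc _ ≤ (M + 1) * ε * (1 + R + |b| * ((2 * M + 1) * ε)) :=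
          mul_le_mul hxle hsum (abs_nonneg _) (by positivity)
      _ = _ := by ring
  have f3 : (M + 1) * (1 + R) * ε ≤ (M + 1) * (1 + R) * ε ^ (1 / 2 : ℝ) := by gcongr
  have f4 : (M + 1) * (2 * M + 1) * (|b| * (ε * ε)) ≤ (M + 1) * (2 * M + 1) * ε ^ (1 / 2 : ℝ) := by
    gcongr
  have f5 : M * ε ≤ M * ε ^ (1 / 2 : ℝ) := by gcongr
  have f6 : 0 < (M + 1) * ε ^ (1 / 2 : ℝ) := by positivity
  refine (abs_sub _ _).trans ((add_le_add f1 f2).trans ?_)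
  have e3 : (M + (M + 1) * (2 + R) + (M + 1) * (2 * M + 1)) * ε ^ (1 / 2 : ℝ) =
    M * ε ^ (1 / 2 : ℝ) + (M + 1) * (1 + R) * ε ^ (1 / 2 : ℝ) +
      (M + 1) * (2 * M + 1) * ε ^ (1 / 2 : ℝ) + (M + 1) * ε ^ (1 / 2 : ℝ) := by ring
  rw [e3]
  linarith

theorem abs_two_mul_mul_le {β X Y A B : ℝ} (hβ0 : 0 < β) (hβ : β < 1) (hX : 0 ≤ X) (hA : X ≤ A)
    (hB : |Y| ≤ B) : |2 * β * (X * Y)| ≤ 2 * (A * B) := by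
  have h := mul_le_mul hA hB (abs_nonneg _) (hX.trans hA)
  have h2 : 0 ≤ X * |Y| := by positivity
  rw [abs_mul, abs_mul X, abs_of_pos (by positivity : 0 < 2 * β), abs_of_nonneg hX]
  nlinarith

set_option maxHeartbeats 2000000 in
/-- The blow-up location moves with speed `κ + O(ε^{1/2})` in the blow-up direction. Time
differentiation of the constraint `w = κ` at the origin gives, by the Euler equations and
`∂₁w = -e^s`, `∂₂w = ∂₃w = 0` there, an identity whose terms of size `e^s` fix that speed; the other
terms are `O(ε^{-1/2})`, hence `O(ε^{1/2})` after division by `e^s`. -/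
theorem exists_front_speed {γ κ₀ M : ℝ} (hγ : 1 < γ) (hκ₀ : 1 < κ₀) (hM : 1 < M) :
    ∃ C, 0 < C ∧ ∀ᶠ ε in 𝓝[>] (0 : ℝ),
    ∀ (a T l L : ℝ) (fl : Fluid) (m : Modulation), Setup γ κ₀ M ε a T l L fl m →
      |betaOne γ * a| ≤ ε ^ (-(3 / 2) : ℝ) →
      ∀ t ∈ Ioo (-ε) T,
        |inner ℝ (derivWithin m.ξ (Ico (-ε) T) t) (m.fr 0 t 0) - m.κ t| ≤ C * ε ^ (1 / 2 : ℝ) := by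
  obtain ⟨K, hK, hKb⟩ := exists_frame_bound
  obtain ⟨C₁, hC₁, h1⟩ := exists_frameFacts hM
  obtain ⟨C₂, hC₂, h2⟩ := exists_stateFacts hγ hκ₀ hM
  obtain ⟨C₃, hC₃, h3⟩ := exists_gradFacts hγ hκ₀ hM
  have hα : 0 < alphaC γ := by unfold alphaC; linarith
  -- `V` bounds the relative speed, `R` the remainder
  obtain ⟨V, hV⟩ : ∃ V, V = M ^ (1 / 4 : ℝ) + 2 * (2 * κ₀) := ⟨_, rfl⟩
  obtain ⟨R, hR⟩ : ∃ R, R = 2 * (V * (2 * κ₀ * C₁)) + 2 * (alphaC γ * (2 * κ₀) ^ 2 * C₃)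
    + 2 * (alphaC γ * (2 * κ₀) * (2 * C₃)) + 2 * κ₀ * (K * M ^ 2) := ⟨_, rfl⟩
  have hMr : 0 < M ^ (1 / 4 : ℝ) := by positivity
  have hVp : 0 < V := by rw [hV]; positivity
  have hRp : 0 < R := by rw [hR]; positivity
  refine ⟨M + (M + 1) * (2 + R) + (M + 1) * (2 * M + 1), by positivity, ?_⟩
  filter_upwards [eventually_pos, eventually_le_const one_pos, h1, h2, h3]
    with ε hε hε1 h1 h2 h3 a T l L fl m H hb t ht
  have ht' := Ioo_subset_Ico_self ht
  have F := h1 γ κ₀ a T l L fl m H t ht'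
  have S := h2 a T l L fl m H t ht'
  have h0box := zero_mem_box hε
  have D := h3 a T l L fl m H t ht' 0 h0box
  have hn : ‖m.n t‖ < 1 := F.n_le.trans_lt (by norm_num)
  have hhalf : ε ^ (1 / 2 : ℝ) ≤ 1 := Real.rpow_le_one hε.le hε1 (by norm_num)
  have hhalfp : 0 < ε ^ (1 / 2 : ℝ) := by positivity
  have hε2 : ε ≤ ε ^ (1 / 2 : ℝ) := by
    simpa using Real.rpow_le_rpow_of_exponent_ge hε hε1 (show (1 / 2 : ℝ) ≤ 1 by norm_num)
  have he8 : ε ^ (1 / 8 : ℝ) ≤ 1 := Real.rpow_le_one hε.le hε1 (by norm_num)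
  have hβ := H.betaOne_pos
  have hβ1 := H.betaOne_lt_one
  have hβα := H.betaOne_mul
  set β := betaOne γ with hβdef
  set p := m.ξ t with hp
  have hp0 : m.physPos t 0 = p := physPos_zero m t
  have hmem := Ico_mem_nhds ht.1 ht.2
  set ξ' := derivWithin m.ξ (Ico (-ε) T) t with hξ'
  set n' := derivWithin m.n (Ico (-ε) T) t with hn'
  set κ' := derivWithin m.κ (Ico (-ε) T) t with hκ'
  have hξd : HasDerivAt m.ξ ξ' t :=
    ((H.modu.smooth_ξ.differentiableOn (by norm_num) t ht').hasDerivWithinAt).hasDerivAt hmem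
  have hnd : HasDerivAt m.n n' t :=
    ((H.modu.smooth_n.differentiableOn (by norm_num) t ht').hasDerivWithinAt).hasDerivAt hmem
  have hκd : HasDerivAt m.κ κ' t :=
    ((H.modu.smooth_κ.differentiableOn (by norm_num) t ht').hasDerivWithinAt).hasDerivAt hmem
  have hfront0 : ∀ r, m.frontD r 0 = 0 := fun r => (m.frontDL r).map_zero
  -- the constraint `W = 0`, differentiated in time
  have hfrd : HasDerivAt (fun r => m.fr 0 r 0)
      (fderiv ℝ (frame 0) (m.n t, 0) (n', 0)) t := by
    have hq : HasDerivAt (fun r => (m.n r, (0 : Fin 2 → ℝ))) (n', 0) t :=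
      hnd.prodMk (hasDerivAt_const t _)
    have hf := ((contDiffAt_frame (q := (m.n t, 0)) hn 0).differentiableAt (by norm_num)).hasFDerivAt
    refine (hf.comp_hasDerivAt (f := fun r => (m.n r, (0 : Fin 2 → ℝ))) t hq).congr_of_eventuallyEq
      (Eventually.of_forall fun r => ?_)
    simp [Modulation.fr, hfront0]
  have hud : DifferentiableAt ℝ (fun q : ℝ × E3 => fl.u q.1 q.2) (t, p) :=
    (H.contDiffAt_u ht p).differentiableAt (by norm_num)
  have hσd : DifferentiableAt ℝ (fun q : ℝ × E3 => fl.sigma γ q.1 q.2) (t, p) :=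
    (H.contDiffAt_sigma ht p).differentiableAt (by norm_num)
  have hu1 := hasDerivAt_path hud hp.symm hξd
  have hσ1 := hasDerivAt_path (F := fl.sigma γ) hσd hp.symm hξd
  have hwd := (hu1.inner ℝ hfrd).add hσ1
  have heq : m.κ =ᶠ[𝓝 t] fun r => inner ℝ (fl.u r (m.ξ r)) (m.fr 0 r 0)
      + fl.sigma γ r (m.ξ r) := by
    filter_upwards [hmem] with r hr
    rw [← H.w_zero hr, w_eq]
    simp only [Modulation.vel, physPos_zero]
  have hκeq := (hκd.congr_of_eventuallyEq heq.symm).unique hwd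
  -- split the convective derivatives into particle derivatives and relative transport
  set v : E3 := ξ' - (2 * β) • fl.u t p with hv
  have hsplit : ((1 : ℝ), ξ') = (1, (2 * β) • fl.u t p) + (0, v) := by
    ext <;> simp [hv]
  set e := m.fr 0 t 0 with he
  set Du := fderiv ℝ (fl.u t) p with hDu
  set Dσ := fderiv ℝ (fl.sigma γ t) p with hDσ
  rw [hsplit, map_add, map_add, ← fderiv_slice hud, ← fderiv_slice hσd, inner_add_left,
    H.inner_momentum ht, H.sigma_joint ht, ← hβdef, ← hp] at hκeq
  have htr := sum_inner_frame (q := (m.n t, m.frontD t 0)) hn.le Du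
  change inner ℝ (Du e) e + inner ℝ (Du (m.fr 1 t 0)) (m.fr 1 t 0)
    + inner ℝ (Du (m.fr 2 t 0)) (m.fr 2 t 0) = _ at htr
  rw [← htr] at hκeq
  have hvc : v = inner ℝ v e • e + inner ℝ v (m.fr 1 t 0) • m.fr 1 t 0
      + inner ℝ v (m.fr 2 t 0) • m.fr 2 t 0 :=
    frame_complete (q := (m.n t, m.frontD t 0)) hn.le v
  have hpw : ∀ i, inner ℝ (Du (m.fr i t 0)) e + Dσ (m.fr i t 0) =
      pd i (m.w γ fl t) 0 - inner ℝ (fl.u t p) (m.frD 0 t 0 (bv i)) := by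
    intro i
    have e1 := pd_vel m fl 0 i hn (H.symm ht') (H.differentiable_u ht') 0
    have e2 := pd_comp_physPos m i (H.symm ht') (H.differentiable_sigma ht') 0
    rw [w_eq, pd, fderiv_fun_add (H.differentiable_vel ht' hn 0 0)
      (H.differentiable_sigma_pos ht' 0)]
    rw [pd] at e1 e2
    rw [add_apply, e1, e2, posD_zero, hp0]
    ring
  have hpw0 := hpw 0
  have hpw1 := hpw 1
  have hpw2 := hpw 2
  rw [H.pd_w_zero_zero ht' hn, frD_bv_zero, inner_zero_right, sub_zero] at hpw0
  rw [show (1 : Fin 3) = (0 : Fin 2).succ from rfl, H.pd_w_succ_zero ht' hn] at hpw1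
  rw [show (2 : Fin 3) = (1 : Fin 2).succ from rfl, H.pd_w_succ_zero ht' hn] at hpw2
  simp only [Fin.succ_zero_eq_one, Fin.succ_one_eq_two, zero_sub] at hpw1 hpw2
  have htrans : inner ℝ (Du v) e + Dσ v = inner ℝ v e * (-(m.τ t - t)⁻¹)
      - inner ℝ v (m.fr 1 t 0) * inner ℝ (fl.u t p) (m.frD 0 t 0 (bv 1))
      - inner ℝ v (m.fr 2 t 0) * inner ℝ (fl.u t p) (m.frD 0 t 0 (bv 2)) := by
    conv_lhs => rw [hvc]
    simp only [map_add, map_smul, inner_add_left, inner_smul_left, conj_trivial, smul_eq_mul]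
    linear_combination inner ℝ v e * hpw0 + inner ℝ v (m.fr 1 t 0) * hpw1
      + inner ℝ v (m.fr 2 t 0) * hpw2
  -- the remainder
  set s := fl.sigma γ t p with hs
  set Rem := - inner ℝ v (m.fr 1 t 0) * inner ℝ (fl.u t p) (m.frD 0 t 0 (bv 1))
      - inner ℝ v (m.fr 2 t 0) * inner ℝ (fl.u t p) (m.frD 0 t 0 (bv 2))
      + 2 * β * (alphaC γ * s ^ 2 / (2 * γ) * fderiv ℝ (fl.k t) p e)
      - 2 * β * (alphaC γ * s * (inner ℝ (Du (m.fr 1 t 0)) (m.fr 1 t 0)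
        + inner ℝ (Du (m.fr 2 t 0)) (m.fr 2 t 0)))
      + inner ℝ (fl.u t p) (fderiv ℝ (frame 0) (m.n t, 0) (n', 0)) with hRem
  have hfinal : κ' = inner ℝ v e * (-(m.τ t - t)⁻¹) + 2 * β * alphaC γ * s * (m.τ t - t)⁻¹
      - 2 * β * a * inner ℝ (fl.u t p) e + Rem := by
    rw [hκeq, hRem]
    have hpw0' : inner ℝ (Du e) e + Dσ e = -(m.τ t - t)⁻¹ := hpw0
    linear_combination htrans - 2 * β * alphaC γ * s * hpw0'
  have e0 : ∀ j, ‖m.fr j t 0‖ = 1 := frame_norm (q := (m.n t, m.frontD t 0)) hn.le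
  have hvn : ‖v‖ ≤ V := by
    refine (norm_sub_le _ _).trans ?_
    rw [norm_smul, Real.norm_eq_abs, abs_of_pos (by positivity), hV]
    have b1 := H.boot.modulation.dξ t ht'
    have b2 := S.u_le p
    have b3 : 2 * β * ‖fl.u t p‖ ≤ 2 * (2 * κ₀) := by
      have : 2 * β ≤ 2 := by linarith
      exact mul_le_mul this b2 (norm_nonneg _) (by norm_num)
    linarith
  have hvj : ∀ j, |inner ℝ v (m.fr j t 0)| ≤ V := fun j => by
    refine (abs_real_inner_le_norm _ _).trans ?_
    rw [e0, mul_one]; exact hvn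
  have hfrj : ∀ i, |inner ℝ (fl.u t p) (m.frD 0 t 0 (bv i))| ≤ 2 * κ₀ * C₁ := by
    intro i
    refine (abs_real_inner_le_norm _ _).trans ?_
    have b1 := F.frD_le 0 (by simp) (by simp) 0 i
    have b2 := S.u_le p
    calc _ ≤ 2 * κ₀ * (C₁ * ε) := mul_le_mul b2 b1 (norm_nonneg _) (by positivity)
      _ ≤ 2 * κ₀ * (C₁ * 1) := by gcongr
      _ = _ := by ring
  have hspos : 0 < s := H.sigma_pos ht' p
  have hs2 : s ≤ 2 * κ₀ := S.sigma_le p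
  have hRemb : |Rem| ≤ R := by
    have r1 : |inner ℝ v (m.fr 1 t 0) * inner ℝ (fl.u t p) (m.frD 0 t 0 (bv 1))|
        ≤ V * (2 * κ₀ * C₁) := by
      rw [abs_mul]; exact mul_le_mul (hvj 1) (hfrj 1) (abs_nonneg _) hVp.le
    have r2 : |inner ℝ v (m.fr 2 t 0) * inner ℝ (fl.u t p) (m.frD 0 t 0 (bv 2))|
        ≤ V * (2 * κ₀ * C₁) := by
      rw [abs_mul]; exact mul_le_mul (hvj 2) (hfrj 2) (abs_nonneg _) hVp.le
    have r3 : |2 * β * (alphaC γ * s ^ 2 / (2 * γ) * fderiv ℝ (fl.k t) p e)| ≤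
        2 * (alphaC γ * (2 * κ₀) ^ 2 * C₃) := by
      have k1 := D.k_le 0
      rw [hp0] at k1
      have k2 : |fderiv ℝ (fl.k t) p e| ≤ C₃ := k1.trans (mul_le_of_le_one_right hC₃.le he8)
      have k3 : alphaC γ * s ^ 2 / (2 * γ) ≤ alphaC γ * (2 * κ₀) ^ 2 := by
        refine (div_le_self (by positivity) (by linarith)).trans ?_
        gcongr
      exact abs_two_mul_mul_le hβ hβ1 (by positivity) k3 k2
    have r4 : |2 * β * (alphaC γ * s * (inner ℝ (Du (m.fr 1 t 0)) (m.fr 1 t 0)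
        + inner ℝ (Du (m.fr 2 t 0)) (m.fr 2 t 0)))| ≤ 2 * (alphaC γ * (2 * κ₀) * (2 * C₃)) := by
      have k1 := D.u_tt 0 0
      have k2 := D.u_tt 1 1
      rw [hp0] at k1 k2
      simp only [Fin.succ_zero_eq_one, Fin.succ_one_eq_two] at k1 k2
      have k6 : C₃ * ε ^ (1 / 2 : ℝ) ≤ C₃ := mul_le_of_le_one_right hC₃.le hhalf
      have k2 := (abs_add_le _ _).trans (add_le_add (k1.trans k6) (k2.trans k6))
      have k3 : alphaC γ * s ≤ alphaC γ * (2 * κ₀) := by gcongr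
      exact abs_two_mul_mul_le hβ hβ1 (by positivity) k3 (k2.trans_eq (by ring))
    have r5 : |inner ℝ (fl.u t p) (fderiv ℝ (frame 0) (m.n t, 0) (n', 0))| ≤
        2 * κ₀ * (K * M ^ 2) := by
      refine (abs_real_inner_le_norm _ _).trans ?_
      have k1 : ‖(m.n t, (0 : Fin 2 → ℝ))‖ ≤ 1 / 2 :=
        norm_prod_le_iff.mpr ⟨F.n_le, by simp⟩
      have k2 := (hKb _ k1 0).2.1
      have k3 : ‖(n', (0 : Fin 2 → ℝ))‖ ≤ M ^ 2 := by
        refine norm_prod_le_iff.mpr ⟨?_, by simp; positivity⟩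
        exact (H.boot.modulation.dn t ht').trans
          (mul_le_of_le_one_right (by positivity) hhalf)
      refine mul_le_mul (S.u_le p) ?_ (norm_nonneg _) (by positivity)
      exact (ContinuousLinearMap.le_opNorm _ _).trans (mul_le_mul k2 k3 (norm_nonneg _) hK.le)
    rw [hRem, hR]
    rw [abs_le] at r1 r2 r3 r4 r5 ⊢
    constructor <;> linarith
  -- `u · e` and `σ` at the origin in terms of `κ` and `z`
  have hz := H.z_bound ht' h0box
  set z := m.z γ fl t 0 with hzdef
  have hw1 : inner ℝ (fl.u t p) e + s = m.κ t := by
    have := H.w_zero ht'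
    rw [w_eq] at this
    simpa only [Modulation.vel, hp0] using this
  have hz1 : inner ℝ (fl.u t p) e - s = z := by
    rw [hzdef, z_eq]
    simp only [Modulation.vel, hp0]
    rfl
  have hve : inner ℝ v e = inner ℝ ξ' e - 2 * β * inner ℝ (fl.u t p) e := by
    rw [hv, inner_sub_left, inner_smul_left]; rfl
  have hx := H.modu.lt_τ t ht'
  have hxp : 0 < m.τ t - t := by linarith
  rw [hve] at hfinal
  have hκb := H.boot.modulation.dκ t ht'
  have hκs := H.abs_kappa_sub_le ht'
  rw [← hκ', ← hβdef] at hκb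
  rw [← hβdef] at hκs
  have hxle := H.tau_sub_le ht'
  have hc := front_speed_solve hxp.ne' hβα hw1 hz1 hfinal
  rw [hc]
  exact front_speed_le hε hε1 hM.le hRp.le hβ hβ1 hβα hxp hxle hz hRemb hκb hκs hb

/-! ### Particle paths in the moving coordinates -/

theorem act_transpose_apply (n : E2) (v : E3) (i : Fin 3) :
    act (rot n)ᵀ v i = inner ℝ v (frame i (n, 0)) := by
  rw [frame, slopeFrame_zero, ← inner_act_transpose, inner3]
  fin_cases i <;> simp

theorem invPos_succ (m : Modulation) (t : ℝ) (p : E3) (μ : Fin 2) :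
    m.invPos t p μ.succ = inner ℝ (p - m.ξ t) (frame μ.succ (m.n t, 0)) := by
  rw [← act_transpose_apply, Modulation.invPos]
  simp

theorem front_invPos (m : Modulation) (t : ℝ) (p : E3) :
    m.front t (m.invPos t p) = m.front t (act (rot (m.n t))ᵀ (p - m.ξ t)) := by
  rw [Modulation.invPos, front_sub_smul]

theorem invPos_zero (m : Modulation) (t : ℝ) (p : E3) :
    m.invPos t p 0 = inner ℝ (p - m.ξ t) (frame 0 (m.n t, 0)) -
      m.front t (m.invPos t p) := by
  rw [← act_transpose_apply, front_invPos, Modulation.invPos]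
  simp

section Slope

variable {p₀ p₁ q₀ q₁ y₁ y₂ : ℝ → ℝ} {p₀' p₁' q₀' q₁' y₁' y₂' P P' Y V t : ℝ}

/-- The slope `φ y` of the front at a moving point `y`. -/
theorem hasDerivAt_slope_bound (h0 : HasDerivAt p₀ p₀' t) (h1 : HasDerivAt p₁ p₁' t)
    (hy1 : HasDerivAt y₁ y₁' t) (hy2 : HasDerivAt y₂ y₂' t) (b0 : |p₀ t| ≤ P) (b1 : |p₁ t| ≤ P)
    (b0' : |p₀'| ≤ P') (b1' : |p₁'| ≤ P') (c1 : |y₁ t| ≤ Y) (c2 : |y₂ t| ≤ Y)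
    (c1' : |y₁'| ≤ V) (c2' : |y₂'| ≤ V) :
    ∃ g', HasDerivAt (fun r => p₀ r * y₁ r + p₁ r * y₂ r) g' t ∧ |g'| ≤ 2 * (P' * Y + P * V) := by
  refine ⟨_, (h0.mul hy1).add (h1.mul hy2), ?_⟩
  have hP := (abs_nonneg _).trans b0
  have hP' := (abs_nonneg _).trans b0'
  have e1 : |p₀' * y₁ t| ≤ P' * Y := by rw [abs_mul]; gcongr
  have e2 : |p₁' * y₂ t| ≤ P' * Y := by rw [abs_mul]; gcongr
  have e3 : |p₀ t * y₁'| ≤ P * V := by rw [abs_mul]; gcongr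
  have e4 : |p₁ t * y₂'| ≤ P * V := by rw [abs_mul]; gcongr
  rw [abs_le] at *
  constructor <;> linarith

/-- The height `½ y · φ y` of the front at a moving point `y`. -/
theorem hasDerivAt_quadratic_bound (h0 : HasDerivAt p₀ p₀' t) (h1 : HasDerivAt p₁ p₁' t)
    (k0 : HasDerivAt q₀ q₀' t) (k1 : HasDerivAt q₁ q₁' t)
    (hy1 : HasDerivAt y₁ y₁' t) (hy2 : HasDerivAt y₂ y₂' t) (b0 : |p₀ t| ≤ P) (b1 : |p₁ t| ≤ P)
    (d0 : |q₀ t| ≤ P) (d1 : |q₁ t| ≤ P) (b0' : |p₀'| ≤ P') (b1' : |p₁'| ≤ P')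
    (d0' : |q₀'| ≤ P') (d1' : |q₁'| ≤ P') (c1 : |y₁ t| ≤ Y) (c2 : |y₂ t| ≤ Y)
    (c1' : |y₁'| ≤ V) (c2' : |y₂'| ≤ V) :
    ∃ f', HasDerivAt (fun r => 1 / 2 * (p₀ r * y₁ r * y₁ r + p₁ r * y₁ r * y₂ r +
      (q₀ r * y₂ r * y₁ r + q₁ r * y₂ r * y₂ r))) f' t ∧
        |f'| ≤ 2 * (P' * Y + P * V) * Y + 2 * P * Y * V := by
  obtain ⟨g, hg, hgb⟩ := hasDerivAt_slope_bound h0 h1 hy1 hy2 b0 b1 b0' b1' c1 c2 c1' c2'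
  obtain ⟨k, hk, hkb⟩ := hasDerivAt_slope_bound k0 k1 hy1 hy2 d0 d1 d0' d1' c1 c2 c1' c2'
  have hP := (abs_nonneg _).trans b0
  have hP' := (abs_nonneg _).trans b0'
  have hY := (abs_nonneg _).trans c1
  have hV := (abs_nonneg _).trans c1'
  -- the second factors `y` of the quadratic form are grouped as `y₁ (p·y) + y₂ (q·y)`
  have hd := (((hy1.mul hg).add (hy2.mul hk)).const_mul (1 / 2))
  refine ⟨_, (hd.congr_of_eventuallyEq (Eventually.of_forall fun r => by simp; ring)), ?_⟩
  have s1 : |p₀ t * y₁ t + p₁ t * y₂ t| ≤ 2 * P * Y := by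
    have e1 : |p₀ t * y₁ t| ≤ P * Y := by rw [abs_mul]; gcongr
    have e2 : |p₁ t * y₂ t| ≤ P * Y := by rw [abs_mul]; gcongr
    refine (abs_add_le _ _).trans (by linarith)
  have s2 : |q₀ t * y₁ t + q₁ t * y₂ t| ≤ 2 * P * Y := by
    have e1 : |q₀ t * y₁ t| ≤ P * Y := by rw [abs_mul]; gcongr
    have e2 : |q₁ t * y₂ t| ≤ P * Y := by rw [abs_mul]; gcongr
    refine (abs_add_le _ _).trans (by linarith)
  have e1 : |y₁' * (p₀ t * y₁ t + p₁ t * y₂ t)| ≤ V * (2 * P * Y) := by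
    rw [abs_mul]; gcongr
  have e2 : |y₂' * (q₀ t * y₁ t + q₁ t * y₂ t)| ≤ V * (2 * P * Y) := by
    rw [abs_mul]; gcongr
  have e3 : |y₁ t * g| ≤ Y * (2 * (P' * Y + P * V)) := by rw [abs_mul]; gcongr
  have e4 : |y₂ t * k| ≤ Y * (2 * (P' * Y + P * V)) := by rw [abs_mul]; gcongr
  rw [abs_le] at e1 e2 e3 e4 ⊢
  constructor <;> linarith

end Slope

/-- Motion of a fluid particle in the moving coordinates at time `t`: the frame along the path has
bounded derivative, and the speed in the `x₁` direction is known to leading order. -/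
structure PathFacts (γ C ε T : ℝ) (m : Modulation) (t : ℝ) (c : ℝ → E3) : Prop where
  frame_deriv : ∀ j, ∃ F', HasDerivAt (fun r => m.fr j r (m.invPos r (c r))) F' t ∧ ‖F'‖ ≤ C
  normal_deriv : ∃ v, HasDerivAt (fun r => m.invPos r (c r) 0) v t ∧
    |v - (betaOne γ * m.κ t - inner ℝ (derivWithin m.ξ (Ico (-ε) T) t) (m.fr 0 t 0))|
      ≤ C * ε ^ (1 / 6 : ℝ)

/-- The coordinates of a particle relative to the moving frame change by its own velocity `2 β₁ u`, by
the motion of the origin, and by the rotation; since `u · N` is close to `κ / 2`, the leading part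
of the speed in the direction `x₁` is `β₁ κ - ξ' · e`. -/
theorem exists_pathFacts {γ κ₀ M B : ℝ} (hγ : 1 < γ) (hκ₀ : 1 < κ₀) (hM : 1 < M) (hB : 0 < B) :
    ∃ C, 0 < C ∧ ∀ᶠ ε in 𝓝[>] (0 : ℝ),
    ∀ (a T l L : ℝ) (fl : Fluid) (m : Modulation), Setup γ κ₀ M ε a T l L fl m →
      ∀ t ∈ Ioo (-ε) T, ∀ c : ℝ → E3, HasDerivAt c ((2 * betaOne γ) • fl.u t (c t)) t →
        ‖c t - m.ξ t‖ ≤ B * ε ^ (1 / 6 : ℝ) → PathFacts γ C ε T m t c := by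
  obtain ⟨K, hK, hKb⟩ := exists_frame_bound
  obtain ⟨C₁, hC₁, h1⟩ := exists_frameFacts hM
  obtain ⟨C₂, hC₂, h2⟩ := exists_stateFacts hγ hκ₀ hM
  -- `V` bounds the velocities of the coordinates, `G` that of the slope
  obtain ⟨V, hV⟩ : ∃ V, V = M ^ (1 / 4 : ℝ) + 2 * (2 * κ₀) + K * M ^ 2 := ⟨_, rfl⟩
  obtain ⟨G, hG⟩ : ∃ G, G = 2 * (M ^ 2 * B + M ^ 2 * V) := ⟨_, rfl⟩
  have hVp : 0 < V := by rw [hV]; positivity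
  have hGp : 0 < G := by rw [hG]; positivity
  refine ⟨K * (M ^ 2 + G) + (2 * C₂ + B * (K * M ^ 2) + (G * B + 2 * M ^ 2 * B * V)),
    by positivity, ?_⟩
  filter_upwards [eventually_pos, eventually_le_const one_pos, h1, h2,
    eventually_mul_rpow_le B (show (0:ℝ) < 1 / 6 by norm_num) one_pos]
    with ε hε hε1 h1 h2 hBε a T l L fl m H t ht c hc hd
  have ht' := Ioo_subset_Ico_self ht
  have F := h1 γ κ₀ a T l L fl m H t ht'
  have S := h2 a T l L fl m H t ht'
  have hβ := H.betaOne_pos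
  have hβ1 := H.betaOne_lt_one
  have hn : ‖m.n t‖ < 1 := F.n_le.trans_lt (by norm_num)
  have hmem := Ico_mem_nhds ht.1 ht.2
  have hhalf : ε ^ (1 / 2 : ℝ) ≤ 1 := Real.rpow_le_one hε.le hε1 (by norm_num)
  have hsix : ε ^ (1 / 6 : ℝ) ≤ 1 := Real.rpow_le_one hε.le hε1 (by norm_num)
  have hsixp : 0 < ε ^ (1 / 6 : ℝ) := by positivity
  have hε6 : ε ≤ ε ^ (1 / 6 : ℝ) := by
    simpa using Real.rpow_le_rpow_of_exponent_ge hε hε1 (show (1 / 6 : ℝ) ≤ 1 by norm_num)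
  have hd1 : ‖c t - m.ξ t‖ ≤ 1 := hd.trans hBε
  have hdB : ‖c t - m.ξ t‖ ≤ B := hd.trans (mul_le_of_le_one_right hB.le hsix)
  obtain ⟨ξ', hξ'⟩ : ∃ ξ', ξ' = derivWithin m.ξ (Ico (-ε) T) t := ⟨_, rfl⟩
  obtain ⟨n', hn'⟩ : ∃ n', n' = derivWithin m.n (Ico (-ε) T) t := ⟨_, rfl⟩
  have hξd : HasDerivAt m.ξ ξ' t := by
    rw [hξ']
    exact ((H.modu.smooth_ξ.differentiableOn (by norm_num) t ht').hasDerivWithinAt).hasDerivAt hmem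
  have hnd : HasDerivAt m.n n' t := by
    rw [hn']
    exact ((H.modu.smooth_n.differentiableOn (by norm_num) t ht').hasDerivWithinAt).hasDerivAt hmem
  have hφd : ∀ μ ν, HasDerivAt (fun r => m.φ r μ ν)
      (derivWithin (fun r => m.φ r μ ν) (Ico (-ε) T) t) t := fun μ ν =>
    ((H.modu.smooth_φ μ ν |>.differentiableOn (by norm_num) t ht').hasDerivWithinAt).hasDerivAt hmem
  have hφb := H.boot.modulation.φ_le t ht'
  have hφb' := H.boot.modulation.dφ t ht'
  have hn'b : ‖n'‖ ≤ M ^ 2 := by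
    rw [hn']
    exact (H.boot.modulation.dn t ht').trans (mul_le_of_le_one_right (by positivity) hhalf)
  -- the unrotated coordinates `y i` of the particle
  obtain ⟨y, hy⟩ : ∃ y : Fin 3 → ℝ → ℝ,
      y = fun i r => inner ℝ (c r - m.ξ r) (frame i (m.n r, 0)) := ⟨_, rfl⟩
  obtain ⟨e, he⟩ : ∃ e : Fin 3 → E3, e = fun i => fderiv ℝ (frame i) (m.n t, 0) (n', 0) := ⟨_, rfl⟩
  have heb : ∀ i, ‖e i‖ ≤ K * M ^ 2 := by
    intro i
    have k1 : ‖(m.n t, (0 : Fin 2 → ℝ))‖ ≤ 1 / 2 := norm_prod_le_iff.mpr ⟨F.n_le, by simp⟩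
    have k3 : ‖(n', (0 : Fin 2 → ℝ))‖ ≤ M ^ 2 :=
      norm_prod_le_iff.mpr ⟨hn'b, by simp; positivity⟩
    rw [he]
    exact (ContinuousLinearMap.le_opNorm _ _).trans
      (mul_le_mul (hKb _ k1 i).2.1 k3 (norm_nonneg _) hK.le)
  have hfrn : ∀ i, ‖frame i (m.n t, 0)‖ = 1 := frame_norm (q := (m.n t, 0)) hn.le
  have hyd : ∀ i, HasDerivAt (y i) (inner ℝ ((2 * betaOne γ) • fl.u t (c t) - ξ')
      (frame i (m.n t, 0)) + inner ℝ (c t - m.ξ t) (e i)) t := by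
    intro i
    have hq : HasDerivAt (fun r => (m.n r, (0 : Fin 2 → ℝ))) (n', 0) t :=
      hnd.prodMk (hasDerivAt_const t _)
    have hf := ((contDiffAt_frame (q := (m.n t, 0)) hn i).differentiableAt
      (by norm_num)).hasFDerivAt
    have hfd : HasDerivAt (fun r => frame i (m.n r, 0)) (e i) t := by
      rw [he]
      exact hf.comp_hasDerivAt (f := fun r => (m.n r, (0 : Fin 2 → ℝ))) t hq
    rw [hy, add_comm]
    exact (hc.sub hξd).inner ℝ hfd
  have hyb : ∀ i, |y i t| ≤ B * ε ^ (1 / 6 : ℝ) := by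
    intro i
    rw [hy]
    refine (abs_real_inner_le_norm _ _).trans ?_
    rw [hfrn, mul_one]; exact hd
  have hrem : ∀ i, |inner ℝ (c t - m.ξ t) (e i)| ≤ B * ε ^ (1 / 6 : ℝ) * (K * M ^ 2) := fun i =>
    (abs_real_inner_le_norm _ _).trans (mul_le_mul hd (heb i) (norm_nonneg _) (by positivity))
  have hyb' : ∀ i, |inner ℝ ((2 * betaOne γ) • fl.u t (c t) - ξ') (frame i (m.n t, 0)) +
      inner ℝ (c t - m.ξ t) (e i)| ≤ V := by
    intro i
    have v1 : ‖(2 * betaOne γ) • fl.u t (c t) - ξ'‖ ≤ 2 * (2 * κ₀) + M ^ (1 / 4 : ℝ) := by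
      refine (norm_sub_le _ _).trans (add_le_add ?_ ?_)
      · rw [norm_smul, Real.norm_eq_abs, abs_of_pos (by positivity)]
        exact mul_le_mul (by linarith) (S.u_le _) (norm_nonneg _) (by norm_num)
      · rw [hξ']; exact H.boot.modulation.dξ t ht'
    have v2 := abs_real_inner_le_norm ((2 * betaOne γ) • fl.u t (c t) - ξ') (frame i (m.n t, 0))
    rw [hfrn, mul_one] at v2
    have v3 : B * ε ^ (1 / 6 : ℝ) * (K * M ^ 2) ≤ K * M ^ 2 :=
      mul_le_of_le_one_left (by positivity) hBε
    refine (abs_add_le _ _).trans ?_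
    rw [hV]
    linarith [hrem i]
  have hslope : ∀ μ, ∃ g', HasDerivAt (fun r => m.frontD r (m.invPos r (c r)) μ) g' t ∧
      |g'| ≤ 2 * (M ^ 2 * (B * ε ^ (1 / 6 : ℝ)) + M ^ 2 * ε * V) := by
    intro μ
    obtain ⟨g', hg', hgb⟩ := hasDerivAt_slope_bound (hφd μ 0) (hφd μ 1) (hyd 1) (hyd 2) (hφb μ 0)
      (hφb μ 1) (hφb' μ 0) (hφb' μ 1) (hyb 1) (hyb 2) (hyb' 1) (hyb' 2)
    refine ⟨g', hg'.congr_of_eventuallyEq (Eventually.of_forall fun r => ?_), hgb⟩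
    have i1 := invPos_succ m r (c r) 0
    have i2 := invPos_succ m r (c r) 1
    simp only [Fin.succ_zero_eq_one, Fin.succ_one_eq_two] at i1 i2
    beta_reduce
    rw [frontD_eq, i1, i2, hy]
  obtain ⟨f', hf', hfb⟩ := hasDerivAt_quadratic_bound (hφd 0 0) (hφd 0 1) (hφd 1 0) (hφd 1 1)
    (hyd 1) (hyd 2) (hφb 0 0) (hφb 0 1) (hφb 1 0) (hφb 1 1) (hφb' 0 0) (hφb' 0 1) (hφb' 1 0)
    (hφb' 1 1) (hyb 1) (hyb 2) (hyb' 1) (hyb' 2)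
  have hfront : HasDerivAt (fun r => m.front r (m.invPos r (c r))) f' t := by
    refine hf'.congr_of_eventuallyEq (Eventually.of_forall fun r => ?_)
    have i1 := invPos_succ m r (c r) 0
    have i2 := invPos_succ m r (c r) 1
    simp only [Fin.succ_zero_eq_one, Fin.succ_one_eq_two] at i1 i2
    beta_reduce
    rw [front_eq, i1, i2, hy]
  have hGb : 2 * (M ^ 2 * (B * ε ^ (1 / 6 : ℝ)) + M ^ 2 * ε * V) ≤ G := by
    rw [hG]
    have g1 : M ^ 2 * (B * ε ^ (1 / 6 : ℝ)) ≤ M ^ 2 * B := by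
      have := mul_le_of_le_one_right hB.le hsix
      gcongr
    have g2 : M ^ 2 * ε * V ≤ M ^ 2 * V := by
      have := mul_le_of_le_one_right (sq_nonneg M) hε1
      gcongr
    linarith
  constructor
  · intro j
    choose g' hg' hgb using hslope
    have hqd : HasDerivAt (fun r => (m.n r, m.frontD r (m.invPos r (c r)))) (n', g') t :=
      hnd.prodMk (hasDerivAt_pi.mpr hg')
    have i1 := hyb 1
    have i2 := hyb 2
    have j1 := invPos_succ m t (c t) 0
    have j2 := invPos_succ m t (c t) 1
    simp only [Fin.succ_zero_eq_one, Fin.succ_one_eq_two] at j1 j2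
    simp only [hy, ← j1, ← j2] at i1 i2
    have hq := F.q_le (m.invPos t (c t)) (i1.trans hBε) (i2.trans hBε)
    obtain ⟨f1, f2, -⟩ := hKb _ hq j
    refine ⟨_, f1.hasFDerivAt.comp_hasDerivAt
      (f := fun r => (m.n r, m.frontD r (m.invPos r (c r)))) t hqd, ?_⟩
    have hqn : ‖(n', g')‖ ≤ M ^ 2 + G := by
      refine norm_prod_le_iff.mpr ⟨by simp only; linarith, ?_⟩
      refine (pi_norm_le_iff_of_nonneg (by positivity)).mpr fun μ => ?_
      have := (hgb μ).trans hGb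
      rw [Real.norm_eq_abs]
      nlinarith [sq_nonneg M]
    refine (ContinuousLinearMap.le_opNorm _ _).trans
      ((mul_le_mul f2 hqn (norm_nonneg _) hK.le).trans ?_)
    have : 0 ≤ 2 * C₂ + B * (K * M ^ 2) + (G * B + 2 * M ^ 2 * B * V) := by positivity
    linarith
  · have hx0 : HasDerivAt (fun r => m.invPos r (c r) 0) _ t :=
      ((hyd 0).sub hfront).congr_of_eventuallyEq (Eventually.of_forall fun r => by
        change m.invPos r (c r) 0 = y 0 r - m.front r (m.invPos r (c r))
        rw [invPos_zero, hy])
    refine ⟨_, hx0, ?_⟩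
    have hfr0 : m.fr 0 t 0 = frame 0 (m.n t, 0) := by
      have : m.frontD t 0 = 0 := (m.frontDL t).map_zero
      rw [Modulation.fr, this]
    have hu := S.u_dir (c t)
    rw [hfr0] at hu ⊢
    rw [← hξ', inner_sub_left, inner_smul_left, conj_trivial]
    have u1 : |2 * betaOne γ * (inner ℝ (fl.u t (c t)) (frame 0 (m.n t, 0)) - m.κ t / 2)| ≤
        2 * C₂ * ε ^ (1 / 6 : ℝ) := by
      rw [abs_mul, abs_of_pos (by positivity : 0 < 2 * betaOne γ), mul_assoc 2 C₂]
      exact mul_le_mul (by linarith) hu (abs_nonneg _) (by norm_num)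
    have u2 := hrem 0
    have u3 : |f'| ≤ (G * B + 2 * M ^ 2 * B * V) * ε ^ (1 / 6 : ℝ) := by
      refine hfb.trans ?_
      have g1 : 2 * (M ^ 2 * (B * ε ^ (1 / 6 : ℝ)) + M ^ 2 * ε * V) * (B * ε ^ (1 / 6 : ℝ)) ≤
        G * (B * ε ^ (1 / 6 : ℝ)) := by gcongr
      have g2 : 2 * (M ^ 2 * ε) * (B * ε ^ (1 / 6 : ℝ)) * V ≤
          2 * (M ^ 2 * 1) * (B * ε ^ (1 / 6 : ℝ)) * V := by gcongr
      linarith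
    have u4 : 0 ≤ K * (M ^ 2 + G) * ε ^ (1 / 6 : ℝ) := by positivity
    rw [abs_le] at u1 u2 u3 ⊢
    constructor <;> linarith

/-! ### A comparison principle with a transversal crossing -/

/-- A continuous function with nonnegative derivative, except possibly at one point, is monotone. -/
theorem le_of_deriv_nonneg_off_point {k k' : ℝ → ℝ} {s t p : ℝ} (hst : s ≤ t)
    (hc : ContinuousOn k (Icc s t))
    (hd : ∀ r ∈ Ioo s t, r ≠ p → HasDerivAt k (k' r) r ∧ 0 ≤ k' r) : k s ≤ k t := by
  have base : ∀ s' t', s ≤ s' → s' ≤ t' → t' ≤ t → (∀ r ∈ Ioo s' t', r ≠ p) → k s' ≤ k t' := by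
    intro s' t' h1 h2 h3 hp
    have hm : MonotoneOn k (Icc s' t') := by
      refine monotoneOn_of_deriv_nonneg (convex_Icc _ _) (hc.mono (Icc_subset_Icc h1 h3)) ?_ ?_ <;>
        rw [interior_Icc] <;> intro r hr <;>
        have := hd r ⟨h1.trans_lt hr.1, hr.2.trans_le h3⟩ (hp r hr)
      · exact this.1.differentiableAt.differentiableWithinAt
      · rw [this.1.deriv]; exact this.2
    exact hm (left_mem_Icc.mpr h2) (right_mem_Icc.mpr h2) h2
  by_cases hp : p ∈ Ioo s t
  · exact (base s p le_rfl hp.1.le hp.2.le fun r hr => hr.2.ne).trans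
      (base p t hp.1.le hp.2.le le_rfl fun r hr => hr.1.ne')
  · exact base s t le_rfl hst le_rfl fun r hr h => hp (h ▸ hr)

/-- The primitive `3 sign(x) |x|^{1/3}` of `|x|^{-2/3}`. -/
noncomputable def cubeRootPrim (x : ℝ) : ℝ :=
  if 0 ≤ x then 3 * x ^ (1 / 3 : ℝ) else -(3 * (-x) ^ (1 / 3 : ℝ))

theorem continuous_cubeRootPrim : Continuous cubeRootPrim := by
  unfold cubeRootPrim
  refine Continuous.if_le ?_ ?_ continuous_const continuous_id ?_
  · exact (Real.continuous_rpow_const (by norm_num)).const_mul 3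
  · exact (((Real.continuous_rpow_const (by norm_num)).comp continuous_neg).const_mul 3).neg
  · intro x hx
    have : x = 0 := hx.symm
    subst this
    norm_num

theorem hasDerivAt_cubeRootPrim {x : ℝ} (hx : x ≠ 0) :
    HasDerivAt cubeRootPrim (|x| ^ (-(2 / 3) : ℝ)) x := by
  rcases lt_or_gt_of_ne hx with h | h
  · have h1 : HasDerivAt (fun y : ℝ => -(3 * (-y) ^ (1 / 3 : ℝ))) (|x| ^ (-(2 / 3) : ℝ)) x := by
      have h2 := (((hasDerivAt_neg x).rpow_const (p := 1 / 3)
        (Or.inl (by linarith : -x ≠ 0))).const_mul 3).neg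
      refine HasDerivAt.congr_deriv h2 ?_
      rw [abs_of_neg h]; norm_num; ring
    refine h1.congr_of_eventuallyEq ?_
    filter_upwards [Iio_mem_nhds h] with y hy
    rw [cubeRootPrim, if_neg (not_le.mpr hy)]
  · have h1 : HasDerivAt (fun y : ℝ => 3 * y ^ (1 / 3 : ℝ)) (|x| ^ (-(2 / 3) : ℝ)) x := by
      have h2 := ((Real.hasDerivAt_rpow_const (x := x) (p := 1 / 3) (Or.inl hx)).const_mul 3)
      refine h2.congr_deriv ?_
      rw [abs_of_pos h]; norm_num; ring
    refine h1.congr_of_eventuallyEq ?_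
    filter_upwards [Ioi_mem_nhds h] with y hy
    rw [cubeRootPrim, if_pos hy.le]

theorem abs_cubeRootPrim (x : ℝ) : |cubeRootPrim x| = 3 * |x| ^ (1 / 3 : ℝ) := by
  unfold cubeRootPrim
  split_ifs with h
  · rw [abs_of_nonneg (by positivity), abs_of_nonneg h]
  · push Not at h
    have : 0 < -x := by linarith
    rw [abs_neg, abs_of_nonneg (by positivity), abs_of_neg h]

/-- If `x` decreases at rate at least `c` and `|h'| ≤ A + D |x|^{-2/3}` away from the zero of `x`,
then the increment of `h` is controlled although `|x|^{-2/3}` is unbounded: along `x` it is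
integrable in time. -/
theorem abs_sub_le_of_transversal {h h' x x' : ℝ → ℝ} {s t A D c X : ℝ} (hst : s ≤ t)
    (hD : 0 ≤ D) (hcp : 0 < c)
    (hh : ContinuousOn h (Icc s t)) (hx : ContinuousOn x (Icc s t))
    (hhd : ∀ r ∈ Ioo s t, HasDerivAt h (h' r) r) (hxd : ∀ r ∈ Ioo s t, HasDerivAt x (x' r) r)
    (hx' : ∀ r ∈ Ioo s t, x' r ≤ -c)
    (hb : ∀ r ∈ Ioo s t, x r ≠ 0 → |h' r| ≤ A + D * |x r| ^ (-(2 / 3) : ℝ))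
    (hX : ∀ r ∈ Icc s t, |x r| ≤ X) :
    |h t - h s| ≤ A * (t - s) + 6 * (D / c) * X ^ (1 / 3 : ℝ) := by
  have hanti : StrictAntiOn x (Icc s t) := by
    refine strictAntiOn_of_deriv_neg (convex_Icc _ _) hx fun r hr => ?_
    rw [interior_Icc] at hr
    rw [(hxd r hr).deriv]
    linarith [hx' r hr]
  -- `x` is strictly decreasing, so it vanishes at most once
  obtain ⟨p, hp⟩ : ∃ p, ∀ r ∈ Ioo s t, r ≠ p → x r ≠ 0 := by
    by_cases hz : ∃ p ∈ Ioo s t, x p = 0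
    · obtain ⟨p, hp, hp0⟩ := hz
      refine ⟨p, fun r hr hne h0 => hne ?_⟩
      exact hanti.injOn (Ioo_subset_Icc_self hr) (Ioo_subset_Icc_self hp) (h0.trans hp0.symm)
    · push Not at hz
      exact ⟨0, fun r hr _ => hz r hr⟩
  -- `A r - (D / c) · 3 sign(x) |x|^{1/3} ∓ h` is monotone in time
  have key : ∀ σ : ℝ, |σ| = 1 → σ * (h t - h s) ≤ A * (t - s) + 6 * (D / c) * X ^ (1 / 3 : ℝ) := by
    intro σ hσ
    have hc : ContinuousOn (fun r => A * r - D / c * cubeRootPrim (x r) - σ * h r) (Icc s t) :=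
      ((continuousOn_const.mul continuousOn_id).sub
        (continuousOn_const.mul (continuous_cubeRootPrim.comp_continuousOn hx))).sub
          (continuousOn_const.mul hh)
    have := le_of_deriv_nonneg_off_point (p := p)
      (k' := fun r => A * 1 - D / c * (|x r| ^ (-(2 / 3) : ℝ) * x' r) - σ * h' r) hst hc
      (fun r hr hne => ⟨(((hasDerivAt_id r).const_mul A).sub
        (((hasDerivAt_cubeRootPrim (hp r hr hne)).comp r (hxd r hr)).const_mul (D / c))).sub
          ((hhd r hr).const_mul σ), by
        have h1 := hb r hr (hp r hr hne)
        have h2 : σ * h' r ≤ |h' r| := by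
          refine (le_abs_self _).trans_eq ?_
          rw [abs_mul, hσ, one_mul]
        have h3 : 0 ≤ D / c * |x r| ^ (-(2 / 3) : ℝ) := by positivity
        have h4 : D / c * |x r| ^ (-(2 / 3) : ℝ) * x' r ≤ D / c * |x r| ^ (-(2 / 3) : ℝ) * -c :=
          mul_le_mul_of_nonneg_left (hx' r hr) h3
        have h5 : D / c * |x r| ^ (-(2 / 3) : ℝ) * -c = -(D * |x r| ^ (-(2 / 3) : ℝ)) := by
          field_simp
        linarith⟩)
    have b : ∀ r ∈ Icc s t, |D / c * cubeRootPrim (x r)| ≤ 3 * (D / c) * X ^ (1 / 3 : ℝ) := by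
      intro r hr
      rw [abs_mul, abs_cubeRootPrim, abs_of_nonneg (by positivity)]
      have := Real.rpow_le_rpow (abs_nonneg _) (hX r hr) (show (0:ℝ) ≤ 1 / 3 by norm_num)
      have h0 : 0 ≤ D / c := by positivity
      nlinarith
    have b1 := abs_le.mp (b s (left_mem_Icc.mpr hst))
    have b2 := abs_le.mp (b t (right_mem_Icc.mpr hst))
    linarith
  rw [abs_le]
  constructor
  · linarith [key (-1) (by norm_num)]
  · linarith [key 1 (by norm_num)]

/-! ### Continuity along particle paths -/

/-- The spatial derivative is continuous up to the initial time: it is a component of the derivative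
within the half-open time slab. -/
theorem continuousOn_fderiv_slice {G : Type*} [NormedAddCommGroup G] [NormedSpace ℝ G]
    {F : ℝ → E3 → G} {ε T : ℝ}
    (hF : ContDiffOn ℝ 4 (fun q : ℝ × E3 => F q.1 q.2) (Ico (-ε) T ×ˢ univ)) :
    ContinuousOn (fun q : ℝ × E3 => fderiv ℝ (F q.1) q.2) (Ico (-ε) T ×ˢ univ) := by
  have hud : UniqueDiffOn ℝ (Ico (-ε) T ×ˢ (univ : Set E3)) :=
    (uniqueDiffOn_Ico (-ε) T).prod uniqueDiffOn_univ
  have h1 := hF.continuousOn_fderivWithin hud (by norm_num)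
  have h2 : ContinuousOn (fun q : ℝ × E3 => (fderivWithin ℝ (fun q : ℝ × E3 => F q.1 q.2)
      (Ico (-ε) T ×ˢ univ) q).comp (ContinuousLinearMap.inr ℝ ℝ E3)) (Ico (-ε) T ×ˢ univ) :=
    ((ContinuousLinearMap.compL ℝ E3 (ℝ × E3) G).flip
      (ContinuousLinearMap.inr ℝ ℝ E3)).continuous.comp_continuousOn h1
  refine h2.congr fun q hq => ?_
  have hd := (hF.differentiableOn (by norm_num) q hq).hasFDerivWithinAt
  have h3 : HasFDerivWithinAt (fun x : E3 => (q.1, x)) (ContinuousLinearMap.inr ℝ ℝ E3) univ q.2 :=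
    (hasFDerivAt_prodMk_right q.1 q.2).hasFDerivWithinAt
  have h4 := HasFDerivWithinAt.comp (g := fun q : ℝ × E3 => F q.1 q.2)
    (f := fun x : E3 => (q.1, x)) (s := univ) (t := Ico (-ε) T ×ˢ univ) q.2 hd h3
    (fun x _ => ⟨hq.1, mem_univ _⟩)
  rw [hasFDerivWithinAt_univ] at h4
  exact h4.fderiv

namespace Setup

variable {γ κ₀ M ε a T l L : ℝ} {fl : Fluid} {m : Modulation}
  (H : Setup γ κ₀ M ε a T l L fl m) {t : ℝ} {c : ℝ → E3}
include H

theorem continuousOn_zeta : ContinuousOn (fun q : ℝ × E3 => fl.zeta q.1 q.2)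
    (Ico (-ε) T ×ˢ univ) := by
  have hρ := H.euler.smooth_rho.continuousOn
  have hD := continuousOn_fderiv_slice H.euler.smooth_u
  have hpd : ∀ i j, ContinuousOn (fun q : ℝ × E3 => fderiv ℝ (fl.u q.1) q.2 (bv i) j)
      (Ico (-ε) T ×ˢ univ) := fun i j =>
    (EuclideanSpace.proj (𝕜 := ℝ) j).continuous.comp_continuousOn
      (hD.clm_apply continuousOn_const)
  have hpd' : ∀ i j, ContinuousOn (fun q : ℝ × E3 => pd i (fun z => fl.u q.1 z j) q.2)
      (Ico (-ε) T ×ˢ univ) := fun i j =>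
    (hpd i j).congr fun q hq => by rw [pd_component (H.differentiable_u hq.1 q.2)]
  refine ContinuousOn.smul (continuousOn_const.div hρ fun q hq => (H.euler.pos _ hq.1 _).ne') ?_
  refine (PiLp.continuous_toLp 2 (fun _ : Fin 3 => ℝ)).comp_continuousOn ?_
  refine continuousOn_pi.mpr fun i => ?_
  fin_cases i
  · exact (hpd' 1 2).sub (hpd' 2 1)
  · exact (hpd' 2 0).sub (hpd' 0 2)
  · exact (hpd' 0 1).sub (hpd' 1 0)

theorem continuousOn_coordinate (ht : t ∈ Ico (-ε) T) (hn : ∀ r ∈ Icc (-ε) t, ‖m.n r‖ < 1)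
    (hc : ContinuousOn c (Icc (-ε) t)) (i : Fin 3) :
    ContinuousOn (fun r => act (rot (m.n r))ᵀ (c r - m.ξ r) i) (Icc (-ε) t) := by
  have hsub : Icc (-ε) t ⊆ Ico (-ε) T := fun r hr => ⟨hr.1, hr.2.trans_lt ht.2⟩
  have hnc := H.modu.smooth_n.continuousOn.mono hsub
  have hξc := H.modu.smooth_ξ.continuousOn.mono hsub
  have hf : ContinuousOn (fun r => frame i (m.n r, 0)) (Icc (-ε) t) := by
    intro r hr
    exact (contDiffAt_frame (q := (m.n r, 0)) (hn r hr) i).continuousAt.comp_continuousWithinAt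
      (f := fun r => (m.n r, (0 : Fin 2 → ℝ))) ((hnc r hr).prodMk continuousWithinAt_const)
  simp only [act_transpose_apply]
  exact (hc.sub hξc).inner hf

theorem continuousOn_invPos (ht : t ∈ Ico (-ε) T) (hn : ∀ r ∈ Icc (-ε) t, ‖m.n r‖ < 1)
    (hc : ContinuousOn c (Icc (-ε) t)) (i : Fin 3) :
    ContinuousOn (fun r => m.invPos r (c r) i) (Icc (-ε) t) := by
  have hsub : Icc (-ε) t ⊆ Ico (-ε) T := fun r hr => ⟨hr.1, hr.2.trans_lt ht.2⟩
  have hy := H.continuousOn_coordinate ht hn hc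
  have hφ : ∀ μ ν, ContinuousOn (fun r => m.φ r μ ν) (Icc (-ε) t) := fun μ ν =>
    (H.modu.smooth_φ μ ν).continuousOn.mono hsub
  have hf : ContinuousOn (fun r => m.front r (act (rot (m.n r))ᵀ (c r - m.ξ r))) (Icc (-ε) t) := by
    simp only [front_eq]
    exact continuousOn_const.mul (((((hφ 0 0).mul (hy 1)).mul (hy 1)).add
      (((hφ 0 1).mul (hy 1)).mul (hy 2))).add ((((hφ 1 0).mul (hy 2)).mul (hy 1)).add
        (((hφ 1 1).mul (hy 2)).mul (hy 2))))
  have : ContinuousOn (fun r => act (rot (m.n r))ᵀ (c r - m.ξ r) i -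
      m.front r (act (rot (m.n r))ᵀ (c r - m.ξ r)) * bv 0 i) (Icc (-ε) t) :=
    (hy i).sub (hf.mul continuousOn_const)
  refine this.congr fun r _ => ?_
  simp [Modulation.invPos]

theorem continuousOn_fr (ht : t ∈ Ico (-ε) T) (hn : ∀ r ∈ Icc (-ε) t, ‖m.n r‖ < 1)
    (hc : ContinuousOn c (Icc (-ε) t)) (j : Fin 3) :
    ContinuousOn (fun r => m.fr j r (m.invPos r (c r))) (Icc (-ε) t) := by
  have hsub : Icc (-ε) t ⊆ Ico (-ε) T := fun r hr => ⟨hr.1, hr.2.trans_lt ht.2⟩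
  have hx := H.continuousOn_invPos ht hn hc
  have hφ : ∀ μ ν, ContinuousOn (fun r => m.φ r μ ν) (Icc (-ε) t) := fun μ ν =>
    (H.modu.smooth_φ μ ν).continuousOn.mono hsub
  have hg : ContinuousOn (fun r => m.frontD r (m.invPos r (c r))) (Icc (-ε) t) := by
    refine continuousOn_pi.mpr fun μ => ?_
    simp only [frontD_eq]
    exact ((hφ μ 0).mul (hx 1)).add ((hφ μ 1).mul (hx 2))
  intro r hr
  exact (contDiffAt_frame (q := (m.n r, m.frontD r (m.invPos r (c r))))
    (hn r hr) j).continuousAt.comp_continuousWithinAt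
      (f := fun r => (m.n r, m.frontD r (m.invPos r (c r))))
      (((H.modu.smooth_n.continuousOn.mono hsub) r hr).prodMk (hg r hr))

/-- Continuity along a path of the vorticity component in the moving frame. -/
theorem continuousOn_inner_zeta (ht : t ∈ Ico (-ε) T) (hn : ∀ r ∈ Icc (-ε) t, ‖m.n r‖ < 1)
    (hc : ContinuousOn c (Icc (-ε) t)) (j : Fin 3) :
    ContinuousOn (fun r => inner ℝ (fl.zeta r (c r)) (m.fr j r (m.invPos r (c r))))
      (Icc (-ε) t) :=
  (continuousOn_slice H.continuousOn_zeta ht hc).inner (H.continuousOn_fr ht hn hc j)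

end Setup

/-! ### Evolution of the vorticity components along particle paths -/

/-- The component of the specific vorticity along the frame vector `j` that a fluid particle with
path `c` meets at time `r`. -/
noncomputable def Modulation.pathZeta (m : Modulation) (fl : Fluid) (j : Fin 3) (c : ℝ → E3)
    (r : ℝ) : ℝ := inner ℝ (fl.zeta r (c r)) (m.fr j r (m.invPos r (c r)))

/-- The factor `e^{2 β₁ a (t + ε)}` removes the damping term from the vorticity equation. -/
theorem Setup.hasDerivAt_exp_mul_inner {γ κ₀ M ε a T l L : ℝ} {fl : Fluid} {m : Modulation}
    (H : Setup γ κ₀ M ε a T l L fl m) {t : ℝ} (ht : t ∈ Ioo (-ε) T) {c : ℝ → E3}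
    (hc : HasDerivAt c ((2 * betaOne γ) • fl.u t (c t)) t) {F : ℝ → E3} {F' : E3}
    (hF : HasDerivAt F F' t) :
    HasDerivAt (fun r => Real.exp (2 * betaOne γ * a * (r + ε)) * inner ℝ (fl.zeta r (c r)) (F r))
      (Real.exp (2 * betaOne γ * a * (t + ε)) *
        (2 * betaOne γ * (inner ℝ (fderiv ℝ (fl.u t) (c t) (fl.zeta t (c t))) (F t) +
          inner ℝ ((1 / fl.ρ t (c t) ^ 3) •
            cross (grad (fl.ρ t) (c t)) (grad (fl.pressure γ t) (c t))) (F t)) +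
          inner ℝ (fl.zeta t (c t)) F')) t := by
  have h1 := (H.hasDerivAt_zeta_path ht hc).inner ℝ hF
  have h2 : HasDerivAt (fun r => Real.exp (2 * betaOne γ * a * (r + ε)))
      (Real.exp (2 * betaOne γ * a * (t + ε)) * (2 * betaOne γ * a)) t := by
    have : HasDerivAt (fun r => 2 * betaOne γ * a * (r + ε)) (2 * betaOne γ * a) t := by
      simpa using ((hasDerivAt_id t).add_const ε).const_mul (2 * betaOne γ * a)
    exact this.exp
  refine (h2.mul h1).congr_deriv ?_
  simp only [inner_add_left, inner_sub_left, inner_smul_left, conj_trivial]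
  ring

theorem grad_eq_zero {h : E3 → ℝ} {p : E3} (h0 : fderiv ℝ h p = 0) : grad h p = 0 := by
  ext i
  fin_cases i <;> simp [grad, pd, h0]

theorem cross_zero_left (v : E3) : cross 0 v = 0 := by
  ext i
  fin_cases i <;> simp [cross]

theorem Setup.zeta_outside {γ κ₀ M ε a T l L : ℝ} {fl : Fluid} {m : Modulation}
    (H : Setup γ κ₀ M ε a T l L fl m) {t : ℝ} (ht : t ∈ Ico (-ε) T) {x : E3} (hx : x ∉ Box ε) :
    fl.zeta t (m.physPos t x) = 0 := by
  rw [Fluid.zeta, curl_eq_zero (H.differentiable_u ht _) (H.const t ht x hx).1, smul_zero]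

/-- After removal of the damping factor, tangential vorticity changes along a particle path only
inside the box, at a rate controlled by the baroclinic torque. -/
theorem exists_evolution {γ κ₀ M B : ℝ} (hγ : 1 < γ) (hκ₀ : 1 < κ₀) (hM : 1 < M) (hB : 0 < B) :
    ∃ C, 0 < C ∧ ∀ᶠ ε in 𝓝[>] (0 : ℝ),
    ∀ (a T l L : ℝ) (fl : Fluid) (m : Modulation), Setup γ κ₀ M ε a T l L fl m →
      ∀ t ∈ Ioo (-ε) T, ∀ c : ℝ → E3, HasDerivAt c ((2 * betaOne γ) • fl.u t (c t)) t →
        ‖c t - m.ξ t‖ ≤ B * ε ^ (1 / 6 : ℝ) → ∀ μ : Fin 2,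
        ∃ h', HasDerivAt (fun r => Real.exp (2 * betaOne γ * a * (r + ε)) *
            m.pathZeta fl μ.succ c r) h' t ∧
          (m.invPos t (c t) ∉ Box ε → h' = 0) ∧
          (m.invPos t (c t) ∈ Box ε →
            |h'| ≤ C * (1 + ε ^ (1 / 8 : ℝ) * (1 + |pd 0 (m.w γ fl t) (m.invPos t (c t))|))) := by
  obtain ⟨C₁, hC₁, h1⟩ := exists_frameFacts hM
  obtain ⟨C₂, hC₂, h2⟩ := exists_pathFacts hγ hκ₀ hM hB
  obtain ⟨C₃, hC₃, h3⟩ := exists_vortFacts hγ hκ₀ hM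
  obtain ⟨C₄, hC₄, h4⟩ := exists_damping_bound hγ hκ₀ hM
  refine ⟨2 * (2 * (C₃ + C₃) + C₃ * C₂), by positivity, ?_⟩
  filter_upwards [eventually_pos, h1, h2, h3, h4,
    eventually_mul_rpow_le C₄ one_pos (show (0:ℝ) < 1 / 2 by norm_num)]
    with ε hε h1 h2 h3 h4 hsm a T l L fl m H t ht c hc hd μ
  have ht' := Ioo_subset_Ico_self ht
  have F := h1 γ κ₀ a T l L fl m H t ht'
  have hn : ‖m.n t‖ ≤ 1 := F.n_le.trans (by norm_num)
  have hβ := H.betaOne_pos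
  have hβ1 := H.betaOne_lt_one
  obtain ⟨F', hF', hFb⟩ := (h2 a T l L fl m H t ht c hc hd).frame_deriv μ.succ
  have hder := H.hasDerivAt_exp_mul_inner ht hc hF'
  refine ⟨_, hder, ?_, ?_⟩
  · intro hx
    have hp := physPos_invPos m hn (c t)
    have hz := H.zeta_outside ht' hx
    have hρ := (H.const t ht' _ hx).2.1
    rw [hp] at hz hρ
    simp [hz, grad_eq_zero hρ, cross_zero_left]
  · intro hx
    have V := h3 a T l L fl m H t ht' _ hx
    have hp := physPos_invPos m hn (c t)
    have v1 := V.norm_le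
    have v2 := V.stretch μ
    have v3 := V.torque μ
    rw [hp] at v1 v2 v3
    set P := ε ^ (1 / 8 : ℝ) * (1 + |pd 0 (m.w γ fl t) (m.invPos t (c t))|) with hP
    have hP0 : 0 ≤ P := by positivity
    rw [mul_assoc, ← hP] at v3
    have he : Real.exp (2 * betaOne γ * a * (t + ε)) ≤ 2 := by
      have k1 := (le_abs_self _).trans (h4 a T l L fl m H t ht')
      rw [Real.rpow_one] at hsm
      have k2 : Real.exp (2 * betaOne γ * a * (t + ε)) ≤ Real.exp (1 / 2) :=
        Real.exp_le_exp.mpr (k1.trans hsm)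
      have k3 := Real.abs_exp_sub_one_le (x := 1 / 2) (by norm_num [abs_of_pos])
      rw [abs_le, abs_of_pos (by norm_num : (0:ℝ) < 1 / 2)] at k3
      linarith [k3.2]
    have v4 : |inner ℝ (fl.zeta t (c t)) F'| ≤ C₃ * C₂ :=
      (abs_real_inner_le_norm _ _).trans (mul_le_mul v1 hFb (norm_nonneg _) hC₃.le)
    rw [abs_mul, Real.abs_exp, mul_assoc 2 (2 * (C₃ + C₃) + C₃ * C₂)]
    refine mul_le_mul he ?_ (abs_nonneg _) (by norm_num)
    refine (abs_add_le _ _).trans ?_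
    rw [abs_mul, abs_of_pos (by positivity : 0 < 2 * betaOne γ)]
    have v5 := (abs_add_le _ _).trans (add_le_add v2 v3)
    have v6 := mul_le_mul (by linarith : 2 * betaOne γ ≤ 2) v5 (abs_nonneg _) (by norm_num)
    have v7 : 0 ≤ C₃ * P := by positivity
    have v8 : 0 ≤ C₃ * C₂ * P := by positivity
    linarith

theorem IsParticlePath.hasDerivAt {γ ε t : ℝ} {fl : Fluid} {c : ℝ → E3}
    (hc : IsParticlePath γ ε fl t c) {r : ℝ} (hr : r ∈ Ioo (-ε) t) :
    HasDerivAt c ((2 * betaOne γ) • fl.u r (c r)) r :=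
  (hc r (Ioo_subset_Icc_self hr)).hasDerivAt (Icc_mem_nhds hr.1 hr.2)

theorem IsParticlePath.continuousOn {γ ε t : ℝ} {fl : Fluid} {c : ℝ → E3}
    (hc : IsParticlePath γ ε fl t c) : ContinuousOn c (Icc (-ε) t) :=
  fun r hr => (hc r hr).continuousWithinAt

/-- A particle that ever meets the box stays close to the origin of the moving coordinates. -/
theorem exists_path_near {γ κ₀ M : ℝ} (hγ : 1 < γ) (hκ₀ : 1 < κ₀) (hM : 1 < M) :
    ∃ B, 0 < B ∧ ∀ᶠ ε in 𝓝[>] (0 : ℝ),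
    ∀ (a T l L : ℝ) (fl : Fluid) (m : Modulation), Setup γ κ₀ M ε a T l L fl m →
      ∀ t ∈ Ico (-ε) T, ∀ c : ℝ → E3, IsParticlePath γ ε fl t c →
        ∀ q ∈ Icc (-ε) t, m.invPos q (c q) ∈ Box ε → ∀ r ∈ Icc (-ε) t,
          ‖c r - m.ξ r‖ ≤ B * ε ^ (1 / 6 : ℝ) := by
  obtain ⟨C₁, hC₁, h1⟩ := exists_frameFacts hM
  obtain ⟨C₂, hC₂, h2⟩ := exists_stateFacts hγ hκ₀ hM
  have hMr : 0 < M ^ (1 / 4 : ℝ) := by positivity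
  refine ⟨(6 + 8 * M ^ 2) + 2 * (2 * κ₀) * (M + 1) + 2 * M ^ (1 / 4 : ℝ), by positivity, ?_⟩
  filter_upwards [eventually_pos, eventually_le_const one_pos, h1, h2]
    with ε hε hε1 h1 h2 a T l L fl m H t ht c hc q hq hbox r hr
  have hsub : Icc (-ε) t ⊆ Ico (-ε) T := fun r hr => ⟨hr.1, hr.2.trans_lt ht.2⟩
  have hβ := H.betaOne_pos
  have hβ1 := H.betaOne_lt_one
  have hn : ‖m.n q‖ ≤ 1 := (h1 γ κ₀ a T l L fl m H q (hsub hq)).n_le.trans (by norm_num)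
  have hε6 : ε ≤ ε ^ (1 / 6 : ℝ) := by
    simpa using Real.rpow_le_rpow_of_exponent_ge hε hε1 (show (1 / 6 : ℝ) ≤ 1 by norm_num)
  have b1 := H.norm_physPos_sub_le (hsub hq) hn hε1 hbox
  rw [physPos_invPos m hn] at b1
  have b2 : ‖c r - c q‖ ≤ 2 * (2 * κ₀) * ((M + 1) * ε) := by
    have := (convex_Icc (-ε) t).norm_image_sub_le_of_norm_hasDerivWithin_le
      (C := 2 * (2 * κ₀)) hc (fun s hs => by
        rw [norm_smul, Real.norm_eq_abs, abs_of_pos (by positivity)]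
        exact mul_le_mul (by linarith) ((h2 a T l L fl m H s (hsub hs)).u_le _)
          (norm_nonneg _) (by norm_num)) hq hr
    refine this.trans (mul_le_mul_of_nonneg_left ?_ (by positivity))
    have e1 := H.theta_le (hsub hq)
    have e2 := H.theta_le (hsub hr)
    rw [Real.norm_eq_abs, abs_le]
    constructor <;> linarith [hq.1, hr.1]
  have b3 := H.boot.modulation.ξ_le r (hsub hr)
  have b4 := H.boot.modulation.ξ_le q (hsub hq)
  have e : c r - m.ξ r = (c q - m.ξ q) + (c r - c q) + (m.ξ q - m.ξ r) := by abel
  rw [e]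
  refine (norm_add₃_le).trans ?_
  have b5 := norm_sub_le (m.ξ q) (m.ξ r)
  have b6 : 2 * (2 * κ₀) * ((M + 1) * ε) ≤ 2 * (2 * κ₀) * (M + 1) * ε ^ (1 / 6 : ℝ) := by
    rw [← mul_assoc]; gcongr
  have b7 : M ^ (1 / 4 : ℝ) * ε ≤ M ^ (1 / 4 : ℝ) * ε ^ (1 / 6 : ℝ) := by gcongr
  linarith

/-- Particles cross the front transversally, unless the damping is extremely strong: a particle near
the origin moves with speed about `β₁ κ` and the front with speed about `κ`, where `β₁ < 1`. -/
theorem exists_transversality {γ κ₀ M B : ℝ} (hγ : 1 < γ) (hκ₀ : 1 < κ₀) (hM : 1 < M)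
    (hB : 0 < B) : ∃ κ₁, 0 < κ₁ ∧ ∀ᶠ ε in 𝓝[>] (0 : ℝ),
    ∀ (a T l L : ℝ) (fl : Fluid) (m : Modulation), Setup γ κ₀ M ε a T l L fl m →
      |betaOne γ * a| ≤ ε ^ (-(3 / 2) : ℝ) →
      ∀ t ∈ Ioo (-ε) T, ∀ c : ℝ → E3, HasDerivAt c ((2 * betaOne γ) • fl.u t (c t)) t →
        ‖c t - m.ξ t‖ ≤ B * ε ^ (1 / 6 : ℝ) →
        ∃ v, HasDerivAt (fun r => m.invPos r (c r) 0) v t ∧ v ≤ -κ₁ := by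
  obtain ⟨C₁, hC₁, h1⟩ := exists_front_speed hγ hκ₀ hM
  obtain ⟨C₂, hC₂, h2⟩ := exists_pathFacts hγ hκ₀ hM hB
  have hβ1 : betaOne γ < 1 := by
    unfold betaOne alphaC
    rw [div_lt_one (by linarith)]
    linarith
  have hpos : 0 < (1 - betaOne γ) * κ₀ := mul_pos (by linarith) (by linarith)
  refine ⟨(1 - betaOne γ) * κ₀ / 4, by linarith, ?_⟩
  filter_upwards [h1, h2,
    eventually_mul_rpow_le C₁ (show (0:ℝ) < 1 / 2 by norm_num)
      (show 0 < (1 - betaOne γ) * κ₀ / 8 by linarith),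
    eventually_mul_rpow_le C₂ (show (0:ℝ) < 1 / 6 by norm_num)
      (show 0 < (1 - betaOne γ) * κ₀ / 8 by linarith)]
    with ε h1 h2 s1 s2 a T l L fl m H hb t ht c hc hd
  obtain ⟨v, hv, hvb⟩ := (h2 a T l L fl m H t ht c hc hd).normal_deriv
  refine ⟨v, hv, ?_⟩
  have f1 := (h1 a T l L fl m H hb t ht).trans s1
  have f2 := hvb.trans s2
  have f3 : (1 - betaOne γ) * (1 / 2 * κ₀) ≤ (1 - betaOne γ) * m.κ t :=
    mul_le_mul_of_nonneg_left (H.boot.modulation.κ_lower t (Ioo_subset_Ico_self ht)) (by linarith)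
  rw [abs_le] at f1 f2
  linarith [f1.1, f2.2]

/-- The estimate `|τ| = O(ε²)` is uniform in the damping constant, since `|a| (t + ε) = O(ε)`. -/
theorem exists_tau_bound {γ κ₀ M : ℝ} (hγ : 1 < γ) (hκ₀ : 1 < κ₀) (hM : 1 < M) :
    ∃ C, 0 < C ∧ ∀ᶠ ε in 𝓝[>] (0 : ℝ),
    ∀ (a T l L : ℝ) (fl : Fluid) (m : Modulation), Setup γ κ₀ M ε a T l L fl m →
      ∀ t ∈ Ico (-ε) T, |m.τ t| ≤ C * ε ^ 2 := by
  obtain ⟨C₁, hC₁, h1⟩ := exists_damping_bound hγ hκ₀ hM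
  refine ⟨(M + 1) * (C₁ + M * (M + 1)), by positivity, ?_⟩
  filter_upwards [eventually_pos, h1] with ε hε h1 a T l L fl m H t ht
  have hβ := H.betaOne_pos
  have hd := h1 a T l L fl m H t ht
  have h0 : 0 ≤ t + ε := by linarith [ht.1]
  rw [abs_mul, abs_mul, abs_of_nonneg h0, abs_of_pos (by positivity : 0 < 2 * betaOne γ)] at hd
  refine (H.abs_tau_le ht).trans ?_
  have e1 : (betaOne γ * |a| + M) * ((M + 1) * ε) * (t + ε) =
    (M + 1) * ε * (betaOne γ * |a| * (t + ε) + M * (t + ε)) := by ring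
  have e2 : (M + 1) * (C₁ + M * (M + 1)) * ε ^ 2 =
    (M + 1) * ε * (C₁ * ε + M * ((M + 1) * ε)) := by ring
  rw [e1, e2]
  have e3 := H.theta_le ht
  have e4 : 0 ≤ betaOne γ * |a| * (t + ε) := by positivity
  have e5 : betaOne γ * |a| * (t + ε) ≤ C₁ * ε := by linarith
  have e6 : M * (t + ε) ≤ M * ((M + 1) * ε) := mul_le_mul_of_nonneg_left e3 (by linarith)
  exact mul_le_mul_of_nonneg_left (add_le_add e5 e6) (by positivity)

theorem abs_sub_le_of_hasDerivAt {h : ℝ → ℝ} {s t A : ℝ} (hst : s ≤ t)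
    (hc : ContinuousOn h (Icc s t)) (hd : ∀ r ∈ Ioo s t, ∃ h', HasDerivAt h h' r ∧ |h'| ≤ A) :
    |h t - h s| ≤ A * (t - s) := by
  rcases hst.eq_or_lt with rfl | hlt
  · simp
  · choose! h' h1 h2 using hd
    obtain ⟨r, hr, hrs⟩ := exists_hasDerivAt_eq_slope h h' hlt hc h1
    have h3 := h2 r hr
    rw [hrs, abs_div, abs_of_pos (by linarith : 0 < t - s), div_le_iff₀ (by linarith)] at h3
    exact h3

/-! ### Transport of tangential vorticity -/

theorem exists_damp_le {γ κ₀ M : ℝ} (hγ : 1 < γ) (hκ₀ : 1 < κ₀) (hM : 1 < M) :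
    ∀ᶠ ε in 𝓝[>] (0 : ℝ),
    ∀ (a T l L : ℝ) (fl : Fluid) (m : Modulation), Setup γ κ₀ M ε a T l L fl m →
      ∀ t ∈ Ico (-ε) T, damp γ a ε t ≤ 2 := by
  obtain ⟨C, hC, h⟩ := exists_damping_bound hγ hκ₀ hM
  filter_upwards [h, eventually_mul_rpow_le C one_pos (show (0:ℝ) < 1 / 2 by norm_num)]
    with ε h hsm a T l L fl m H t ht
  have k1 := (neg_le_abs _).trans (h a T l L fl m H t ht)
  rw [Real.rpow_one] at hsm
  have k2 : damp γ a ε t ≤ Real.exp (1 / 2) := Real.exp_le_exp.mpr (k1.trans hsm)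
  have k3 := Real.abs_exp_sub_one_le (x := 1 / 2) (by norm_num [abs_of_pos])
  rw [abs_le, abs_of_pos (by norm_num : (0:ℝ) < 1 / 2)] at k3
  linarith [k3.2]

/-- For moderate damping the torque is of size `ε^{1/8} |x₁|^{-2/3}`. Along a path transversal to the
front its time integral is `O(ε^{1/8} X^{1/3})`, where `X = O(ε^{1/6})` bounds `|x₁|`, which gains a
factor `ε^{1/18}`. The remaining bounded terms act for a time `O(ε)`. -/
theorem exists_increment_moderate {γ κ₀ M B : ℝ} (hγ : 1 < γ) (hκ₀ : 1 < κ₀) (hM : 1 < M)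
    (hB : 0 < B) : ∀ᶠ ε in 𝓝[>] (0 : ℝ),
    ∀ (a T l L : ℝ) (fl : Fluid) (m : Modulation), Setup γ κ₀ M ε a T l L fl m →
      |betaOne γ * a| ≤ ε ^ (-(3 / 2) : ℝ) →
      ∀ t ∈ Ico (-ε) T, ∀ c : ℝ → E3, IsParticlePath γ ε fl t c →
        (∀ r ∈ Icc (-ε) t, ‖c r - m.ξ r‖ ≤ B * ε ^ (1 / 6 : ℝ)) → ∀ μ : Fin 2,
        |Real.exp (2 * betaOne γ * a * (t + ε)) * m.pathZeta fl μ.succ c t -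
          m.pathZeta fl μ.succ c (-ε)| ≤ 1 / 2 * ε ^ (1 / 8 : ℝ) := by
  obtain ⟨C₁, hC₁, h1⟩ := exists_frameFacts hM
  obtain ⟨C₂, hC₂, h2⟩ := exists_evolution hγ hκ₀ hM hB
  obtain ⟨κ₁, hκ₁, h3⟩ := exists_transversality hγ hκ₀ hM hB
  filter_upwards [eventually_pos, eventually_le_const one_pos, h1, h2, h3,
    eventually_mul_rpow_le B (show (0:ℝ) < 1 / 6 by norm_num) one_pos,
    eventually_mul_rpow_le (2 * C₂ * (M + 1)) (show (0:ℝ) < 7 / 8 by norm_num)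
      (show (0:ℝ) < 1 / 4 by norm_num),
    eventually_mul_rpow_le (6 * (4 * C₂ / κ₁) * (B + 2 * M ^ 2) ^ (1 / 3 : ℝ))
      (show (0:ℝ) < 1 / 18 by norm_num) (show (0:ℝ) < 1 / 4 by norm_num)]
    with ε hε hε1 h1 h2 h3 hBε s1 s2 a T l L fl m H hb t ht c hc hnear μ
  have hsub : Icc (-ε) t ⊆ Ico (-ε) T := fun r hr => ⟨hr.1, hr.2.trans_lt ht.2⟩
  have hsub' : Ioo (-ε) t ⊆ Ioo (-ε) T := Ioo_subset_Ioo_right ht.2.le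
  have hn : ∀ r ∈ Icc (-ε) t, ‖m.n r‖ < 1 := fun r hr =>
    (h1 γ κ₀ a T l L fl m H r (hsub hr)).n_le.trans_lt (by norm_num)
  have he8 : ε ^ (1 / 8 : ℝ) ≤ 1 := Real.rpow_le_one hε.le hε1 (by norm_num)
  have he8p : 0 < ε ^ (1 / 8 : ℝ) := by positivity
  obtain ⟨h, hh⟩ : ∃ h : ℝ → ℝ, h = fun r => Real.exp (2 * betaOne γ * a * (r + ε)) *
    m.pathZeta fl μ.succ c r := ⟨_, rfl⟩
  have hhc : ContinuousOn h (Icc (-ε) t) := by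
    rw [hh]
    exact (Continuous.continuousOn (by fun_prop)).mul
      (H.continuousOn_inner_zeta ht hn hc.continuousOn μ.succ)
  have hev : ∀ r ∈ Ioo (-ε) t, ∃ h', HasDerivAt h h' r ∧
      (m.invPos r (c r) ∉ Box ε → h' = 0) ∧ (m.invPos r (c r) ∈ Box ε →
        |h'| ≤ C₂ * (1 + ε ^ (1 / 8 : ℝ) * (1 + |pd 0 (m.w γ fl r) (m.invPos r (c r))|))) := by
    intro r hr
    rw [hh]
    exact h2 a T l L fl m H r (hsub' hr) c (hc.hasDerivAt hr) (hnear r (Ioo_subset_Icc_self hr)) μ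
  choose! h' hd hout hin using hev
  have htr : ∀ r ∈ Ioo (-ε) t, ∃ v, HasDerivAt (fun r => m.invPos r (c r) 0) v r ∧ v ≤ -κ₁ :=
    fun r hr => h3 a T l L fl m H hb r (hsub' hr) c (hc.hasDerivAt hr)
      (hnear r (Ioo_subset_Icc_self hr))
  choose! x' hxd hx' using htr
  have hX : ∀ r ∈ Icc (-ε) t, |m.invPos r (c r) 0| ≤ (B + 2 * M ^ 2) * ε ^ (1 / 6 : ℝ) := by
    intro r hr
    have hd := hnear r hr
    have hfr : ∀ i, |inner ℝ (c r - m.ξ r) (frame i (m.n r, 0))| ≤ B * ε ^ (1 / 6 : ℝ) := by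
      intro i
      refine (abs_real_inner_le_norm _ _).trans ?_
      rw [frame_norm (q := (m.n r, 0)) (hn r hr).le, mul_one]
      exact hd
    have i1 := invPos_succ m r (c r) 0
    have i2 := invPos_succ m r (c r) 1
    have y1 := hfr 1
    have y2 := hfr 2
    simp only [Fin.succ_zero_eq_one, Fin.succ_one_eq_two] at i1 i2
    rw [← i1] at y1
    rw [← i2] at y2
    have hε6 : ε ≤ ε ^ (1 / 6 : ℝ) := by
      simpa using Real.rpow_le_rpow_of_exponent_ge hε hε1 (show (1 / 6 : ℝ) ≤ 1 by norm_num)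
    have hq : ∀ μ ν (p q : ℝ), |p| ≤ 1 → |q| ≤ 1 → |m.φ r μ ν * p * q| ≤ M ^ 2 * ε := by
      intro μ ν p q hp hq
      rw [abs_mul, abs_mul]
      have := H.boot.modulation.φ_le r (hsub hr) μ ν
      calc _ ≤ M ^ 2 * ε * 1 * 1 := by gcongr
        _ = _ := by ring
    have z1 := y1.trans hBε
    have z2 := y2.trans hBε
    have hfront : |m.front r (m.invPos r (c r))| ≤ 2 * M ^ 2 * ε := by
      rw [front_eq, abs_le]
      have q1 := abs_le.mp (hq 0 0 _ _ z1 z1)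
      have q2 := abs_le.mp (hq 0 1 _ _ z1 z2)
      have q3 := abs_le.mp (hq 1 0 _ _ z2 z1)
      have q4 := abs_le.mp (hq 1 1 _ _ z2 z2)
      constructor <;> linarith
    rw [invPos_zero]
    refine (abs_sub _ _).trans ?_
    have := hfr 0
    have e : 2 * M ^ 2 * ε ≤ 2 * M ^ 2 * ε ^ (1 / 6 : ℝ) := by gcongr
    linarith
  have hbd : ∀ r ∈ Ioo (-ε) t, m.invPos r (c r) 0 ≠ 0 →
      |h' r| ≤ 2 * C₂ + 4 * C₂ * ε ^ (1 / 8 : ℝ) * |m.invPos r (c r) 0| ^ (-(2 / 3) : ℝ) := by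
    intro r hr h0
    have hr' := Ioo_subset_Icc_self hr
    by_cases hx : m.invPos r (c r) ∈ Box ε
    · have p1 := H.pd_w_zero_of_ne (hsub hr') (hn r hr') hx h0
      refine (hin r hr hx).trans ?_
      calc _ ≤ C₂ * (1 + (1 + ε ^ (1 / 8 : ℝ) * (4 * |m.invPos r (c r) 0| ^ (-(2 / 3) : ℝ)))) := by
            rw [mul_add (ε ^ (1 / 8 : ℝ)), mul_one]; gcongr
        _ = _ := by ring
    · rw [hout r hr hx, abs_zero]; positivity
  have main := abs_sub_le_of_transversal ht.1 (by positivity) hκ₁ hhc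
    (H.continuousOn_invPos ht hn hc.continuousOn 0) hd hxd hx' hbd hX
  rw [hh] at main
  simp only [neg_add_cancel, mul_zero, Real.exp_zero, one_mul] at main
  refine main.trans ?_
  have e1 : 2 * C₂ * (t - -ε) ≤ 1 / 4 * ε ^ (1 / 8 : ℝ) := by
    have t1 : t - -ε ≤ (M + 1) * ε := by linarith [H.theta_le ht]
    have t2 : ε = ε ^ (7 / 8 : ℝ) * ε ^ (1 / 8 : ℝ) := by
      rw [← Real.rpow_add hε]; norm_num
    calc 2 * C₂ * (t - -ε) ≤ 2 * C₂ * ((M + 1) * ε) := by gcongr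
      _ = (2 * C₂ * (M + 1) * ε ^ (7 / 8 : ℝ)) * ε ^ (1 / 8 : ℝ) := by
        conv_lhs => rw [t2]
        ring
      _ ≤ _ := by gcongr
  have e2 : 6 * (4 * C₂ * ε ^ (1 / 8 : ℝ) / κ₁) *
      ((B + 2 * M ^ 2) * ε ^ (1 / 6 : ℝ)) ^ (1 / 3 : ℝ) ≤ 1 / 4 * ε ^ (1 / 8 : ℝ) := by
    rw [Real.mul_rpow (by positivity) (by positivity), ← Real.rpow_mul hε.le]
    norm_num only
    calc _ = (6 * (4 * C₂ / κ₁) * (B + 2 * M ^ 2) ^ (1 / 3 : ℝ) * ε ^ (1 / 18 : ℝ)) *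
          ε ^ (1 / 8 : ℝ) := by ring
      _ ≤ _ := by gcongr
  linarith

/-- For very strong damping the front speed is not known, but the lifespan is `O(ε^{5/2})`. So
`τ - t` stays of size `ε`, the torque is `O(ε^{-2})`, and its integral is `O(ε^{1/2})`. -/
theorem exists_increment_strong {γ κ₀ M B : ℝ} (hγ : 1 < γ) (hκ₀ : 1 < κ₀) (hM : 1 < M)
    (hB : 0 < B) : ∀ᶠ ε in 𝓝[>] (0 : ℝ),
    ∀ (a T l L : ℝ) (fl : Fluid) (m : Modulation), Setup γ κ₀ M ε a T l L fl m →
      ε ^ (-(3 / 2) : ℝ) ≤ |betaOne γ * a| →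
      ∀ t ∈ Ico (-ε) T, ∀ c : ℝ → E3, IsParticlePath γ ε fl t c →
        (∀ r ∈ Icc (-ε) t, ‖c r - m.ξ r‖ ≤ B * ε ^ (1 / 6 : ℝ)) → ∀ μ : Fin 2,
        |Real.exp (2 * betaOne γ * a * (t + ε)) * m.pathZeta fl μ.succ c t -
          m.pathZeta fl μ.succ c (-ε)| ≤ 1 / 2 * ε ^ (1 / 8 : ℝ) := by
  obtain ⟨C₁, hC₁, h1⟩ := exists_frameFacts hM
  obtain ⟨C₂, hC₂, h2⟩ := exists_evolution hγ hκ₀ hM hB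
  obtain ⟨C₃, hC₃, h3⟩ := exists_damping_bound hγ hκ₀ hM
  obtain ⟨C₄, hC₄, h4⟩ := exists_tau_bound hγ hκ₀ hM
  filter_upwards [eventually_pos, eventually_le_const one_pos, h1, h2, h3, h4,
    eventually_mul_rpow_le C₃ (show (0:ℝ) < 3 / 2 by norm_num) (show (0:ℝ) < 1 / 4 by norm_num),
    eventually_mul_rpow_le C₄ one_pos (show (0:ℝ) < 1 / 4 by norm_num),
    eventually_mul_rpow_le (8 * C₂ * C₃) (show (0:ℝ) < 3 / 8 by norm_num)
      (show (0:ℝ) < 1 / 2 by norm_num)]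
    with ε hε hε1 h1 h2 h3 h4 s1 s2 s3 a T l L fl m H hb t ht c hc hnear μ
  rw [Real.rpow_one] at s2
  have hsub : Icc (-ε) t ⊆ Ico (-ε) T := fun r hr => ⟨hr.1, hr.2.trans_lt ht.2⟩
  have hn : ∀ r ∈ Icc (-ε) t, ‖m.n r‖ < 1 := fun r hr =>
    (h1 γ κ₀ a T l L fl m H r (hsub hr)).n_le.trans_lt (by norm_num)
  have he8 : ε ^ (1 / 8 : ℝ) ≤ 1 := Real.rpow_le_one hε.le hε1 (by norm_num)
  have he8p : 0 < ε ^ (1 / 8 : ℝ) := by positivity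
  have hθ : t + ε ≤ C₃ * ε ^ (5 / 2 : ℝ) := by
    have k := h3 a T l L fl m H t ht
    have h0 : 0 ≤ t + ε := by linarith [ht.1]
    rw [mul_assoc 2, mul_assoc 2, abs_mul, abs_mul, abs_of_nonneg h0,
      abs_of_pos (by norm_num : (0:ℝ) < 2)] at k
    have k1 : ε ^ (-(3 / 2) : ℝ) * (t + ε) ≤ C₃ * ε := by
      have := mul_le_mul_of_nonneg_right hb h0
      have : 0 ≤ ε ^ (-(3 / 2) : ℝ) * (t + ε) := by positivity
      linarith
    calc t + ε = ε ^ (3 / 2 : ℝ) * (ε ^ (-(3 / 2) : ℝ) * (t + ε)) := by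
          rw [← mul_assoc, ← Real.rpow_add hε]; norm_num
      _ ≤ ε ^ (3 / 2 : ℝ) * (C₃ * ε) := by gcongr
      _ = C₃ * (ε ^ (3 / 2 : ℝ) * ε ^ (1 : ℝ)) := by rw [Real.rpow_one]; ring
      _ = _ := by rw [← Real.rpow_add hε]; norm_num
  -- `τ = O(ε²)` while the time is still close to `-ε`
  have hgap : ∀ r ∈ Icc (-ε) t, ε / 2 ≤ m.τ r - r := by
    intro r hr
    have k1 := (abs_le.mp (h4 a T l L fl m H r (hsub hr))).1
    have k2 : C₄ * ε ^ 2 ≤ 1 / 4 * ε := by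
      calc C₄ * ε ^ 2 = C₄ * ε * ε := by ring
        _ ≤ _ := by gcongr
    have k3 : C₃ * ε ^ (5 / 2 : ℝ) ≤ 1 / 4 * ε := by
      calc C₃ * ε ^ (5 / 2 : ℝ) = C₃ * ε ^ (3 / 2 : ℝ) * ε ^ (1 : ℝ) := by
            rw [mul_assoc, ← Real.rpow_add hε]; norm_num
        _ ≤ 1 / 4 * ε ^ (1 : ℝ) := by gcongr
        _ = _ := by rw [Real.rpow_one]
    linarith [hr.2]
  obtain ⟨h, hh⟩ : ∃ h : ℝ → ℝ, h = fun r => Real.exp (2 * betaOne γ * a * (r + ε)) *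
    m.pathZeta fl μ.succ c r := ⟨_, rfl⟩
  have hhc : ContinuousOn h (Icc (-ε) t) := by
    rw [hh]
    exact (Continuous.continuousOn (by fun_prop)).mul
      (H.continuousOn_inner_zeta ht hn hc.continuousOn μ.succ)
  have hev : ∀ r ∈ Ioo (-ε) t, ∃ h', HasDerivAt h h' r ∧ |h'| ≤ 8 * C₂ * (ε⁻¹ * ε⁻¹) := by
    intro r hr
    have hr' := Ioo_subset_Icc_self hr
    obtain ⟨h', hd, hout, hin⟩ := h2 a T l L fl m H r (Ioo_subset_Ioo_right ht.2.le hr) c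
      (hc.hasDerivAt hr) (hnear r hr') μ
    refine ⟨h', by rw [hh]; exact hd, ?_⟩
    by_cases hx : m.invPos r (c r) ∈ Box ε
    · have p1 := H.pd_w_zero_le (hsub hr') (hn r hr') hx
      have hi1 : 1 ≤ ε⁻¹ := (one_le_inv₀ hε).mpr hε1
      have p2 : (m.τ r - r)⁻¹ ≤ 2 * ε⁻¹ := by
        rw [inv_le_comm₀ (by linarith [hgap r hr']) (by positivity), mul_inv, inv_inv]
        linarith [hgap r hr']
      have p3 : |pd 0 (m.w γ fl r) (m.invPos r (c r))| ≤ 2 * ε⁻¹ * (3 * ε⁻¹) :=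
        p1.trans (mul_le_mul p2 (by linarith) (by positivity) (by positivity))
      refine (hin hx).trans ?_
      have p4 : 1 ≤ ε⁻¹ * ε⁻¹ := by nlinarith
      calc _ ≤ C₂ * (1 + 1 * (1 + 2 * ε⁻¹ * (3 * ε⁻¹))) := by gcongr
        _ ≤ C₂ * (8 * (ε⁻¹ * ε⁻¹)) := by gcongr; linarith
        _ = _ := by ring
    · rw [hout hx, abs_zero]; positivity
  have main := abs_sub_le_of_hasDerivAt ht.1 hhc hev
  rw [hh] at main
  simp only [neg_add_cancel, mul_zero, Real.exp_zero, one_mul, sub_neg_eq_add] at main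
  refine main.trans ?_
  calc 8 * C₂ * (ε⁻¹ * ε⁻¹) * (t + ε) ≤ 8 * C₂ * (ε⁻¹ * ε⁻¹) * (C₃ * ε ^ (5 / 2 : ℝ)) := by
        gcongr
    _ = 8 * C₂ * C₃ * ε ^ (3 / 8 : ℝ) * ε ^ (1 / 8 : ℝ) := by
      have : ε ^ (5 / 2 : ℝ) = ε ^ (3 / 8 : ℝ) * ε ^ (1 / 8 : ℝ) * ε ^ (2 : ℝ) := by
        rw [← Real.rpow_add hε, ← Real.rpow_add hε]; norm_num
      rw [this, Real.rpow_two]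
      field_simp
    _ ≤ _ := by gcongr

/-- Along a particle path, tangential vorticity is multiplied by the damping factor up to
`ε^{1/8}`. A particle that never meets the box carries no vorticity; any other one stays near the
origin, where the estimates of the increment apply. -/
theorem eventually_transport {γ κ₀ M : ℝ} (hγ : 1 < γ) (hκ₀ : 1 < κ₀) (hM : 1 < M) :
    ∀ᶠ ε in 𝓝[>] (0 : ℝ),
    ∀ (a T l L : ℝ) (fl : Fluid) (m : Modulation), Setup γ κ₀ M ε a T l L fl m →
      ∀ t ∈ Ico (-ε) T, ∀ μ : Fin 2, ∀ c : ℝ → E3, IsParticlePath γ ε fl t c →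
        ∀ x₀ x : E3, c (-ε) = m.physPos (-ε) x₀ → c t = m.physPos t x →
          |m.zetaT fl μ t x - damp γ a ε t * m.zetaT fl μ (-ε) x₀| ≤ ε ^ (1 / 8 : ℝ) := by
  obtain ⟨C₁, hC₁, h1⟩ := exists_frameFacts hM
  obtain ⟨B, hB, h2⟩ := exists_path_near hγ hκ₀ hM
  filter_upwards [eventually_pos, h1, h2, exists_increment_moderate hγ hκ₀ hM hB,
    exists_increment_strong hγ hκ₀ hM hB, exists_damp_le hγ hκ₀ hM]
    with ε hε h1 h2 h3 h4 h5 a T l L fl m H t ht μ c hc x₀ x hx₀ hx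
  have hsub : Icc (-ε) t ⊆ Ico (-ε) T := fun r hr => ⟨hr.1, hr.2.trans_lt ht.2⟩
  have hn : ∀ r ∈ Icc (-ε) t, ‖m.n r‖ ≤ 1 := fun r hr =>
    (h1 γ κ₀ a T l L fl m H r (hsub hr)).n_le.trans (by norm_num)
  have hl : -ε ∈ Icc (-ε) t := left_mem_Icc.mpr ht.1
  have hr : t ∈ Icc (-ε) t := right_mem_Icc.mpr ht.1
  have z1 : m.zetaT fl μ t x = m.pathZeta fl μ.succ c t := by
    rw [zetaT_eq, Modulation.pathZeta, hx, invPos_physPos m (hn t hr)]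
  have z0 : m.zetaT fl μ (-ε) x₀ = m.pathZeta fl μ.succ c (-ε) := by
    rw [zetaT_eq, Modulation.pathZeta, hx₀, invPos_physPos m (hn _ hl)]
  rw [z1, z0]
  by_cases hbox : ∃ q ∈ Icc (-ε) t, m.invPos q (c q) ∈ Box ε
  · obtain ⟨q, hq, hqb⟩ := hbox
    have hnear := h2 a T l L fl m H t ht c hc q hq hqb
    have hinc : |Real.exp (2 * betaOne γ * a * (t + ε)) * m.pathZeta fl μ.succ c t -
        m.pathZeta fl μ.succ c (-ε)| ≤ 1 / 2 * ε ^ (1 / 8 : ℝ) := by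
      rcases le_total |betaOne γ * a| (ε ^ (-(3 / 2) : ℝ)) with hb | hb
      · exact h3 a T l L fl m H hb t ht c hc hnear μ
      · exact h4 a T l L fl m H hb t ht c hc hnear μ
    have hde : damp γ a ε t * Real.exp (2 * betaOne γ * a * (t + ε)) = 1 := by
      rw [damp, ← Real.exp_add]; simp
    have e : m.pathZeta fl μ.succ c t - damp γ a ε t * m.pathZeta fl μ.succ c (-ε) =
        damp γ a ε t * (Real.exp (2 * betaOne γ * a * (t + ε)) * m.pathZeta fl μ.succ c t -
          m.pathZeta fl μ.succ c (-ε)) := by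
      linear_combination (-m.pathZeta fl μ.succ c t) * hde
    have hdp : 0 < damp γ a ε t := Real.exp_pos _
    rw [e, abs_mul, abs_of_pos hdp]
    calc _ ≤ 2 * (1 / 2 * ε ^ (1 / 8 : ℝ)) :=
          mul_le_mul (h5 a T l L fl m H t ht) hinc (abs_nonneg _) (by norm_num)
      _ = _ := by ring
  · push Not at hbox
    have hz : ∀ r ∈ Icc (-ε) t, m.pathZeta fl μ.succ c r = 0 := by
      intro r hr
      have := H.zeta_outside (hsub hr) (hbox r hr)
      rw [physPos_invPos m (hn r hr)] at this
      rw [Modulation.pathZeta, this, inner_zero_left]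
    rw [hz t hr, hz _ hl]
    simp only [mul_zero, sub_zero, abs_zero]
    positivity

/-! ### Existence of particle paths -/

/-- Through every point at time `t` there passes a particle path starting at time `-ε`, provided
the velocity is bounded. The Picard–Lindelöf theorem applies on the whole interval `[-ε, t]`, in a
closed ball that the path cannot leave. -/
theorem Setup.exists_particlePath {γ κ₀ M ε a T l L V : ℝ} {fl : Fluid} {m : Modulation}
    (H : Setup γ κ₀ M ε a T l L fl m) (hV : ∀ r ∈ Ico (-ε) T, ∀ p, ‖fl.u r p‖ ≤ V) {t : ℝ}
    (ht : t ∈ Ico (-ε) T) (p : E3) : ∃ c, IsParticlePath γ ε fl t c ∧ c t = p := by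
  have hsub : Icc (-ε) t ⊆ Ico (-ε) T := fun r hr => ⟨hr.1, hr.2.trans_lt ht.2⟩
  have hβ := H.betaOne_pos
  have hV0 : 0 ≤ V := (norm_nonneg _).trans (hV t ht p)
  have h0 : 0 ≤ t + ε := by linarith [ht.1]
  have hA : 0 ≤ 2 * betaOne γ * V * (t + ε) := by positivity
  lift 2 * betaOne γ * V * (t + ε) to NNReal using hA with A hAeq
  have hL : 0 ≤ 2 * betaOne γ * V := by positivity
  obtain ⟨K, hK⟩ : ∃ K : NNReal, ∀ r ∈ Icc (-ε) t, ∀ q ∈ Metric.closedBall p (A : ℝ),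
      ‖fderiv ℝ (fun q => (2 * betaOne γ) • fl.u r q) q‖₊ ≤ K := by
    have hcomp : IsCompact (Icc (-ε) t ×ˢ Metric.closedBall p (A : ℝ)) :=
      isCompact_Icc.prod (isCompact_closedBall _ _)
    have hcont : ContinuousOn (fun q : ℝ × E3 => fderiv ℝ (fl.u q.1) q.2)
        (Icc (-ε) t ×ˢ Metric.closedBall p (A : ℝ)) :=
      (continuousOn_fderiv_slice H.euler.smooth_u).mono (prod_mono hsub (subset_univ _))
    obtain ⟨B, hB⟩ := hcomp.exists_bound_of_continuousOn hcont
    refine ⟨Real.toNNReal (2 * betaOne γ * B), fun r hr q hq => ?_⟩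
    rw [← NNReal.coe_le_coe, coe_nnnorm]
    refine le_trans ?_ (Real.le_coe_toNNReal _)
    rw [fderiv_fun_const_smul (H.differentiable_u (hsub hr) q), norm_smul, Real.norm_eq_abs,
      abs_of_pos (by positivity)]
    exact mul_le_mul_of_nonneg_left (hB (r, q) ⟨hr, hq⟩) (by positivity)
  have hPL : IsPicardLindelof (fun r q => (2 * betaOne γ) • fl.u r q)
      (⟨t, right_mem_Icc.mpr ht.1⟩ : Icc (-ε) t) p A 0 ⟨2 * betaOne γ * V, hL⟩ K := by
    constructor
    · intro r hr
      exact Convex.lipschitzOnWith_of_nnnorm_fderiv_le (𝕜 := ℝ)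
        (fun q _ => (H.differentiable_u (hsub hr) q).fun_const_smul _)
        (hK r hr) (convex_closedBall _ _)
    · intro q _
      exact (continuous_const_smul (2 * betaOne γ)).comp_continuousOn
        (continuousOn_slice H.euler.smooth_u.continuousOn ht
          (c := fun _ => q) continuousOn_const)
    · intro r hr q _
      rw [norm_smul, Real.norm_eq_abs, abs_of_pos (by positivity)]
      exact mul_le_mul_of_nonneg_left (hV r (hsub hr) q) (by positivity)
    · simp only [sub_self, sub_neg_eq_add, NNReal.coe_zero, sub_zero]
      rw [max_eq_right h0, hAeq]
      rfl
  obtain ⟨c, hc, hd⟩ := hPL.exists_eq_forall_mem_Icc_hasDerivWithinAt₀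
  exact ⟨c, hd, hc⟩

/-! ### Essential suprema -/

theorem eLpNorm_top_le_of_forall {f : E3 → ℝ} {c : ℝ≥0∞} (h : ∀ x, ‖f x‖ₑ ≤ c) :
    eLpNorm f ⊤ volume ≤ c := by
  rw [eLpNorm_exponent_top]
  exact eLpNormEssSup_le_of_ae_enorm_bound (Eventually.of_forall h)

/-- The essential supremum of a continuous function bounds it at every point. -/
theorem enorm_le_eLpNorm_top {f : E3 → ℝ} (hf : Continuous f) (x : E3) :
    ‖f x‖ₑ ≤ eLpNorm f ⊤ volume := by
  rw [eLpNorm_exponent_top]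
  have h1 : Dense {y | ‖f y‖ₑ ≤ eLpNormEssSup f volume} := Measure.dense_of_ae ae_le_eLpNormEssSup
  have h2 : IsClosed {y | ‖f y‖ₑ ≤ eLpNormEssSup f volume} := isClosed_le hf.enorm continuous_const
  have h3 := h2.closure_eq ▸ h1.closure_eq
  exact (h3 ▸ mem_univ x : x ∈ {y | ‖f y‖ₑ ≤ eLpNormEssSup f volume})

theorem Setup.continuous_zetaT {γ κ₀ M ε a T l L : ℝ} {fl : Fluid} {m : Modulation}
    (H : Setup γ κ₀ M ε a T l L fl m) {t : ℝ} (ht : t ∈ Ico (-ε) T) (hn : ‖m.n t‖ < 1)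
    (μ : Fin 2) : Continuous (m.zetaT fl μ t) := by
  have h1 : Continuous (fl.zeta t) := by
    rw [← continuousOn_univ]
    exact H.continuousOn_zeta.comp (f := fun x : E3 => (t, x)) (by fun_prop)
      (fun x _ => ⟨ht, mem_univ _⟩)
  have h2 : Continuous (m.fr μ.succ t) :=
    (show Differentiable ℝ (m.fr μ.succ t) from
      fun x => (hasFDerivAt_fr m μ.succ hn x).differentiableAt).continuous
  have : m.zetaT fl μ t = fun x => inner ℝ (fl.zeta t (m.physPos t x)) (m.fr μ.succ t x) :=
    funext fun x => zetaT_eq m fl μ t x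
  rw [this]
  exact (h1.comp (H.differentiable_physPos ht).continuous).inner h2

/-- The transport error `ε^{1/8}` is part of `source`, whose other term is nonnegative for either sign
of `a`. -/
theorem rpow_le_source {γ a ε t : ℝ} (hβ : 0 < betaOne γ) (ha : a ≠ 0) (ht : -ε ≤ t) :
    ε ^ (1 / 8 : ℝ) ≤ source γ a ε t := by
  have h0 : 0 ≤ t + ε := by linarith
  have : 0 ≤ (1 - damp γ a ε t) / (2 * betaOne γ * a) := by
    rcases lt_or_gt_of_ne ha with h | h
    · refine div_nonneg_of_nonpos ?_ ?_
      · have : 1 ≤ damp γ a ε t := by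
          rw [damp, Real.one_le_exp_iff]
          have : 2 * betaOne γ * a ≤ 0 := mul_nonpos_of_nonneg_of_nonpos (by positivity) h.le
          nlinarith
        linarith
      · exact mul_nonpos_of_nonneg_of_nonpos (by positivity) h.le
    · refine div_nonneg ?_ (by positivity)
      have : damp γ a ε t ≤ 1 := by
        rw [damp, Real.exp_le_one_iff]
        have : 0 ≤ 2 * betaOne γ * a * (t + ε) := by positivity
        linarith
      linarith
  unfold source
  linarith

/-- Transport along the particle path that ends at a given point. The initial vorticity is bounded at
every point, not only almost everywhere, because it is continuous. -/
theorem eventually_zetaT_bound {γ κ₀ M : ℝ} (hγ : 1 < γ) (hκ₀ : 1 < κ₀) (hM : 1 < M) :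
    ∀ᶠ ε in 𝓝[>] (0 : ℝ),
    ∀ (a T l L : ℝ) (fl : Fluid) (m : Modulation), Setup γ κ₀ M ε a T l L fl m → a ≠ 0 →
      ∀ t ∈ Ico (-ε) T, ∀ μ : Fin 2,
        eLpNorm (m.zetaT fl μ t) ⊤ volume
            ≤ ENNReal.ofReal (damp γ a ε t) * eLpNorm (m.zetaT fl μ (-ε)) ⊤ volume
              + ENNReal.ofReal (source γ a ε t) := by
  obtain ⟨C₁, hC₁, h1⟩ := exists_frameFacts hM
  obtain ⟨C₂, hC₂, h2⟩ := exists_stateFacts hγ hκ₀ hM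
  filter_upwards [eventually_pos, h1, h2, eventually_transport hγ hκ₀ hM]
    with ε hε h1 h2 h3 a T l L fl m H ha t ht μ
  have hl := left_mem ht
  have hn0 := (h1 γ κ₀ a T l L fl m H (-ε) hl).n_le
  refine eLpNorm_top_le_of_forall fun x => ?_
  obtain ⟨c, hc, hct⟩ := H.exists_particlePath
    (fun r hr => (h2 a T l L fl m H r hr).u_le) ht (m.physPos t x)
  have hx₀ := physPos_invPos m (hn0.trans (by norm_num)) (c (-ε))
  have key := h3 a T l L fl m H t ht μ c hc _ x hx₀.symm hct
  set x₀ := m.invPos (-ε) (c (-ε))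
  have hd : 0 < damp γ a ε t := Real.exp_pos _
  have hs := rpow_le_source (γ := γ) H.betaOne_pos ha ht.1
  have hs0 : 0 ≤ source γ a ε t := le_trans (by positivity) hs
  have hb : |m.zetaT fl μ t x| ≤ damp γ a ε t * |m.zetaT fl μ (-ε) x₀| + source γ a ε t := by
    have := abs_sub_abs_le_abs_sub (m.zetaT fl μ t x) (damp γ a ε t * m.zetaT fl μ (-ε) x₀)
    rw [abs_mul, abs_of_pos hd] at this
    linarith
  calc ‖m.zetaT fl μ t x‖ₑ = ENNReal.ofReal |m.zetaT fl μ t x| := by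
        rw [← Real.norm_eq_abs, ofReal_norm]
    _ ≤ ENNReal.ofReal (damp γ a ε t * |m.zetaT fl μ (-ε) x₀| + source γ a ε t) :=
        ENNReal.ofReal_le_ofReal hb
    _ = ENNReal.ofReal (damp γ a ε t) * ‖m.zetaT fl μ (-ε) x₀‖ₑ
        + ENNReal.ofReal (source γ a ε t) := by
        rw [ENNReal.ofReal_add (by positivity) hs0, ENNReal.ofReal_mul hd.le,
          ← Real.norm_eq_abs, ofReal_norm]
    _ ≤ _ := by
        gcongr
        exact enorm_le_eLpNorm_top (H.continuous_zetaT hl (hn0.trans_lt (by norm_num)) μ) x₀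

theorem eventually_zetaN_bound {γ κ₀ M : ℝ} (hγ : 1 < γ) (hκ₀ : 1 < κ₀) (hM : 1 < M) :
    ∀ᶠ ε in 𝓝[>] (0 : ℝ),
    ∀ (a T l L : ℝ) (fl : Fluid) (m : Modulation), Setup γ κ₀ M ε a T l L fl m →
      ∀ t ∈ Ico (-ε) T,
        eLpNorm (m.zetaN fl t) ⊤ volume ≤ ENNReal.ofReal (ε ^ (1 / 4 : ℝ)) := by
  obtain ⟨C, hC, h⟩ := exists_vortFacts hγ hκ₀ hM
  filter_upwards [eventually_pos, h,
    eventually_mul_rpow_le C (show (0:ℝ) < 1 / 4 by norm_num) one_pos]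
    with ε hε h hsm a T l L fl m H t ht
  refine eLpNorm_top_le_of_forall fun x => ?_
  rw [← ofReal_norm, Real.norm_eq_abs]
  refine ENNReal.ofReal_le_ofReal ?_
  rw [zetaN_eq]
  by_cases hx : x ∈ Box ε
  · refine (h a T l L fl m H t ht x hx).normal.trans ?_
    calc C * ε ^ (1 / 2 : ℝ) = C * ε ^ (1 / 4 : ℝ) * ε ^ (1 / 4 : ℝ) := by
          rw [mul_assoc, ← Real.rpow_add hε]; norm_num
      _ ≤ 1 * ε ^ (1 / 4 : ℝ) := by gcongr
      _ = _ := one_mul _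
  · rw [H.zeta_outside ht hx, inner_zero_left, abs_zero]
    positivity

/-! ### The damping factor at the shock time -/

/-- Second order expansion of the square of `e^{-v}` at `v ≈ ε b`. -/
theorem abs_exp_sq_sub_le {v b x C ε : ℝ} (hv : |v| ≤ 1) (hv' : |v| ≤ C * ε) (hb : |ε * b| ≤ 1)
    (hx : |v - ε * b| ≤ x * ε ^ 2) :
    |Real.exp (-(2 * v)) - (1 - ε * b) ^ 2| ≤ 5 * (C ^ 2 + x) * ε ^ 2 := by
  have h1 := Real.abs_exp_sub_one_sub_id_le (x := -v) (by rwa [abs_neg])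
  have h2 := Real.abs_exp_sub_one_le (x := -v) (by rwa [abs_neg])
  rw [abs_neg] at h2
  replace h2 : |Real.exp (-v) - 1| ≤ 2 := by linarith
  have h3 : v ^ 2 ≤ C ^ 2 * ε ^ 2 := by
    rw [← mul_pow, ← sq_abs v]
    exact pow_le_pow_left₀ (abs_nonneg _) hv' 2
  have e : Real.exp (-(2 * v)) = Real.exp (-v) ^ 2 := by
    rw [← Real.exp_nat_mul]; congr 1; push_cast; ring
  have h4 : |Real.exp (-v) - (1 - ε * b)| ≤ (C ^ 2 + x) * ε ^ 2 := by
    rw [abs_le] at *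
    constructor <;> nlinarith
  have h5 : |Real.exp (-v) + (1 - ε * b)| ≤ 5 := by
    rw [abs_le] at *
    constructor <;> linarith
  rw [e, sq_sub_sq, abs_mul, mul_assoc]
  exact mul_le_mul h5 h4 (abs_nonneg _) (by norm_num)

/-- At the shock time `T = lim τ = O(ε²)`. So `T + ε ≥ ε / 2`, and the bound on the damping over the
lifespan makes `a` itself bounded; then `β₁ a (T + ε) = ε β₁ a + O(ε²)`. -/
theorem exists_shock_bound {γ κ₀ M : ℝ} (hγ : 1 < γ) (hκ₀ : 1 < κ₀) (hM : 1 < M) :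
    ∃ C : ℝ, ∀ᶠ ε in 𝓝[>] (0 : ℝ),
    ∀ (a T l L : ℝ) (fl : Fluid) (m : Modulation), Setup γ κ₀ M ε a T l L fl m → -ε < T →
      IsShockTime m T → ∃ D : ℝ, Tendsto (damp γ a ε) (𝓝[<] T) (𝓝 D) ∧
        |D - (1 - ε * betaOne γ * a) ^ 2| ≤ C * ε ^ 2 := by
  obtain ⟨C₁, hC₁, h1⟩ := exists_tau_bound hγ hκ₀ hM
  obtain ⟨C₂, hC₂, h2⟩ := exists_damping_bound hγ hκ₀ hM
  refine ⟨5 * (C₂ ^ 2 + C₂ * C₁), ?_⟩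
  filter_upwards [eventually_pos, h1, h2,
    eventually_mul_rpow_le C₁ one_pos (show (0:ℝ) < 1 / 2 by norm_num),
    eventually_mul_rpow_le C₂ one_pos (show (0:ℝ) < 1 by norm_num)]
    with ε hε h1 h2 s1 s2 a T l L fl m H hT hshock
  rw [Real.rpow_one] at s1 s2
  have hmem : ∀ᶠ t in 𝓝[<] T, t ∈ Ico (-ε) T := Ico_mem_nhdsLT hT
  have hid : Tendsto (fun t : ℝ => t) (𝓝[<] T) (𝓝 T) := nhdsWithin_le_nhds
  have hτ : Tendsto m.τ (𝓝[<] T) (𝓝 T) := by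
    have := hshock.add hid
    simpa using this
  have hT1 : |T| ≤ C₁ * ε ^ 2 :=
    le_of_tendsto hτ.abs (hmem.mono fun t ht => h1 a T l L fl m H t ht)
  have hT2 : |2 * betaOne γ * a * (T + ε)| ≤ C₂ * ε :=
    le_of_tendsto ((hid.add_const ε).const_mul (2 * betaOne γ * a)).abs
      (hmem.mono fun t ht => h2 a T l L fl m H t ht)
  refine ⟨damp γ a ε T, ?_, ?_⟩
  · have : Continuous (damp γ a ε) := by unfold damp; fun_prop
    exact (this.tendsto T).mono_left nhdsWithin_le_nhds
  set b := betaOne γ * a with hb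
  have hv : |b * (T + ε)| ≤ 1 / 2 * (C₂ * ε) := by
    have e : 2 * betaOne γ * a * (T + ε) = 2 * (b * (T + ε)) := by rw [hb]; ring
    rw [e, abs_mul, abs_of_pos (by norm_num : (0:ℝ) < 2)] at hT2
    linarith
  have hTh : ε / 2 ≤ T + ε := by
    have := (abs_le.mp hT1).1
    nlinarith
  have hbb : |b| ≤ C₂ := by
    rw [abs_mul, abs_of_pos (by linarith : 0 < T + ε)] at hv
    have : |b| * (ε / 2) ≤ C₂ * (ε / 2) := by
      have := mul_le_mul_of_nonneg_left hTh (abs_nonneg b)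
      linarith
    exact le_of_mul_le_mul_right this (by linarith)
  have e1 : damp γ a ε T = Real.exp (-(2 * (b * (T + ε)))) := by
    rw [damp, hb]; ring_nf
  have e2 : ε * betaOne γ * a = ε * b := by rw [hb]; ring
  rw [e1, e2]
  have hεC : 0 < C₂ * ε := by positivity
  refine abs_exp_sq_sub_le (by linarith) (by linarith) ?_ ?_
  · rw [abs_mul, abs_of_pos hε]
    calc ε * |b| ≤ ε * C₂ := by gcongr
      _ ≤ 1 := by linarith
  · have : b * (T + ε) - ε * b = b * T := by ring
    rw [this, abs_mul, mul_assoc]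
    exact mul_le_mul hbb hT1 (abs_nonneg _) hC₂.le

/-! ### Strong damping -/

theorem norm_le_of_frame {q : E2 × (Fin 2 → ℝ)} (hn : ‖q.1‖ ≤ 1) {v : E3} {b : ℝ}
    (hb : ∀ i, |inner ℝ v (frame i q)| ≤ b) : ‖v‖ ≤ 3 * b := by
  have e := frame_norm hn
  rw [frame_complete hn v]
  refine norm_add₃_le.trans ?_
  simp only [norm_smul, e, mul_one, Real.norm_eq_abs]
  linarith [hb 0, hb 1, hb 2]

theorem opNorm_le_of_frame {G : Type*} [NormedAddCommGroup G] [NormedSpace ℝ G]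
    {q : E2 × (Fin 2 → ℝ)} (hn : ‖q.1‖ ≤ 1) {D : E3 →L[ℝ] G} {b : ℝ}
    (hb : ∀ i, ‖D (frame i q)‖ ≤ b) : ‖D‖ ≤ 3 * b := by
  have hb0 : 0 ≤ b := (norm_nonneg _).trans (hb 0)
  refine D.opNorm_le_bound (by positivity) fun v => ?_
  have hv : ∀ i, |inner ℝ v (frame i q)| ≤ ‖v‖ := fun i => by
    simpa [frame_norm hn] using abs_real_inner_le_norm v (frame i q)
  have hi : ∀ i, ‖inner ℝ v (frame i q) • D (frame i q)‖ ≤ ‖v‖ * b := fun i => by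
    rw [norm_smul]
    exact mul_le_mul (hv i) (hb i) (norm_nonneg _) (norm_nonneg _)
  conv_lhs => rw [frame_complete hn v]
  simp only [map_add, map_smul]
  refine norm_add₃_le.trans ?_
  linarith [hi 0, hi 1, hi 2]

/-- Since `a ≥ 2 / (β₁ ε)` and `a (t + ε) = O(ε)`, the lifespan is `O(ε²)`, and so is `τ`: the blow-up
time is never approached, and all gradient bounds are finite. -/
theorem eventually_strong_damping {γ κ₀ M : ℝ} (hγ : 1 < γ) (hκ₀ : 1 < κ₀) (hM : 1 < M) :
    ∀ᶠ ε in 𝓝[>] (0 : ℝ),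
    ∀ (a T l L : ℝ) (fl : Fluid) (m : Modulation), Setup γ κ₀ M ε a T l L fl m →
      2 / (betaOne γ * ε) ≤ a →
      (∃ δ : ℝ, 0 < δ ∧ ∀ t ∈ Ico (-ε) T, δ ≤ m.τ t - t) ∧
      (∃ B : ℝ, ∀ t ∈ Ico (-ε) T, ∀ x : E3,
        ‖fderiv ℝ (fl.u t) x‖ ≤ B ∧ ‖fderiv ℝ (fl.ρ t) x‖ ≤ B ∧ ‖fderiv ℝ (fl.k t) x‖ ≤ B) := by
  obtain ⟨C₁, hC₁, h1⟩ := exists_frameFacts hM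
  obtain ⟨C₂, hC₂, h2⟩ := exists_stateFacts hγ hκ₀ hM
  obtain ⟨C₃, hC₃, h3⟩ := exists_gradFacts hγ hκ₀ hM
  obtain ⟨C₄, hC₄, h4⟩ := exists_damping_bound hγ hκ₀ hM
  obtain ⟨C₅, hC₅, h5⟩ := exists_tau_bound hγ hκ₀ hM
  filter_upwards [eventually_pos, eventually_le_const one_pos, h1, h2, h3, h4, h5,
    eventually_mul_rpow_le (C₄ + C₅) one_pos (show (0:ℝ) < 1 / 2 by norm_num)]
    with ε hε hε1 h1 h2 h3 h4 h5 hsm a T l L fl m H ha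
  rw [Real.rpow_one] at hsm
  have hβ := H.betaOne_pos
  have hα := H.alpha_pos
  have hab : 2 ≤ betaOne γ * a * ε := by
    rw [div_le_iff₀ (by positivity)] at ha
    linarith
  have hgap : ∀ t ∈ Ico (-ε) T, ε / 2 ≤ m.τ t - t := by
    intro t ht
    have k1 := (abs_le.mp (h5 a T l L fl m H t ht)).1
    have k2 := (le_abs_self _).trans (h4 a T l L fl m H t ht)
    have h0 : 0 ≤ t + ε := by linarith [ht.1]
    have k3 : 2 * (t + ε) ≤ betaOne γ * a * ε * (t + ε) := mul_le_mul_of_nonneg_right hab h0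
    have k4 : betaOne γ * a * ε * (t + ε) ≤ C₄ * ε * ε := by
      have k5 := mul_le_mul_of_nonneg_right k2 hε.le
      have : 0 ≤ betaOne γ * a * ε * (t + ε) := le_trans (by positivity) k3
      linarith
    have k6 : (C₄ + C₅) * ε * ε ≤ 1 / 2 * ε := by gcongr
    have k7 : 0 < C₄ * ε * ε := by positivity
    linarith
  refine ⟨⟨ε / 2, by positivity, hgap⟩, ?_⟩
  obtain ⟨G, hG⟩ : ∃ G, G = C₃ * (1 + (ε / 2)⁻¹ * (ε⁻¹ + 2)) := ⟨_, rfl⟩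
  have hCG : C₃ ≤ G := by
    have : 0 < C₃ * ((ε / 2)⁻¹ * (ε⁻¹ + 2)) := by positivity
    rw [hG, mul_add, mul_one]; linarith
  have hGp : 0 < G := hC₃.trans_le hCG
  obtain ⟨R, hR⟩ : ∃ R, R = C₂ / (alphaC γ * (κ₀ / 8)) * (3 * G) +
    C₂ / (2 * alphaC γ) * (3 * G) := ⟨_, rfl⟩
  have hRp : 0 < R := by rw [hR]; positivity
  refine ⟨3 * (3 * G) + R, fun t ht p => ?_⟩
  have F := h1 γ κ₀ a T l L fl m H t ht
  have S := h2 a T l L fl m H t ht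
  have hn1 : ‖m.n t‖ ≤ 1 := F.n_le.trans (by norm_num)
  have hp := physPos_invPos m hn1 p
  set x := m.invPos t p with hx
  by_cases hbox : x ∈ Box ε
  swap
  · obtain ⟨c1, c2, -⟩ := H.const t ht x hbox
    have c3 := H.fderiv_k_outside ht hn1 hbox
    rw [hp] at c1 c2 c3
    rw [c1, c2, c3]
    simp only [norm_zero]
    refine ⟨?_, ?_, ?_⟩ <;> positivity
  have D := h3 a T l L fl m H t ht x hbox
  have hw := H.pd_w_zero_le ht (F.n_le.trans_lt (by norm_num)) hbox
  have hw' : |pd 0 (m.w γ fl t) x| ≤ (ε / 2)⁻¹ * (ε⁻¹ + 2) := by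
    refine hw.trans ?_
    have := hgap t ht
    gcongr
  have hGw : C₃ * (1 + |pd 0 (m.w γ fl t) x|) ≤ G := by
    rw [hG]; gcongr
  have e2 : C₃ * ε ^ (1 / 2 : ℝ) ≤ G :=
    (mul_le_of_le_one_right hC₃.le (Real.rpow_le_one hε.le hε1 (by norm_num))).trans hCG
  have e8 : C₃ * ε ^ (1 / 8 : ℝ) ≤ G :=
    (mul_le_of_le_one_right hC₃.le (Real.rpow_le_one hε.le hε1 (by norm_num))).trans hCG
  have hu : ‖fderiv ℝ (fl.u t) p‖ ≤ 3 * (3 * G) := by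
    refine opNorm_le_of_frame (q := (m.n t, m.frontD t x)) hn1 fun j =>
      norm_le_of_frame (q := (m.n t, m.frontD t x)) hn1 fun i => ?_
    have utt := D.u_tt
    have utn := D.u_tn
    have unt := D.u_nt
    have unn := D.u_nn
    rw [hp] at utt utn unt unn
    refine Fin.cases ?_ (fun μ => ?_) j <;> refine Fin.cases ?_ (fun ν => ?_) i
    · exact unn.trans hGw
    · exact (unt ν).trans hCG
    · exact (utn μ).trans hCG
    · exact (utt μ ν).trans e2
  have hσ : ‖fderiv ℝ (fl.sigma γ t) p‖ ≤ 3 * G := by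
    refine opNorm_le_of_frame (q := (m.n t, m.frontD t x)) hn1 fun j => ?_
    have s1 := D.sigma_t
    have s2 := D.sigma_n
    rw [hp] at s1 s2
    refine Fin.cases ?_ (fun μ => ?_) j
    · exact s2.trans hGw
    · exact (s1 μ).trans hCG
  have hk : ‖fderiv ℝ (fl.k t) p‖ ≤ 3 * G := by
    refine opNorm_le_of_frame (q := (m.n t, m.frontD t x)) hn1 fun j => ?_
    have s1 := D.k_le
    rw [hp] at s1
    exact (s1 j).trans e8
  have hρ : ‖fderiv ℝ (fl.ρ t) p‖ ≤ R := by
    have hρp := H.euler.pos t ht p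
    have hσp := H.sigma_pos ht p
    have e : fderiv ℝ (fl.ρ t) p = (fl.ρ t p / (alphaC γ * fl.sigma γ t p)) •
        fderiv ℝ (fl.sigma γ t) p - (fl.ρ t p / (2 * alphaC γ)) • fderiv ℝ (fl.k t) p := by
      rw [H.fderiv_sigma ht]
      ext v
      simp only [sub_apply, add_apply, smul_apply, smul_eq_mul]
      field_simp
      ring
    rw [e, hR]
    refine (norm_sub_le _ _).trans ?_
    rw [norm_smul, norm_smul, Real.norm_eq_abs, Real.norm_eq_abs, abs_of_pos (by positivity),
      abs_of_pos (by positivity)]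
    have r1 := S.rho_le p
    have r2 := S.sigma_ge p
    have hκ : 0 < κ₀ := by linarith
    gcongr
  refine ⟨by linarith, by linarith, by linarith⟩

end DampedEuler

theorem proposition7p2 (γ κ₀ M : ℝ) (hγ : 1 < γ) (hκ₀ : 1 < κ₀) (hM : 1 < M) :
    ∃ ε₀ : ℝ, 0 < ε₀ ∧ ∃ C : ℝ, ∀ ε : ℝ, 0 < ε → ε < ε₀ →
      ∀ a : ℝ, a ≠ 0 → ∀ T : ℝ, -ε < T → ∀ l L : ℝ, 0 < l → l ≤ L →
      ∀ (fl : Fluid) (m : Modulation),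
        IsEulerSolution γ a ε T fl →
        IsModulated γ κ₀ ε T fl m →
        IsConstantOutside ε T fl m →
        Bootstrap γ a κ₀ M ε T l L fl m →
        -- the normal component is small
        (∀ t ∈ Ico (-ε) T,
          eLpNorm (m.zetaN fl t) ⊤ volume ≤ ENNReal.ofReal (ε ^ (1 / 4 : ℝ))) ∧
        -- the bound for the tangential components
        (∀ t ∈ Ico (-ε) T, ∀ μ : Fin 2,
          eLpNorm (m.zetaT fl μ t) ⊤ volume
            ≤ ENNReal.ofReal (damp γ a ε t) * eLpNorm (m.zetaT fl μ (-ε)) ⊤ volume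
              + ENNReal.ofReal (source γ a ε t)) ∧
        -- along particle paths, initial tangential vorticity is multiplied by the damping factor
        (∀ t ∈ Ico (-ε) T, ∀ μ : Fin 2, ∀ c : ℝ → E3, IsParticlePath γ ε fl t c →
          ∀ x₀ x : E3, c (-ε) = m.physPos (-ε) x₀ → c t = m.physPos t x →
            |m.zetaT fl μ t x - damp γ a ε t * m.zetaT fl μ (-ε) x₀| ≤ source γ a ε t) ∧
        -- the damping factor at the shock time
        (IsShockTime m T →
          ∃ D : ℝ, Tendsto (damp γ a ε) (𝓝[<] T) (𝓝 D) ∧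
            |D - (1 - ε * betaOne γ * a) ^ 2| ≤ C * ε ^ 2) ∧
        -- anti-damping: amplification
        (a < 0 → damp γ a ε (-ε) = 1 ∧ StrictMonoOn (damp γ a ε) (Ico (-ε) T)) ∧
        -- weak damping: dissipation
        (0 < a → a ≤ 1 / (2 * betaOne γ * ε) →
          damp γ a ε (-ε) = 1 ∧ StrictAntiOn (damp γ a ε) (Ico (-ε) T)) ∧
        -- strong damping: no singularity, and exponential decay
        (2 / (betaOne γ * ε) ≤ a →
          (∃ δ : ℝ, 0 < δ ∧ ∀ t ∈ Ico (-ε) T, δ ≤ m.τ t - t) ∧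
          (∃ B : ℝ, ∀ t ∈ Ico (-ε) T, ∀ x : E3,
            ‖fderiv ℝ (fl.u t) x‖ ≤ B ∧ ‖fderiv ℝ (fl.ρ t) x‖ ≤ B ∧
              ‖fderiv ℝ (fl.k t) x‖ ≤ B) ∧
          (∀ t ∈ Ico (-ε) T, ∀ μ : Fin 2,
            eLpNorm (m.zetaT fl μ t) ⊤ volume
              ≤ ENNReal.ofReal (Real.exp (-(4 * (t + ε) / ε)))
                  * eLpNorm (m.zetaT fl μ (-ε)) ⊤ volume
                + ENNReal.ofReal (ε / 4 + ε ^ (1 / 8 : ℝ)))) := by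
  obtain ⟨C, hshock⟩ := exists_shock_bound hγ hκ₀ hM
  have hall := (eventually_zetaN_bound hγ hκ₀ hM).and ((eventually_zetaT_bound hγ hκ₀ hM).and
    ((eventually_transport hγ hκ₀ hM).and (hshock.and (eventually_strong_damping hγ hκ₀ hM))))
  obtain ⟨ε₀, hε₀, hsub⟩ := mem_nhdsGT_iff_exists_Ioo_subset.mp hall
  refine ⟨ε₀, hε₀, C, fun ε hε hεlt a ha T hT l L _ _ fl m hE hMod hconst hboot => ?_⟩
  obtain ⟨hN, hTan, htrans, hsh, hstrong⟩ := hsub ⟨hε, hεlt⟩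
  have H : Setup γ κ₀ M ε a T l L fl m := ⟨hγ, hκ₀, hM, hε, hE, hMod, hconst, hboot⟩
  have hβ := H.betaOne_pos
  have hinit : damp γ a ε (-ε) = 1 := by simp [damp]
  refine ⟨hN a T l L fl m H, hTan a T l L fl m H ha, ?_, hsh a T l L fl m H hT, ?_, ?_, ?_⟩
  · intro t ht μ c hc x₀ x hx₀ hx
    exact (htrans a T l L fl m H t ht μ c hc x₀ x hx₀ hx).trans (rpow_le_source hβ ha ht.1)
  · intro hneg
    refine ⟨hinit, fun r _ s _ hrs => Real.exp_lt_exp.mpr ?_⟩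
    have : 2 * betaOne γ * a < 0 := mul_neg_of_pos_of_neg (by positivity) hneg
    nlinarith
  · intro hpos _
    refine ⟨hinit, fun r _ s _ hrs => Real.exp_lt_exp.mpr ?_⟩
    have : 0 < 2 * betaOne γ * a := by positivity
    nlinarith
  · intro hge
    obtain ⟨hδ, hB⟩ := hstrong a T l L fl m H hge
    refine ⟨hδ, hB, fun t ht μ => (hTan a T l L fl m H ha t ht μ).trans ?_⟩
    have hab : 4 / ε ≤ 2 * betaOne γ * a := by
      rw [div_le_iff₀ (by positivity)] at hge ⊢
      linarith
    have h0 : 0 ≤ t + ε := by linarith [ht.1]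
    gcongr
    · refine Real.exp_le_exp.mpr (neg_le_neg ?_)
      rw [mul_div_right_comm]
      exact mul_le_mul_of_nonneg_right hab h0
    · have h4 : 0 < 4 / ε := by positivity
      refine add_le_add ?_ le_rfl
      calc (1 - damp γ a ε t) / (2 * betaOne γ * a) ≤ 1 / (4 / ε) := by
            have : 0 < damp γ a ε t := Real.exp_pos _
            exact div_le_div₀ zero_le_one (by linarith) h4 hab
        _ = ε / 4 := by field_simp
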